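/- **Setting.** Let $m\ge 2$, $n_1,\dots,n_m\ge 1$, $n=\sum_i n_i$. Consider $$\min\{c^\top x : Ax=b,\ x\in\textstyle\prod_{i=1}^m K_i\},\qquad A\in\mathbb R^{d\times n},$$ where the $K_i\subset\mathbb R^{n_i}$ are compact convex sets, $A$ has linearly independent rows and the problem is feasible. For each $i$ let $\phi_i$ be a $\nu_i$-self-concordant barrier for $K_i$: $\phi_i$ is $C^3$ on $\operatorname{int}K_i$ with positive definite Hessian, tends to $+\infty$ at the boundary of $K_i$, and for all $x\in\operatorname{int}K_i$ and $u\in\mathbb R^{n_i}$ $$|D^3\phi_i(x)[u,u,u]|\le 2\|u\|_x^3,\qquad \|\nabla\phi_i(x)\|_x^*\le\sqrt{\nu_i},$$ where $\|u\|_M=(u^\top Mu)^{1/2}$, $\|u\|_x=\|u\|_{\nabla^2\phi_i(x)}$ and $\|u\|^*_x=\|u\|_{\nabla^2\phi_i(x)^{-1}}$. Let $\nu=\sum_{i=1}^m\nu_i$ and $x^{(0)}=\arg\min_x\sum_i\phi_i(x_i)$. Assume $\|x\|_2\le R$ for all $x\in\prod_iK_i$ and $\|c\|_2\le L$, and let $\delta>0$.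 **Algorithm RobustIPM.** Put $\lambda=2^{16}\log m$, $\alpha=2^{-20}\lambda^{-2}$, $\kappa=2^{-10}\alpha$, $\delta'=\min(1/\lambda,\delta)$. Add a block $K_{m+1}=\mathbb R_+$ with $\phi_{m+1}=-\log$, and put $\overline A=[A\mid b-Ax^{(0)}]$, $\overline c=\big[\tfrac{\delta'}{LR}c;\,1\big]$ (with $\frac{\delta'}{LR}c=0$ if $L=0$). For $x,s\in\mathbb R^{n+1}$, $t>0$ and $i\in[m+1]$ let $$\mu_i^t(x,s)=\tfrac{s_i}{t}+\nabla\phi_i(x_i),\quad \gamma_i^t(x,s)=\|\mu_i^t(x,s)\|^*_{x_i},\quad \Phi^t(x,s)=\sum_{i=1}^{m+1}\exp(\lambda\gamma^t_i(x,s)),$$ $$c_i^t(x,s)=\frac{\exp(\lambda\gamma_i^t(x,s))/\gamma_i^t(x,s)}{\big(\sum_{j=1}^{m+1}\exp(2\lambda\gamma_j^t(x,s))\big)^{1/2}}\ \text{ if }\gamma_i^t(x,s)\ge 96\sqrt\alpha,\qquad c_i^t(x,s)=0\ \text{ otherwise}.$$ Start with $x=[x^{(0)};1]$, $s=\overline c$,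 $t=1$. While $t>\delta'^2/(4\nu)$: 1. take any $\overline x,\overline s$ with, for all $i\in[m+1]$, $\overline x_i\in\operatorname{int}K_i$, $\|\overline x_i-x_i\|_{\overline x_i}<\alpha$ and $\|\overline s_i-s_i\|^*_{\overline x_i}<t\alpha$; 2. take any block diagonal $\widetilde V$ with $(1-\alpha)\nabla^2\phi_i(\overline x_i)^{-1}\preceq\widetilde V_i\preceq(1+\alpha)\nabla^2\phi_i(\overline x_i)^{-1}$ for all $i\in[m+1]$; 3. let $h_i=-\alpha\,c_i^t(\overline x,\overline s)\,\mu_i^t(\overline x,\overline s)$ and $\widetilde P=\widetilde V^{1/2}\overline A^\top(\overline A\widetilde V\overline A^\top)^{-1}\overline A\widetilde V^{1/2}$; 4. replace $x$ by $x+\widetilde V^{1/2}(I-\widetilde P)\widetilde V^{1/2}h$, then $s$ by $s+t\,\widetilde V^{-1/2}\widetilde P\widetilde V^{1/2}h$, then $t$ by $(1-\kappa/\sqrt\nu)\,t$. Return the first $n$ coordinates of $x$. **Theorem.** There is an absolute constant $C$ such that, in this setting and for every choice of $\overline x,\overline s,\widetilde V$ in the iterations: 1. At the start and after every iteration, $x_i\in\operatorname{int}K_i$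 for all $i\in[m+1]$ and $\Phi^t(x,s)\le 80\,m/\alpha$; and as long as $t>\delta'^2/(4\nu)$, admissible $\overline x,\overline s,\widetilde V$ exist. 2. The loop makes at most $C\sqrt\nu\,\log^2 m\,\log\big(\nu/\min(\delta,1)\big)$ iterations, so the algorithm terminates. 3. The returned vector $x$ satisfies $$c^\top x\le\min_{Az=b,\ z\in\prod_iK_i}c^\top z+LR\,\delta,\qquad \|Ax-b\|_1\le 3\delta\Big(R\sum_{i,j}|A_{i,j}|+\|b\|_1\Big),\qquad x\in\prod_{i=1}^mK_i.$$ -/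

import Mathlib

open Filter Topology

noncomputable section

namespace RobustIPM

/-! ### Norms and derivatives in coordinates -/

/-- The Euclidean norm of a coordinate vector. -/
def l2Norm {J : Type} [Fintype J] (v : J → ℝ) : ℝ := √(∑ j, v j ^ 2)

/-- The `ℓ¹` norm of a coordinate vector. -/
def l1Norm {J : Type} [Fintype J] (v : J → ℝ) : ℝ := ∑ j, |v j|

/-- `‖v‖_M = (vᵀ M v)^{1/2}`. -/
def matNorm {J : Type} [Fintype J] (M : Matrix J J ℝ) (v : J → ℝ) : ℝ :=
  √(v ⬝ᵥ M.mulVec v)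

/-- The gradient `∇φ(x)`. -/
def grad {k : ℕ} (φ : (Fin k → ℝ) → ℝ) (x : Fin k → ℝ) : Fin k → ℝ :=
  fun j => fderiv ℝ φ x (Pi.single j 1)

/-- The Hessian matrix `∇²φ(x)`. -/
def hess {k : ℕ} (φ : (Fin k → ℝ) → ℝ) (x : Fin k → ℝ) : Matrix (Fin k) (Fin k) ℝ :=
  Matrix.of fun j l => iteratedFDeriv ℝ 2 φ x ![Pi.single j 1, Pi.single l 1]

/-- `φ` is a (closed, nondegenerate) `ν`-self-concordant barrier for the closed convex set `K`.
Its domain is the interior of `K`; the values of `φ` elsewhere are irrelevant. -/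
structure IsSelfConcordantBarrier {k : ℕ} (ν : ℝ) (K : Set (Fin k → ℝ))
    (φ : (Fin k → ℝ) → ℝ) : Prop where
  contDiffOn : ContDiffOn ℝ 3 φ (interior K)
  tendsto_frontier : ∀ z ∈ frontier K, Tendsto φ (𝓝[interior K] z) atTop
  hess_posDef : ∀ x ∈ interior K, (hess φ x).PosDef
  third_deriv_le : ∀ x ∈ interior K, ∀ u : Fin k → ℝ,
    |iteratedFDeriv ℝ 3 φ x ![u, u, u]| ≤ 2 * matNorm (hess φ x) u ^ 3
  grad_le : ∀ x ∈ interior K, matNorm (hess φ x)⁻¹ (grad φ x) ≤ √ν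

/-! ### Block-structured programs -/

/-- The data of the program `min cᵀx` subject to `Ax = b`, `x_i ∈ K_i`, with a function `φ_i` for
every block.  Vectors are indexed by pairs (block, coordinate in the block). -/
structure BlockProgram (ι : Type) (n : ι → ℕ) (d : ℕ) where
  K : ∀ i, Set (Fin (n i) → ℝ)
  φ : ∀ i, (Fin (n i) → ℝ) → ℝ
  A : Matrix (Fin d) (Σ i, Fin (n i)) ℝ
  b : Fin d → ℝ
  c : (Σ i, Fin (n i)) → ℝ

/-- The `i`-th block of a vector. -/
def blk {ι : Type} {n : ι → ℕ} (x : (Σ i, Fin (n i)) → ℝ) (i : ι) : Fin (n i) → ℝ :=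
  fun j => x ⟨i, j⟩

section Program

variable {ι : Type} {n : ι → ℕ} {d : ℕ}

/-- The feasible set `{x : Ax = b, x ∈ ∏ K_i}`. -/
def BlockProgram.feasible [Fintype ι] (P : BlockProgram ι n d) : Set ((Σ i, Fin (n i)) → ℝ) :=
  {x | P.A.mulVec x = P.b ∧ ∀ i, blk x i ∈ P.K i}

/-- `x = argmin ∑ φ_i(x_i)` (over the domain of the barriers). -/
def BlockProgram.IsAnalyticCenter [Fintype ι] (P : BlockProgram ι n d)
    (x : (Σ i, Fin (n i)) → ℝ) : Prop :=
  (∀ i, blk x i ∈ interior (P.K i)) ∧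
    ∀ z : (Σ i, Fin (n i)) → ℝ, (∀ i, blk z i ∈ interior (P.K i)) →
      ∑ i, P.φ i (blk x i) ≤ ∑ i, P.φ i (blk z i)

/-- The Hessian `∇²φ_i(x_i)` of the `i`-th block. -/
def BlockProgram.H (P : BlockProgram ι n d) (x : (Σ i, Fin (n i)) → ℝ) (i : ι) :
    Matrix (Fin (n i)) (Fin (n i)) ℝ :=
  hess (P.φ i) (blk x i)

/-- `μ_i^t(x,s) = s_i / t + ∇φ_i(x_i)`. -/
def BlockProgram.mu (P : BlockProgram ι n d) (t : ℝ) (x s : (Σ i, Fin (n i)) → ℝ) (i : ι) :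
    Fin (n i) → ℝ :=
  t⁻¹ • blk s i + grad (P.φ i) (blk x i)

/-- `γ_i^t(x,s) = ‖μ_i^t(x,s)‖_{∇²φ_i(x_i)⁻¹}`. -/
def BlockProgram.gam (P : BlockProgram ι n d) (t : ℝ) (x s : (Σ i, Fin (n i)) → ℝ) (i : ι) : ℝ :=
  matNorm (P.H x i)⁻¹ (P.mu t x s i)

/-- The soft-max potential `Φ^t(x,s) = ∑ exp(lam γ_i^t(x,s))`. -/
def BlockProgram.potential [Fintype ι] (P : BlockProgram ι n d) (lam t : ℝ)
    (x s : (Σ i, Fin (n i)) → ℝ) : ℝ :=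
  ∑ i, Real.exp (lam * P.gam t x s i)

open Classical in
/-- The step coefficient `c_i^t(x,s)`. -/
def BlockProgram.coef [Fintype ι] (P : BlockProgram ι n d) (lam α t : ℝ)
    (x s : (Σ i, Fin (n i)) → ℝ) (i : ι) : ℝ :=
  if 96 * √α ≤ P.gam t x s i then
    (Real.exp (lam * P.gam t x s i) / P.gam t x s i) /
      √(∑ j, Real.exp (2 * lam * P.gam t x s j))
  else 0

/-- The centering direction, `h_i = -α c_i^t(x,s) μ_i^t(x,s)`. -/
def BlockProgram.dir [Fintype ι] (P : BlockProgram ι n d) (lam α t : ℝ)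
    (x s : (Σ i, Fin (n i)) → ℝ) : (Σ i, Fin (n i)) → ℝ :=
  fun p => -α * P.coef lam α t x s p.1 * P.mu t x s p.1 p.2

end Program

/-! ### The projection and the step -/

open scoped MatrixOrder in
/-- The positive semidefinite square root `V^{1/2}`. -/
def msqrt {J : Type} [Fintype J] [DecidableEq J] (V : Matrix J J ℝ) : Matrix J J ℝ := CFC.sqrt V

/-- `P = V^{1/2} Aᵀ (A V Aᵀ)⁻¹ A V^{1/2}`. -/
def proj {J : Type} [Fintype J] [DecidableEq J] {d : ℕ} (A : Matrix (Fin d) J ℝ)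
    (V : Matrix J J ℝ) : Matrix J J ℝ :=
  msqrt V * A.transpose * (A * V * A.transpose)⁻¹ * A * msqrt V

/-- `δ_x = V^{1/2} (I - P) V^{1/2} h`. -/
def deltaX {J : Type} [Fintype J] [DecidableEq J] {d : ℕ} (A : Matrix (Fin d) J ℝ)
    (V : Matrix J J ℝ) (h : J → ℝ) : J → ℝ :=
  (msqrt V * (1 - proj A V) * msqrt V).mulVec h

/-- `δ_s = t V^{-1/2} P V^{1/2} h`. -/
def deltaS {J : Type} [Fintype J] [DecidableEq J] {d : ℕ} (A : Matrix (Fin d) J ℝ)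
    (V : Matrix J J ℝ) (t : ℝ) (h : J → ℝ) : J → ℝ :=
  t • ((msqrt V)⁻¹ * proj A V * msqrt V).mulVec h

/-- The variables of the loop. -/
structure State (ι : Type) (n : ι → ℕ) where
  x : (Σ i, Fin (n i)) → ℝ
  s : (Σ i, Fin (n i)) → ℝ
  t : ℝ

section Loop

variable {ι : Type} [Fintype ι] [DecidableEq ι] {n : ι → ℕ} {d : ℕ}

/-- The approximations `x'` of `x`, `s'` of `s` and `V` of the inverse Hessian that an iteration
may use. -/
structure BlockProgram.Approx (P : BlockProgram ι n d) (α : ℝ) (σ : State ι n)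
    (x' s' : (Σ i, Fin (n i)) → ℝ) (V : ∀ i, Matrix (Fin (n i)) (Fin (n i)) ℝ) : Prop where
  mem : ∀ i, blk x' i ∈ interior (P.K i)
  near_x : ∀ i, matNorm (P.H x' i) (blk x' i - blk σ.x i) < α
  near_s : ∀ i, matNorm (P.H x' i)⁻¹ (blk s' i - blk σ.s i) < σ.t * α
  lower : ∀ i, (V i - (1 - α) • (P.H x' i)⁻¹).PosSemidef
  upper : ∀ i, ((1 + α) • (P.H x' i)⁻¹ - V i).PosSemidef

/-- The state after an iteration that uses the approximations `x'`, `s'`, `V`. -/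
def BlockProgram.next (P : BlockProgram ι n d) (lam α κ ν : ℝ) (σ : State ι n)
    (x' s' : (Σ i, Fin (n i)) → ℝ) (V : ∀ i, Matrix (Fin (n i)) (Fin (n i)) ℝ) : State ι n where
  x := σ.x + deltaX P.A (Matrix.blockDiagonal' V) (P.dir lam α σ.t x' s')
  s := σ.s + deltaS P.A (Matrix.blockDiagonal' V) σ.t (P.dir lam α σ.t x' s')
  t := (1 - κ / √ν) * σ.t

/-- `P.Reaches lam α κ ν τ σ₀ k σ`: the loop `while t > τ`, started in `σ₀`, can be in the state
`σ` after exactly `k` iterations, for some choice of the approximations in each iteration. -/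
inductive BlockProgram.Reaches (P : BlockProgram ι n d) (lam α κ ν τ : ℝ) (σ₀ : State ι n) :
    ℕ → State ι n → Prop
  | start : P.Reaches lam α κ ν τ σ₀ 0 σ₀
  | iterate {k : ℕ} {σ : State ι n} (x' s' : (Σ i, Fin (n i)) → ℝ)
      (V : ∀ i, Matrix (Fin (n i)) (Fin (n i)) ℝ) :
      P.Reaches lam α κ ν τ σ₀ k σ → τ < σ.t → P.Approx α σ x' s' V →
      P.Reaches lam α κ ν τ σ₀ (k + 1) (P.next lam α κ ν σ x' s' V)

end Loop

/-! ### The modified program, with one more block `ℝ₊` -/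

/-- The block dimensions of the modified program. -/
abbrev extDim {ι : Type} (n : ι → ℕ) : Option ι → ℕ
  | none => 1
  | some i => n i

/-- The vector with blocks `x_i` and the number `a` in the additional block. -/
def extVec {ι : Type} {n : ι → ℕ} (x : (Σ i, Fin (n i)) → ℝ) (a : ℝ) :
    (Σ o, Fin (extDim n o)) → ℝ
  | ⟨none, _⟩ => a
  | ⟨some i, j⟩ => x ⟨i, j⟩

/-- The original coordinates of a vector of the modified program. -/
def restrict {ι : Type} {n : ι → ℕ} (x : (Σ o, Fin (extDim n o)) → ℝ) : (Σ i, Fin (n i)) → ℝ :=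
  fun p => x ⟨some p.1, p.2⟩

/-- The modified program: the additional block is `ℝ₊` with barrier `-log`, and
`Ā = [A | b - A x₀]`, `b̄ = b`, `c̄ = [δ/(LR) c ; 1]`. -/
def BlockProgram.modified {ι : Type} [Fintype ι] {n : ι → ℕ} {d : ℕ} (P : BlockProgram ι n d)
    (x₀ : (Σ i, Fin (n i)) → ℝ) (L R δ : ℝ) : BlockProgram (Option ι) (extDim n) d where
  K
    | none => {z : Fin 1 → ℝ | 0 ≤ z 0}
    | some i => P.K i
  φ
    | none => fun z : Fin 1 → ℝ => -Real.log (z 0)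
    | some i => P.φ i
  A := Matrix.of fun r => extVec (P.A r) (P.b r - P.A.mulVec x₀ r)
  b := P.b
  c := extVec ((δ / (L * R)) • P.c) 1

/-! ### The algorithm -/

/-- `λ = 2^16 log m`. -/
def lamOf (m : ℕ) : ℝ := 2 ^ 16 * Real.log m

/-- `α = 2^{-20} λ^{-2}`. -/
def alphaOf (m : ℕ) : ℝ := 1 / (2 ^ 20 * lamOf m ^ 2)

/-- `κ = 2^{-10} α`. -/
def kappaOf (m : ℕ) : ℝ := alphaOf m / 2 ^ 10

/-- The accuracy `min (1/λ) δ` that is used internally. -/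
def deltaOf (m : ℕ) (δ : ℝ) : ℝ := min (1 / lamOf m) δ

section Algorithm

variable {m : ℕ} {n : Fin m → ℕ} {d : ℕ}

/-- The program that the algorithm works on. -/
def BlockProgram.work (P : BlockProgram (Fin m) n d) (x₀ : (Σ i, Fin (n i)) → ℝ) (L R δ : ℝ) :
    BlockProgram (Option (Fin m)) (extDim n) d :=
  P.modified x₀ L R (deltaOf m δ)

/-- The initial state: `x̄ = [x₀ ; 1]`, `s̄ = c̄`, `t = 1`. -/
def BlockProgram.init (P : BlockProgram (Fin m) n d) (x₀ : (Σ i, Fin (n i)) → ℝ) (L R δ : ℝ) :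
    State (Option (Fin m)) (extDim n) where
  x := extVec x₀ 1
  s := (P.work x₀ L R δ).c
  t := 1

/-- The loop ends as soon as `t ≤ δ²/(4ν)` (for the internal accuracy `δ`). -/
def threshold (m : ℕ) (ν δ : ℝ) : ℝ := deltaOf m δ ^ 2 / (4 * ν)

/-- Some run of the algorithm is in the state `σ` after `k` iterations. -/
def BlockProgram.IPMReaches (P : BlockProgram (Fin m) n d) (ν : ℝ)
    (x₀ : (Σ i, Fin (n i)) → ℝ) (L R δ : ℝ) (k : ℕ)
    (σ : State (Option (Fin m)) (extDim n)) : Prop :=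
  (P.work x₀ L R δ).Reaches (lamOf m) (alphaOf m) (kappaOf m) ν (threshold m ν δ)
    (P.init x₀ L R δ) k σ

/-- Some run of the algorithm stops after exactly `k` iterations and returns `x`. -/
def BlockProgram.IPMReturns (P : BlockProgram (Fin m) n d) (ν : ℝ)
    (x₀ : (Σ i, Fin (n i)) → ℝ) (L R δ : ℝ) (k : ℕ) (x : (Σ i, Fin (n i)) → ℝ) : Prop :=
  ∃ σ, P.IPMReaches ν x₀ L R δ k σ ∧ σ.t ≤ threshold m ν δ ∧ x = restrict σ.x

end Algorithm

end RobustIPM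

end

/-! The proof maintains an invariant stronger than the claimed bound on the potential. With `N = m +
1` blocks, every reachable state has all blocks in the interior of their sets, potential at most `4
N`, `Ā x = b`, and `s = c̄ + Āᵀ y` for some `y`. Since `4 N ≤ m ^ 16 = exp (λ / 4096)`, the
potential bound forces every `γ_i ≤ 1 / 4096`. All local estimates are then perturbative.

At the start, the gradient of each original barrier vanishes at the analytic center and the extra
block is exactly centered. Dikin's ellipsoid lies in a ball of radius `R`, so the scaled cost has
dual local norm at most `δ' ≤ 1 / λ` (`gam_init_le`), and each term of the potential is at most `e`.

In one iteration the direction splits as `h = w + Āᵀ y` with `δ_x = V w` in the kernel of `Ā` and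
`δ_s = t Āᵀ y` (`exists_step_decomposition`). By orthogonality the local norms of the blocks of
`δ_x` have `ℓ²` norm at most `1.01 α`. Self-concordance says that `μ_i` moves by `h_i` up to
second-order errors (`gam_step_le`), and lowering `t` costs at most `4 (κ / √ν) √ν_i`
(`gam_rescale_le`). So `γ_i` drops by almost `β_i = ‖h_i‖*`, up to errors of `ℓ²` norm at most `0.03
α`. Apart from the frozen blocks, `β` is `α` times the normalized vector of the weights `exp (λ
γ_i)`. Hence the potential cannot grow once it is at least `3 N`, and otherwise grows by at most `N`
(`sum_exp_le_of_step`).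

At the end, near-centrality bounds the duality gap of the modified program by `2 t (1 + ν) ≤ (3/4)
δ'²` (`dotProduct_sub_le_gap`). The modified objective is `δ' / (L R) cᵀx` plus the extra
coordinate, so this one bound controls both the objective and the extra coordinate; the latter
multiplies the residual `b - A x₀`.

The iteration count follows from the geometric decay of `t`. It uses `ν_i ≥ 1`, which compactness of
`K_i` forces (`one_le_nu`). -/

noncomputable section

namespace RobustIPM

/-! ### Norms given by positive definite matrices -/

section MatNorm

open scoped Matrix

variable {J : Type} [Fintype J]

lemma matNorm_nonneg (M : Matrix J J ℝ) (v : J → ℝ) : 0 ≤ matNorm M v := Real.sqrt_nonneg _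

lemma quad_nonneg {M : Matrix J J ℝ} (hM : M.PosSemidef) (v : J → ℝ) : 0 ≤ v ⬝ᵥ M *ᵥ v := by
  simpa using hM.dotProduct_mulVec_nonneg v

lemma matNorm_sq {M : Matrix J J ℝ} (hM : M.PosSemidef) (v : J → ℝ) :
    matNorm M v ^ 2 = v ⬝ᵥ M *ᵥ v := Real.sq_sqrt (quad_nonneg hM v)

lemma matNorm_zero (M : Matrix J J ℝ) : matNorm M 0 = 0 := by simp [matNorm]

lemma matNorm_smul (M : Matrix J J ℝ) (a : ℝ) (v : J → ℝ) :
    matNorm M (a • v) = |a| * matNorm M v := by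
  rw [matNorm, matNorm, Matrix.mulVec_smul, smul_dotProduct, dotProduct_smul, smul_eq_mul,
    smul_eq_mul, ← mul_assoc, Real.sqrt_mul (mul_self_nonneg a), Real.sqrt_mul_self_eq_abs]

lemma matNorm_neg (M : Matrix J J ℝ) (v : J → ℝ) : matNorm M (-v) = matNorm M v := by
  simpa using matNorm_smul M (-1) v

lemma matNorm_pos {M : Matrix J J ℝ} (hM : M.PosDef) {v : J → ℝ} (hv : v ≠ 0) :
    0 < matNorm M v := by
  apply Real.sqrt_pos.2
  simpa using hM.dotProduct_mulVec_pos hv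

lemma dotProduct_mulVec_symm {B : Matrix J J ℝ} (hB : B.IsHermitian) (u v : J → ℝ) :
    u ⬝ᵥ B *ᵥ v = v ⬝ᵥ B *ᵥ u := by
  have h : Bᵀ = B := by simpa [Matrix.IsHermitian] using hB
  rw [Matrix.dotProduct_mulVec, ← Matrix.mulVec_transpose, h, dotProduct_comm]

/-- A symmetric bilinear form that is bounded on the diagonal is bounded. -/
lemma abs_bilin_le {B M : Matrix J J ℝ} (hB : B.IsHermitian) (hM : M.PosDef) {ε : ℝ}
    (h : ∀ u, |u ⬝ᵥ B *ᵥ u| ≤ ε * (u ⬝ᵥ M *ᵥ u)) (u v : J → ℝ) :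
    |u ⬝ᵥ B *ᵥ v| ≤ ε * (matNorm M u * matNorm M v) := by
  by_cases hu : u = 0
  · simp [hu, matNorm_zero]
  by_cases hv : v = 0
  · simp [hv, matNorm_zero]
  have ha := matNorm_pos hM hu
  have hb := matNorm_pos hM hv
  set a := matNorm M u with hadef
  set b := matNorm M v with hbdef
  have hua : u ⬝ᵥ M *ᵥ u = a ^ 2 := (matNorm_sq hM.posSemidef u).symm
  have hvb : v ⬝ᵥ M *ᵥ v = b ^ 2 := (matNorm_sq hM.posSemidef v).symm
  -- Scaling makes both vectors have norm `a * b`. The two quadratic values differ by `4ab` times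
  -- the bilinear term, and the parallelogram law sums the two `M`-values to `4a²b²`.
  have h1 := abs_le.1 (h (b • u + a • v))
  have h2 := abs_le.1 (h (b • u - a • v))
  have e1 := dotProduct_mulVec_symm hB u v
  have e2 := dotProduct_mulVec_symm hM.isHermitian u v
  simp only [Matrix.mulVec_add, Matrix.mulVec_sub, Matrix.mulVec_smul, dotProduct_add,
    dotProduct_sub, add_dotProduct, sub_dotProduct, smul_dotProduct, dotProduct_smul,
    smul_eq_mul, ← e1, ← e2, hua, hvb] at h1 h2
  have hab : 0 < a * b := mul_pos ha hb
  rw [abs_le]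
  constructor
  · refine le_of_mul_le_mul_left ?_ hab
    nlinarith [h1.1, h2.2]
  · refine le_of_mul_le_mul_left ?_ hab
    nlinarith [h1.2, h2.1]

lemma abs_inner_le {M : Matrix J J ℝ} (hM : M.PosDef) (u v : J → ℝ) :
    |u ⬝ᵥ M *ᵥ v| ≤ matNorm M u * matNorm M v := by
  have := abs_bilin_le hM.isHermitian hM (ε := 1)
    (fun u => by rw [one_mul, abs_of_nonneg (quad_nonneg hM.posSemidef u)]) u v
  simpa using this

lemma matNorm_add_le {M : Matrix J J ℝ} (hM : M.PosDef) (u v : J → ℝ) :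
    matNorm M (u + v) ≤ matNorm M u + matNorm M v := by
  refine abs_le_of_sq_le_sq' ?_ (add_nonneg (matNorm_nonneg _ _) (matNorm_nonneg _ _)) |>.2
  have h := (abs_le.1 (abs_inner_le hM u v)).2
  have e2 := dotProduct_mulVec_symm hM.isHermitian u v
  rw [matNorm_sq hM.posSemidef, add_sq, matNorm_sq hM.posSemidef, matNorm_sq hM.posSemidef]
  simp only [Matrix.mulVec_add, dotProduct_add, add_dotProduct, ← e2]
  linarith

lemma matNorm_sub_le {M : Matrix J J ℝ} (hM : M.PosDef) (u v : J → ℝ) :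
    matNorm M (u - v) ≤ matNorm M u + matNorm M v := by
  rw [sub_eq_add_neg, ← matNorm_neg M v]
  exact matNorm_add_le hM u (-v)

lemma matNorm_le_of_quad_le {M N : Matrix J J ℝ} {c : ℝ} (hc : 0 ≤ c) {v : J → ℝ}
    (h : v ⬝ᵥ M *ᵥ v ≤ c ^ 2 * (v ⬝ᵥ N *ᵥ v)) : matNorm M v ≤ c * matNorm N v := by
  rw [matNorm, matNorm]
  calc √(v ⬝ᵥ M *ᵥ v) ≤ √(c ^ 2 * (v ⬝ᵥ N *ᵥ v)) := Real.sqrt_le_sqrt h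
    _ = c * √(v ⬝ᵥ N *ᵥ v) := by rw [Real.sqrt_mul (sq_nonneg c), Real.sqrt_sq hc]

variable [DecidableEq J]

lemma mulVec_inv_mulVec {M : Matrix J J ℝ} (hM : M.PosDef) (v : J → ℝ) :
    M *ᵥ (M⁻¹ *ᵥ v) = v := by
  rw [Matrix.mulVec_mulVec, Matrix.mul_nonsing_inv _ ((Matrix.isUnit_iff_isUnit_det _).1 hM.isUnit),
    Matrix.one_mulVec]

lemma inv_mulVec_mulVec {M : Matrix J J ℝ} (hM : M.PosDef) (v : J → ℝ) :
    M⁻¹ *ᵥ (M *ᵥ v) = v := by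
  rw [Matrix.mulVec_mulVec, Matrix.nonsing_inv_mul _ ((Matrix.isUnit_iff_isUnit_det _).1 hM.isUnit),
    Matrix.one_mulVec]

lemma matNorm_inv_mulVec {M : Matrix J J ℝ} (hM : M.PosDef) (v : J → ℝ) :
    matNorm M (M⁻¹ *ᵥ v) = matNorm M⁻¹ v := by
  rw [matNorm, matNorm, mulVec_inv_mulVec hM, dotProduct_comm]

lemma matNorm_mulVec {M : Matrix J J ℝ} (hM : M.PosDef) (v : J → ℝ) :
    matNorm M⁻¹ (M *ᵥ v) = matNorm M v := by
  rw [← matNorm_inv_mulVec hM, inv_mulVec_mulVec hM]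

/-- The Cauchy-Schwarz inequality between a norm and its dual. -/
lemma abs_dotProduct_le {M : Matrix J J ℝ} (hM : M.PosDef) (g u : J → ℝ) :
    |g ⬝ᵥ u| ≤ matNorm M⁻¹ g * matNorm M u := by
  have h := abs_inner_le hM u (M⁻¹ *ᵥ g)
  rwa [mulVec_inv_mulVec hM, matNorm_inv_mulVec hM, dotProduct_comm, mul_comm] at h

lemma dotProduct_le {M : Matrix J J ℝ} (hM : M.PosDef) (g u : J → ℝ) :
    g ⬝ᵥ u ≤ matNorm M⁻¹ g * matNorm M u := (abs_le.1 (abs_dotProduct_le hM g u)).2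

/-- The dual norm is attained at `u = M⁻¹ g`, so dual norms can be bounded by testing and the
inverse need not be computed. -/
lemma matNorm_inv_le {M : Matrix J J ℝ} (hM : M.PosDef) {g : J → ℝ} {B : ℝ} (hB : 0 ≤ B)
    (h : ∀ u, g ⬝ᵥ u ≤ B * matNorm M u) : matNorm M⁻¹ g ≤ B := by
  rcases (matNorm_nonneg M⁻¹ g).eq_or_lt with h0 | h0
  · rw [← h0]; exact hB
  · have h1 := h (M⁻¹ *ᵥ g)
    rw [← matNorm_sq hM.inv.posSemidef, matNorm_inv_mulVec hM] at h1
    nlinarith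

/-- Passing to dual norms reverses a comparison of norms and keeps the constant. -/
lemma matNorm_inv_le_mul {M N : Matrix J J ℝ} (hM : M.PosDef) (hN : N.PosDef) {c : ℝ} (hc : 0 ≤ c)
    (h : ∀ u, matNorm M u ≤ c * matNorm N u) (g : J → ℝ) :
    matNorm N⁻¹ g ≤ c * matNorm M⁻¹ g := by
  refine matNorm_inv_le hN (mul_nonneg hc (matNorm_nonneg _ _)) fun u => ?_
  calc g ⬝ᵥ u ≤ matNorm M⁻¹ g * matNorm M u := dotProduct_le hM g u
    _ ≤ matNorm M⁻¹ g * (c * matNorm N u) :=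
      mul_le_mul_of_nonneg_left (h u) (matNorm_nonneg _ _)
    _ = _ := by ring

end MatNorm

/-! ### Derivatives along lines -/

section Derivatives

open scoped Matrix

variable {k : ℕ} {φ : (Fin k → ℝ) → ℝ} {x : Fin k → ℝ}

lemma clm_apply_eq_sum {F : Type*} [AddCommGroup F] [Module ℝ F] [TopologicalSpace F]
    (L : (Fin k → ℝ) →L[ℝ] F) (u : Fin k → ℝ) : L u = ∑ j, u j • L (Pi.single j 1) := by
  conv_lhs => rw [pi_eq_sum_univ' u]
  rw [map_sum]
  refine Finset.sum_congr rfl fun j _ => ?_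
  rw [map_smul]

lemma grad_dotProduct (φ : (Fin k → ℝ) → ℝ) (x u : Fin k → ℝ) :
    grad φ x ⬝ᵥ u = fderiv ℝ φ x u := by
  rw [clm_apply_eq_sum]
  simp [dotProduct, grad, mul_comm]

lemma dotProduct_hess (φ : (Fin k → ℝ) → ℝ) (x u v : Fin k → ℝ) :
    u ⬝ᵥ hess φ x *ᵥ v = iteratedFDeriv ℝ 2 φ x ![u, v] := by
  rw [iteratedFDeriv_two_apply]
  simp only [Matrix.cons_val_zero, Matrix.cons_val_one]
  rw [clm_apply_eq_sum _ u]
  simp only [_root_.sum_apply, _root_.smul_apply, smul_eq_mul]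
  simp only [dotProduct, Matrix.mulVec, hess, Matrix.of_apply, iteratedFDeriv_two_apply,
    Matrix.cons_val_zero, Matrix.cons_val_one]
  refine Finset.sum_congr rfl fun j _ => ?_
  rw [clm_apply_eq_sum _ v]
  simp [mul_comm]

lemma hasDerivAt_line (x v : Fin k → ℝ) (τ : ℝ) :
    HasDerivAt (fun τ : ℝ => x + τ • v) v τ := by
  simpa using ((hasDerivAt_id τ).smul_const v).const_add x

/-- The new direction enters in the first slot. This reduces every later estimate on derivatives to
calculus in one variable. -/
lemma hasDerivAt_iteratedFDeriv_line {l : ℕ} {v : Fin k → ℝ} {τ : ℝ}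
    (h : ContDiffAt ℝ (l + 1 : ℕ) φ (x + τ • v)) (w : Fin l → Fin k → ℝ) :
    HasDerivAt (fun τ : ℝ => iteratedFDeriv ℝ l φ (x + τ • v) w)
      (iteratedFDeriv ℝ (l + 1) φ (x + τ • v) (Fin.cons v w)) τ := by
  have hd := (h.differentiableAt_iteratedFDeriv (m := l) (by exact_mod_cast l.lt_succ_self))
  have h1 := hd.hasFDerivAt.comp_hasDerivAt τ (hasDerivAt_line x v τ)
  have h2 := (ContinuousMultilinearMap.apply ℝ (fun _ : Fin l => Fin k → ℝ) ℝ w).hasFDerivAt.comp_hasDerivAt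
    τ h1
  rw [iteratedFDeriv_succ_apply_left]
  exact h2

lemma hasDerivAt_comp_line {v : Fin k → ℝ} {τ : ℝ} (h : ContDiffAt ℝ 1 φ (x + τ • v)) :
    HasDerivAt (fun τ : ℝ => φ (x + τ • v)) (grad φ (x + τ • v) ⬝ᵥ v) τ := by
  rw [grad_dotProduct]
  exact (h.differentiableAt one_ne_zero).hasFDerivAt.comp_hasDerivAt τ (hasDerivAt_line x v τ)

lemma hasDerivAt_grad_line {v : Fin k → ℝ} {τ : ℝ} (h : ContDiffAt ℝ 2 φ (x + τ • v))
    (u : Fin k → ℝ) :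
    HasDerivAt (fun τ : ℝ => grad φ (x + τ • v) ⬝ᵥ u) (v ⬝ᵥ hess φ (x + τ • v) *ᵥ u) τ := by
  have := hasDerivAt_iteratedFDeriv_line (l := 1) h ![u]
  simp only [iteratedFDeriv_one_apply, Matrix.cons_val_zero, ← grad_dotProduct] at this
  rw [dotProduct_hess]
  exact this

lemma hasDerivAt_hess_line {v : Fin k → ℝ} {τ : ℝ} (h : ContDiffAt ℝ 3 φ (x + τ • v))
    (u w : Fin k → ℝ) :
    HasDerivAt (fun τ : ℝ => u ⬝ᵥ hess φ (x + τ • v) *ᵥ w)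
      (iteratedFDeriv ℝ 3 φ (x + τ • v) ![v, u, w]) τ := by
  have := hasDerivAt_iteratedFDeriv_line (l := 2) h ![u, w]
  simp only [← dotProduct_hess] at this
  exact this

/-- The first two slots are the second derivative of `fderiv ℝ φ`, which is symmetric. -/
lemma iteratedFDeriv_three_swap (h : ContDiffAt ℝ 3 φ x) (u v w : Fin k → ℝ) :
    iteratedFDeriv ℝ 3 φ x ![u, v, w] = iteratedFDeriv ℝ 3 φ x ![v, u, w] := by
  have h2 : ContDiffAt ℝ 2 (fderiv ℝ φ) x := h.fderiv_right (by norm_num)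
  have hs := (h2.isSymmSndFDerivAt (by simp)).eq u v
  rw [iteratedFDeriv_succ_apply_right (n := 2) ![u, v, w],
    iteratedFDeriv_succ_apply_right (n := 2) ![v, u, w]]
  rw [iteratedFDeriv_two_apply, iteratedFDeriv_two_apply]
  exact congrArg (fun L => L w) hs

/-- The third derivative is the derivative of the Hessian along `u`, and the Hessian is symmetric
near `x`. -/
lemma iteratedFDeriv_three_swap_right (h : ∀ᶠ y in 𝓝 x, (hess φ y).IsHermitian)
    (h3 : ContDiffAt ℝ 3 φ x) (u v w : Fin k → ℝ) :
    iteratedFDeriv ℝ 3 φ x ![u, v, w] = iteratedFDeriv ℝ 3 φ x ![u, w, v] := by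
  have hx : x + (0 : ℝ) • u = x := by simp
  have h3' : ContDiffAt ℝ 3 φ (x + (0 : ℝ) • u) := by rwa [hx]
  have e1 := hasDerivAt_hess_line h3' v w
  have e2 := hasDerivAt_hess_line h3' w v
  rw [hx] at e1 e2
  refine e1.unique (e2.congr_of_eventuallyEq ?_)
  have hc : Tendsto (fun τ : ℝ => x + τ • u) (𝓝 0) (𝓝 x) := by
    have := (hasDerivAt_line x u 0).continuousAt.tendsto
    rwa [hx] at this
  filter_upwards [hc.eventually h] with τ hτ
  exact dotProduct_mulVec_symm hτ v w

/-- Polarization: a bound for a cubic form gives one for the symmetric trilinear form. -/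
lemma abs_iteratedFDeriv_three_le (hs : ∀ᶠ y in 𝓝 x, (hess φ y).IsHermitian)
    (h3 : ContDiffAt ℝ 3 φ x) (hp : (hess φ x).PosDef)
    (h : ∀ u, |iteratedFDeriv ℝ 3 φ x ![u, u, u]| ≤ 2 * matNorm (hess φ x) u ^ 3)
    (v u : Fin k → ℝ) :
    |iteratedFDeriv ℝ 3 φ x ![v, u, u]| ≤
      6 * matNorm (hess φ x) v * matNorm (hess φ x) u ^ 2 := by
  set T : (Fin k → ℝ) → (Fin k → ℝ) → (Fin k → ℝ) → ℝ :=
    fun a b c => iteratedFDeriv ℝ 3 φ x ![a, b, c] with hT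
  have s1 : ∀ a b c, T a b c = T b a c := iteratedFDeriv_three_swap h3
  have s2 : ∀ a b c, T a b c = T a c b := iteratedFDeriv_three_swap_right hs h3
  have a1 : ∀ a a' b c, T (a + a') b c = T a b c + T a' b c := fun a a' b c =>
    (iteratedFDeriv ℝ 3 φ x).cons_add ![b, c] a a'
  have m1 : ∀ (r : ℝ) a b c, T (r • a) b c = r * T a b c := fun r a b c =>
    (iteratedFDeriv ℝ 3 φ x).cons_smul ![b, c] r a
  have a2 : ∀ a a' b c, T b (a + a') c = T b a c + T b a' c := fun a a' b c => by
    rw [s1, a1, s1 a, s1 a']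
  have a3 : ∀ a a' b c, T b c (a + a') = T b c a + T b c a' := fun a a' b c => by
    rw [s2, a2, s2 b a, s2 b a']
  have m2 : ∀ (r : ℝ) a b c, T b (r • a) c = r * T b a c := fun r a b c => by
    rw [s1, m1, s1 a]
  have m3 : ∀ (r : ℝ) a b c, T b c (r • a) = r * T b c a := fun r a b c => by
    rw [s2, m2, s2 b a]
  change |T v u u| ≤ _
  by_cases hu : u = 0
  · have : T v u u = 0 := by
      have := m2 0 u v u
      simpa [hu] using this
    rw [this]
    simp [hu, matNorm_zero]
  by_cases hv : v = 0
  · have : T v u u = 0 := by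
      have := m1 0 v u u
      simpa [hv] using this
    rw [this]
    simp [hv, matNorm_zero]
  have ha := matNorm_pos hp hu
  have hb := matNorm_pos hp hv
  set a := matNorm (hess φ x) u with hadef
  set b := matNorm (hess φ x) v with hbdef
  -- The cubic values at `b u + a v` and `b u - a v` differ by `6ab² T(v,u,u) + 2a³ T(v,v,v)`. Each
  -- is at most `2(2ab)³` in absolute value and `|T(v,v,v)| ≤ 2b³`, so `6ab² |T(v,u,u)| ≤ 36a³b³`;
  -- this is the constant `6`.
  have hN1 : matNorm (hess φ x) (b • u + a • v) ≤ 2 * (a * b) := by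
    refine (matNorm_add_le hp _ _).trans ?_
    rw [matNorm_smul, matNorm_smul, abs_of_pos ha, abs_of_pos hb, ← hadef, ← hbdef]
    linarith
  have hN2 : matNorm (hess φ x) (b • u + (-a) • v) ≤ 2 * (a * b) := by
    refine (matNorm_add_le hp _ _).trans ?_
    rw [matNorm_smul, matNorm_smul, abs_neg, abs_of_pos ha, abs_of_pos hb, ← hadef, ← hbdef]
    linarith
  have b1 := abs_le.1 ((h (b • u + a • v)).trans (mul_le_mul_of_nonneg_left
    (pow_le_pow_left₀ (matNorm_nonneg _ _) hN1 3) zero_le_two))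
  have b2 := abs_le.1 ((h (b • u + (-a) • v)).trans (mul_le_mul_of_nonneg_left
    (pow_le_pow_left₀ (matNorm_nonneg _ _) hN2 3) zero_le_two))
  have b3 := abs_le.1 (h v)
  change _ ≤ T _ _ _ ∧ T _ _ _ ≤ _ at b1 b2 b3
  simp only [a1, a2, a3, m1, m2, m3] at b1 b2
  have e1 : T u v u = T v u u := s1 _ _ _
  have e2 : T u u v = T v u u := by rw [s2, s1]
  have e3 : T u v v = T v v u := by rw [s1, s2]
  have e4 : T v u v = T v v u := s2 _ _ _
  rw [e1, e2, e3, e4] at b1 b2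
  rw [← hbdef] at b3
  have hpos : 0 < a * b ^ 2 := by positivity
  have ha3 : 0 < a ^ 3 := by positivity
  have c1 := mul_le_mul_of_nonneg_left b3.1 ha3.le
  have c2 := mul_le_mul_of_nonneg_left b3.2 ha3.le
  rw [abs_le]
  constructor
  · refine le_of_mul_le_mul_left ?_ hpos
    linarith [b1.1, b2.2]
  · refine le_of_mul_le_mul_left ?_ hpos
    linarith [b1.2, b2.1]

end Derivatives

/-! ### Self-concordant barriers -/

/-- The reciprocal square root of the second derivative of a self-concordant function is
`1`-Lipschitz. -/
lemma abs_inv_sqrt_sub_le {D : Set ℝ} (hD : Convex ℝ D) {p p' : ℝ → ℝ}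
    (hd : ∀ τ ∈ D, HasDerivAt p (p' τ) τ) (hpos : ∀ τ ∈ D, 0 < p τ)
    (hb : ∀ τ ∈ D, |p' τ| ≤ 2 * √(p τ) ^ 3) {a b : ℝ} (ha : a ∈ D) (hb' : b ∈ D) :
    |(√(p b))⁻¹ - (√(p a))⁻¹| ≤ |b - a| := by
  have h := hD.norm_image_sub_le_of_norm_hasDerivWithin_le (f := fun τ => (√(p τ))⁻¹)
    (f' := fun τ => -(p' τ / (2 * √(p τ))) / √(p τ) ^ 2) (C := 1) (fun τ hτ => by
      have h1 := (hd τ hτ).sqrt (hpos τ hτ).ne'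
      exact (h1.inv (Real.sqrt_pos.2 (hpos τ hτ)).ne').hasDerivWithinAt) (fun τ hτ => by
      have hs := Real.sqrt_pos.2 (hpos τ hτ)
      rw [Real.norm_eq_abs, abs_div, abs_neg, abs_div, abs_of_pos (show 0 < 2 * √(p τ) by positivity),
        abs_of_pos (show 0 < √(p τ) ^ 2 by positivity), div_div, div_le_one (by positivity)]
      calc |p' τ| ≤ 2 * √(p τ) ^ 3 := hb τ hτ
        _ = _ := by ring) ha hb'
  simpa using h

/-- Where a segment that starts in the interior of a set leaves it. -/
lemma exists_first_exit {k : ℕ} {K : Set (Fin k → ℝ)} {x u : Fin k → ℝ} (hx : x ∈ interior K)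
    (hu : x + u ∉ interior K) :
    ∃ T : ℝ, 0 < T ∧ T ≤ 1 ∧ x + T • u ∈ frontier K ∧
      ∀ τ : ℝ, 0 ≤ τ → τ < T → x + τ • u ∈ interior K := by
  have hcont : Continuous fun τ : ℝ => x + τ • u := by fun_prop
  set S : Set ℝ := Set.Icc 0 1 ∩ {τ | x + τ • u ∉ interior K} with hS
  have hSc : IsClosed S :=
    isClosed_Icc.inter ((isOpen_interior.preimage hcont).isClosed_compl)
  have h1S : (1 : ℝ) ∈ S := ⟨by simp, by simpa using hu⟩
  have hSb : BddBelow S := ⟨0, fun τ hτ => hτ.1.1⟩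
  have hT := hSc.csInf_mem ⟨1, h1S⟩ hSb
  set T := sInf S with hTdef
  have hin : ∀ τ : ℝ, 0 ≤ τ → τ < T → x + τ • u ∈ interior K := by
    intro τ h0 hτ
    by_contra hcon
    exact absurd (csInf_le hSb (show τ ∈ S from ⟨⟨h0, hτ.le.trans hT.1.2⟩, hcon⟩)) (not_le.2 hτ)
  have hT0 : 0 < T := by
    rcases hT.1.1.eq_or_lt with h | h
    · exfalso
      apply hT.2
      rw [← h]
      simpa using hx
    · exact h
  refine ⟨T, hT0, hT.1.2, ⟨?_, hT.2⟩, hin⟩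
  have hmem : T ∈ closure (Set.Ico 0 T) := by
    rw [closure_Ico hT0.ne]
    exact ⟨hT0.le, le_rfl⟩
  have := map_mem_closure hcont hmem
    (t := K) (fun τ hτ => interior_subset (hin τ hτ.1 hτ.2))
  exact this

lemma add_smul_sub_mem_interior {k : ℕ} {K : Set (Fin k → ℝ)} (hK : Convex ℝ K) {x z : Fin k → ℝ}
    (hx : x ∈ interior K) (hz : z ∈ K) {τ : ℝ} (h0 : 0 ≤ τ) (h1 : τ < 1) :
    x + τ • (z - x) ∈ interior K := by
  have := hK.combo_interior_self_mem_interior hx hz (sub_pos.2 h1) h0 (by ring)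
  convert this using 1
  rw [smul_sub, sub_smul, one_smul]
  abel

namespace IsSelfConcordantBarrier

open scoped Matrix

variable {k : ℕ} {ν : ℝ} {K : Set (Fin k → ℝ)} {φ : (Fin k → ℝ) → ℝ} {x : Fin k → ℝ}

lemma contDiffAt (hB : IsSelfConcordantBarrier ν K φ) (hx : x ∈ interior K) :
    ContDiffAt ℝ 3 φ x :=
  hB.contDiffOn.contDiffAt (isOpen_interior.mem_nhds hx)

lemma abs_third_le (hB : IsSelfConcordantBarrier ν K φ) (hx : x ∈ interior K)
    (v u : Fin k → ℝ) : |iteratedFDeriv ℝ 3 φ x ![v, u, u]| ≤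
      6 * matNorm (hess φ x) v * matNorm (hess φ x) u ^ 2 :=
  abs_iteratedFDeriv_three_le (by
    filter_upwards [isOpen_interior.mem_nhds hx] with y hy using (hB.hess_posDef y hy).isHermitian)
    (hB.contDiffAt hx) (hB.hess_posDef x hx) (hB.third_deriv_le x hx) v u

lemma abs_grad_dotProduct_le (hB : IsSelfConcordantBarrier ν K φ) (hx : x ∈ interior K)
    (u : Fin k → ℝ) : |grad φ x ⬝ᵥ u| ≤ √ν * matNorm (hess φ x) u :=
  (abs_dotProduct_le (hB.hess_posDef x hx) _ u).trans
    (mul_le_mul_of_nonneg_right (hB.grad_le x hx) (matNorm_nonneg _ _))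

lemma hasDerivAt_grad (hB : IsSelfConcordantBarrier ν K φ) {u : Fin k → ℝ} {τ : ℝ}
    (h : x + τ • u ∈ interior K) :
    HasDerivAt (fun τ : ℝ => grad φ (x + τ • u) ⬝ᵥ u) (matNorm (hess φ (x + τ • u)) u ^ 2) τ := by
  rw [matNorm_sq (hB.hess_posDef _ h).posSemidef]
  exact hasDerivAt_grad_line ((hB.contDiffAt h).of_le (by norm_num)) u

/-- Self-concordance on a line in integrated form: `u ⬝ᵥ hess φ u` has derivative bounded by twice
its `3/2` power. -/
lemma abs_inv_matNorm_sub_le (hB : IsSelfConcordantBarrier ν K φ) {u : Fin k → ℝ} (hu : u ≠ 0)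
    {D : Set ℝ} (hD : Convex ℝ D) (hin : ∀ τ ∈ D, x + τ • u ∈ interior K) {a b : ℝ}
    (ha : a ∈ D) (hb : b ∈ D) :
    |(matNorm (hess φ (x + b • u)) u)⁻¹ - (matNorm (hess φ (x + a • u)) u)⁻¹| ≤ |b - a| :=
  abs_inv_sqrt_sub_le hD (p := fun τ => u ⬝ᵥ hess φ (x + τ • u) *ᵥ u)
    (fun τ hτ => hasDerivAt_hess_line (hB.contDiffAt (hin τ hτ)) u u)
    (fun τ hτ => by simpa using (hB.hess_posDef _ (hin τ hτ)).dotProduct_mulVec_pos hu)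
    (fun τ hτ => hB.third_deriv_le _ (hin τ hτ) u) ha hb

/-- The reciprocal of the norm starts at `1/r` and falls by at most `τ ≤ 1`, so it stays above `(1 -
r)/r`. -/
lemma matNorm_line_le (hB : IsSelfConcordantBarrier ν K φ) {u : Fin k → ℝ} (hu : u ≠ 0)
    {D : Set ℝ} (hD : Convex ℝ D) (hin : ∀ τ ∈ D, x + τ • u ∈ interior K) (h0 : (0 : ℝ) ∈ D)
    (hD1 : ∀ τ ∈ D, 0 ≤ τ ∧ τ ≤ 1) (hr : matNorm (hess φ x) u < 1) {τ : ℝ} (hτ : τ ∈ D) :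
    matNorm (hess φ (x + τ • u)) u ≤ matNorm (hess φ x) u / (1 - matNorm (hess φ x) u) := by
  have h := abs_le.1 (hB.abs_inv_matNorm_sub_le hu hD hin h0 hτ)
  have hx : x ∈ interior K := by simpa using hin 0 h0
  rw [zero_smul, add_zero, sub_zero, abs_of_nonneg (hD1 τ hτ).1] at h
  have hr0 := matNorm_pos (hB.hess_posDef x hx) hu
  have hn0 := matNorm_pos (hB.hess_posDef _ (hin τ hτ)) hu
  set r := matNorm (hess φ x) u
  set n := matNorm (hess φ (x + τ • u)) u
  have h1 : (1 - r) / r ≤ n⁻¹ := by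
    rw [sub_div, div_self hr0.ne', one_div]
    linarith [h.1, (hD1 τ hτ).2]
  rw [le_inv_comm₀ (div_pos (by linarith) hr0) hn0, inv_div] at h1
  exact h1

/-- Dikin's ellipsoid is contained in the domain. -/
theorem add_mem_interior (hB : IsSelfConcordantBarrier ν K φ) (hx : x ∈ interior K)
    {u : Fin k → ℝ} (hr : matNorm (hess φ x) u < 1) : x + u ∈ interior K := by
  by_contra hcon
  obtain ⟨T, hT0, hT1, hfr, hin⟩ := exists_first_exit hx hcon
  have hu : u ≠ 0 := by
    rintro rfl
    exact hcon (by simpa using hx)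
  set D : Set ℝ := Set.Ico 0 T with hDdef
  have hD : Convex ℝ D := convex_Ico 0 T
  have hinD : ∀ τ ∈ D, x + τ • u ∈ interior K := fun τ hτ => hin τ hτ.1 hτ.2
  have h0 : (0 : ℝ) ∈ D := ⟨le_rfl, hT0⟩
  have hD1 : ∀ τ ∈ D, 0 ≤ τ ∧ τ ≤ 1 := fun τ hτ => ⟨hτ.1, hτ.2.le.trans hT1⟩
  -- Before the exit time the second derivative along the segment is at most `M²`. Two integrations
  -- bound `φ` there, against its blow-up at the frontier point.
  set M := matNorm (hess φ x) u / (1 - matNorm (hess φ x) u) with hM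
  have hn : ∀ τ ∈ D, matNorm (hess φ (x + τ • u)) u ^ 2 ≤ M ^ 2 := fun τ hτ =>
    pow_le_pow_left₀ (matNorm_nonneg _ _) (hB.matNorm_line_le hu hD hinD h0 hD1 hr hτ) 2
  have hg : ∀ τ ∈ D, ‖grad φ (x + τ • u) ⬝ᵥ u‖ ≤ |grad φ x ⬝ᵥ u| + M ^ 2 := by
    intro τ hτ
    have := hD.norm_image_sub_le_of_norm_hasDerivWithin_le
      (f := fun τ : ℝ => grad φ (x + τ • u) ⬝ᵥ u) (C := M ^ 2)
      (fun τ hτ => (hB.hasDerivAt_grad (hinD τ hτ)).hasDerivWithinAt)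
      (fun τ hτ => by
        rw [Real.norm_eq_abs, abs_of_nonneg (sq_nonneg _)]
        exact hn τ hτ) h0 hτ
    rw [zero_smul, add_zero, sub_zero, Real.norm_eq_abs, Real.norm_eq_abs,
      abs_of_nonneg hτ.1] at this
    rw [Real.norm_eq_abs]
    have h3 := abs_sub_abs_le_abs_sub (grad φ (x + τ • u) ⬝ᵥ u) (grad φ x ⬝ᵥ u)
    nlinarith [(hD1 τ hτ).2, sq_nonneg M]
  set G := |grad φ x ⬝ᵥ u| + M ^ 2 with hG
  have hf : ∀ τ ∈ D, φ (x + τ • u) ≤ φ x + G := by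
    intro τ hτ
    have := hD.norm_image_sub_le_of_norm_hasDerivWithin_le
      (f := fun τ : ℝ => φ (x + τ • u)) (C := G)
      (fun τ hτ => (hasDerivAt_comp_line
        ((hB.contDiffAt (hinD τ hτ)).of_le (by norm_num))).hasDerivWithinAt) hg h0 hτ
    rw [zero_smul, add_zero, sub_zero, Real.norm_eq_abs, Real.norm_eq_abs,
      abs_of_nonneg hτ.1] at this
    have h3 := (abs_le.1 this).2
    have hG0 : 0 ≤ G := by positivity
    nlinarith [(hD1 τ hτ).2]
  have hlim : Tendsto (fun τ : ℝ => φ (x + τ • u)) (𝓝[D] T) atTop := by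
    refine (hB.tendsto_frontier _ hfr).comp ?_
    refine tendsto_nhdsWithin_iff.2 ⟨?_, ?_⟩
    · exact ((hasDerivAt_line x u T).continuousAt.tendsto).mono_left nhdsWithin_le_nhds
    · filter_upwards [self_mem_nhdsWithin] with τ hτ using hinD τ hτ
  have hne : (𝓝[D] T).NeBot := by
    rw [← mem_closure_iff_nhdsWithin_neBot, closure_Ico hT0.ne]
    exact ⟨hT0.le, le_rfl⟩
  obtain ⟨τ, h1, h2⟩ := ((hlim.eventually (eventually_gt_atTop (φ x + G))).and
    self_mem_nhdsWithin).exists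
  exact absurd (hf τ h2) (not_le.2 h1)

/-- Hessians at close points are close. -/
theorem abs_hess_sub_le (hB : IsSelfConcordantBarrier ν K φ) (hx : x ∈ interior K)
    {v : Fin k → ℝ} (hr : matNorm (hess φ x) v ≤ 1 / 100) (u : Fin k → ℝ) :
    |u ⬝ᵥ hess φ (x + v) *ᵥ u - u ⬝ᵥ hess φ x *ᵥ u| ≤
      8 * matNorm (hess φ x) v * (u ⬝ᵥ hess φ x *ᵥ u) := by
  by_cases hv : v = 0
  · simp [hv, matNorm_zero]
  by_cases hu : u = 0
  · simp [hu]
  set D : Set ℝ := Set.Icc 0 1 with hDdef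
  have hD : Convex ℝ D := convex_Icc 0 1
  have hin : ∀ τ ∈ D, x + τ • v ∈ interior K := by
    intro τ hτ
    apply hB.add_mem_interior hx
    rw [matNorm_smul, abs_of_nonneg hτ.1]
    nlinarith [hτ.1, hτ.2, matNorm_nonneg (hess φ x) v]
  have h0 : (0 : ℝ) ∈ D := ⟨le_rfl, zero_le_one⟩
  have h1 : (1 : ℝ) ∈ D := ⟨zero_le_one, le_rfl⟩
  set r := matNorm (hess φ x) v with hrdef
  have hr0 : 0 ≤ r := matNorm_nonneg _ _
  have hn : ∀ τ ∈ D, matNorm (hess φ (x + τ • v)) v ≤ 100 / 99 * r := by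
    intro τ hτ
    refine (hB.matNorm_line_le hv hD hin h0 (fun τ hτ => hτ) (by rw [← hrdef]; linarith)
      hτ).trans ?_
    rw [← hrdef, div_le_iff₀ (by linarith)]
    nlinarith
  have hpos : ∀ τ ∈ D, 0 < u ⬝ᵥ hess φ (x + τ • v) *ᵥ u := fun τ hτ => by
    simpa using (hB.hess_posDef _ (hin τ hτ)).dotProduct_mulVec_pos hu
  -- The logarithmic derivative of the quadratic form is at most `6 ‖v‖` in the moving norm, hence
  -- at most `6 * (100/99) r ≤ 6.1 r`. Exponentiating for `r ≤ 1/100` leaves room below `8 r`.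
  have hlog := hD.norm_image_sub_le_of_norm_hasDerivWithin_le
    (f := fun τ : ℝ => Real.log (u ⬝ᵥ hess φ (x + τ • v) *ᵥ u)) (C := 6.1 * r)
    (fun τ hτ => ((hasDerivAt_hess_line (hB.contDiffAt (hin τ hτ)) u u).log
      (hpos τ hτ).ne').hasDerivWithinAt)
    (fun τ hτ => by
      rw [Real.norm_eq_abs, abs_div, abs_of_pos (hpos τ hτ), div_le_iff₀ (hpos τ hτ)]
      refine (hB.abs_third_le (hin τ hτ) v u).trans ?_
      rw [matNorm_sq (hB.hess_posDef _ (hin τ hτ)).posSemidef]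
      refine mul_le_mul_of_nonneg_right ?_ (hpos τ hτ).le
      linarith [hn τ hτ]) h0 h1
  rw [zero_smul, add_zero, one_smul, sub_zero, norm_one, mul_one, Real.norm_eq_abs] at hlog
  have p0 : 0 < u ⬝ᵥ hess φ x *ᵥ u := by simpa using hpos 0 h0
  have p1 : 0 < u ⬝ᵥ hess φ (x + v) *ᵥ u := by simpa using hpos 1 h1
  set a := u ⬝ᵥ hess φ x *ᵥ u
  set b := u ⬝ᵥ hess φ (x + v) *ᵥ u
  set z := Real.log b - Real.log a with hz
  have hb : b = a * Real.exp z := by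
    rw [hz, Real.exp_sub, Real.exp_log p0, Real.exp_log p1]
    field_simp
  have hz1 : |z| ≤ 0.061 := by linarith
  have he := Real.abs_exp_sub_one_sub_id_le (x := z) (by linarith)
  have he' : |Real.exp z - 1| ≤ 8 * r := by
    have : |Real.exp z - 1| ≤ |Real.exp z - 1 - z| + |z| := by
      have := abs_add_le (Real.exp z - 1 - z) z
      rwa [sub_add_cancel] at this
    have hsq : z ^ 2 ≤ 0.061 * |z| := by
      rw [← sq_abs, sq]
      exact mul_le_mul_of_nonneg_right hz1 (abs_nonneg _)
    linarith
  rw [hb, show a * Real.exp z - a = a * (Real.exp z - 1) by ring, abs_mul, abs_of_pos p0, mul_comm]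
  exact mul_le_mul_of_nonneg_right he' p0.le

/-- The directional derivative of a barrier towards a point of the set is at most `ν`. -/
theorem grad_dotProduct_sub_le (hB : IsSelfConcordantBarrier ν K φ) (hK : Convex ℝ K)
    (hx : x ∈ interior K) {z : Fin k → ℝ} (hz : z ∈ K) : grad φ x ⬝ᵥ (z - x) ≤ √ν ^ 2 := by
  by_contra! hcon
  set v := z - x with hv
  set s := √ν with hs
  set a := grad φ x ⬝ᵥ v with ha
  have ha0 : 0 < a := (sq_nonneg s).trans_lt hcon
  have hs0 : 0 < s := by
    rcases (Real.sqrt_nonneg ν).eq_or_lt with h | h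
    · have := (le_abs_self _).trans (hB.abs_grad_dotProduct_le hx v)
      rw [← h, zero_mul] at this
      exact absurd ha0 (not_lt.2 this)
    · exact h
  set D : Set ℝ := Set.Ico 0 1 with hDdef
  have hD : Convex ℝ D := convex_Ico 0 1
  have hin : ∀ τ ∈ D, x + τ • v ∈ interior K := fun τ hτ =>
    add_smul_sub_mem_interior hK hx hz hτ.1 hτ.2
  have h0 : (0 : ℝ) ∈ D := ⟨le_rfl, zero_lt_one⟩
  have hmono : MonotoneOn (fun τ : ℝ => grad φ (x + τ • v) ⬝ᵥ v) D :=
    monotoneOn_of_hasDerivWithinAt_nonneg hD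
      (fun τ hτ => (hB.hasDerivAt_grad (hin τ hτ)).continuousAt.continuousWithinAt)
      (fun τ hτ => (hB.hasDerivAt_grad (hin τ (interior_subset hτ))).hasDerivWithinAt)
      (fun τ _ => sq_nonneg _)
  have hpos : ∀ τ ∈ D, 0 < grad φ (x + τ • v) ⬝ᵥ v := fun τ hτ => by
    have := hmono h0 hτ hτ.1
    simp only [zero_smul, add_zero] at this
    linarith
  -- For `g` the slope along the segment, `g' = ‖v‖² ≥ g² / s²`, so `1/g + τ/s²` decreases. Then
  -- `1/g` would be nonpositive at `τ = s²/a < 1`, where `g` is still positive.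
  have hder : ∀ τ ∈ D, HasDerivAt (fun τ : ℝ => (grad φ (x + τ • v) ⬝ᵥ v)⁻¹ + τ / s ^ 2)
      (-matNorm (hess φ (x + τ • v)) v ^ 2 / (grad φ (x + τ • v) ⬝ᵥ v) ^ 2 + 1 / s ^ 2) τ :=
    fun τ hτ => ((hB.hasDerivAt_grad (hin τ hτ)).inv (hpos τ hτ).ne').add
      ((hasDerivAt_id τ).div_const _)
  have hanti : AntitoneOn (fun τ : ℝ => (grad φ (x + τ • v) ⬝ᵥ v)⁻¹ + τ / s ^ 2) D := by
    refine antitoneOn_of_hasDerivWithinAt_nonpos hD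
      (fun τ hτ => (hder τ hτ).continuousAt.continuousWithinAt)
      (fun τ hτ => (hder τ (interior_subset hτ)).hasDerivWithinAt) (fun τ hτ => ?_)
    have hτ' := interior_subset hτ
    have h1 := (le_abs_self _).trans (hB.abs_grad_dotProduct_le (hin τ hτ') v)
    have h2 := pow_le_pow_left₀ (hpos τ hτ').le h1 2
    rw [neg_div, neg_add_nonpos_iff, div_le_div_iff₀ (by positivity) (pow_pos (hpos τ hτ') 2)]
    rw [mul_pow] at h2
    linarith
  have hτ : s ^ 2 / a ∈ D := ⟨by positivity, by rwa [div_lt_one ha0]⟩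
  have := hanti h0 hτ hτ.1
  simp only [zero_smul, add_zero, zero_div] at this
  rw [← ha, div_div, mul_comm a, ← div_div, div_self (by positivity), one_div] at this
  have h2 := inv_pos.2 (hpos _ hτ)
  linarith

/-- The parameter of a barrier for a compact set is at least one. -/
theorem one_le_nu (hB : IsSelfConcordantBarrier ν K φ) (hK : Convex ℝ K) (hKc : IsCompact K)
    (hk : 1 ≤ k) (hx : x ∈ interior K) : 1 ≤ ν := by
  obtain ⟨z, hz⟩ : (frontier K).Nonempty := by
    refine nonempty_frontier_iff.2 ⟨⟨x, interior_subset hx⟩, fun h => ?_⟩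
    have : Nonempty (Fin k) := ⟨⟨0, hk⟩⟩
    exact noncompact_univ (Fin k → ℝ) (h ▸ hKc)
  have hzK : z ∈ K := hKc.isClosed.frontier_subset hz
  set v := z - x with hv
  set D : Set ℝ := Set.Ico 0 1 with hDdef
  have hD : Convex ℝ D := convex_Ico 0 1
  have hin : ∀ τ ∈ D, x + τ • v ∈ interior K := fun τ hτ =>
    add_smul_sub_mem_interior hK hx hzK hτ.1 hτ.2
  have h0 : (0 : ℝ) ∈ D := ⟨le_rfl, zero_lt_one⟩
  have hrest : ∀ τ : ℝ, z - (x + τ • v) = (1 - τ) • v := fun τ => by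
    rw [sub_smul, one_smul, hv]
    abel
  -- The frontier point `z` lies outside every open Dikin ellipsoid, so the remaining vector `(1 -
  -- τ) v` has local norm at least `1`. Hence the slope grows at least as fast as `1/(1 - τ)`.
  have hn : ∀ τ ∈ D, 1 / (1 - τ) ≤ matNorm (hess φ (x + τ • v)) v := by
    intro τ hτ
    have hτ1 : 0 < 1 - τ := by linarith [hτ.2]
    by_contra! hcon
    have h1 : matNorm (hess φ (x + τ • v)) ((1 - τ) • v) < 1 := by
      rw [matNorm_smul, abs_of_pos hτ1]
      rwa [lt_div_iff₀ hτ1, mul_comm] at hcon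
    have := hB.add_mem_interior (hin τ hτ) h1
    rw [← hrest, add_sub_cancel] at this
    exact hz.2 this
  have hder : ∀ τ ∈ D, HasDerivAt (fun τ : ℝ => grad φ (x + τ • v) ⬝ᵥ v - (1 - τ)⁻¹)
      (matNorm (hess φ (x + τ • v)) v ^ 2 - - -1 / (1 - τ) ^ 2) τ := fun τ hτ => by
    have hτ1 : 0 < 1 - τ := by linarith [hτ.2]
    exact (hB.hasDerivAt_grad (hin τ hτ)).sub (((hasDerivAt_id τ).const_sub 1).inv hτ1.ne')
  have hmono : MonotoneOn (fun τ : ℝ => grad φ (x + τ • v) ⬝ᵥ v - (1 - τ)⁻¹) D := by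
    refine monotoneOn_of_hasDerivWithinAt_nonneg hD
      (fun τ hτ => (hder τ hτ).continuousAt.continuousWithinAt)
      (fun τ hτ => (hder τ (interior_subset hτ)).hasDerivWithinAt) (fun τ hτ => ?_)
    have hτ' := interior_subset hτ
    have hτ1 : 0 < 1 - τ := by linarith [hτ'.2]
    have := pow_le_pow_left₀ (by positivity) (hn τ hτ') 2
    rw [div_pow, one_pow] at this
    rw [neg_neg]
    linarith
  set c := grad φ x ⬝ᵥ v - 1 with hc
  -- At distance `ε = 1 - τ` the slope is at least `1/ε + c`, while `ε` times the slope is at most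
  -- `√ν ^ 2`. Letting `ε` tend to `0` gives the bound.
  have key : ∀ ε : ℝ, 0 < ε → ε ≤ 1 → 1 + c * ε ≤ √ν ^ 2 := by
    intro ε h1 h2
    have hτ : 1 - ε ∈ D := ⟨by linarith, by linarith⟩
    have m := hmono h0 hτ hτ.1
    simp only [zero_smul, add_zero, sub_zero, inv_one, sub_sub_cancel] at m
    have g := hB.grad_dotProduct_sub_le hK (hin _ hτ) hzK
    rw [hrest, sub_sub_cancel, dotProduct_smul, smul_eq_mul] at g
    have m' := mul_le_mul_of_nonneg_left m h1.le
    rw [mul_sub ε _ ε⁻¹, mul_inv_cancel₀ h1.ne'] at m'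
    linarith
  have hfin : 1 ≤ √ν ^ 2 := by
    by_contra! hcon
    have hd : 0 < 1 - √ν ^ 2 := by linarith
    have hε : 0 < (1 - √ν ^ 2) / (2 + |c|) := by positivity
    have hε2 : (1 - √ν ^ 2) / (2 + |c|) * (2 + |c|) = 1 - √ν ^ 2 := by field_simp
    set ε := (1 - √ν ^ 2) / (2 + |c|)
    have hε1 : ε ≤ 1 := by nlinarith [abs_nonneg c, sq_nonneg (√ν)]
    have := key ε hε hε1
    nlinarith [neg_abs_le c]
  -- No sign of `ν` is assumed. A negative `ν` would have `√ν = 0`, which contradicts `hfin`.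
  rcases le_or_gt 0 ν with h | h
  · rwa [Real.sq_sqrt h] at hfin
  · rw [Real.sqrt_eq_zero_of_nonpos h.le] at hfin
    norm_num at hfin

/-- The bound that controls the duality gap at an approximately centered point. -/
theorem grad_dotProduct_add_le (hB : IsSelfConcordantBarrier ν K φ) (hK : Convex ℝ K)
    (hν : 1 ≤ ν) (hx : x ∈ interior K) {z : Fin k → ℝ} (hz : z ∈ K) {γ : ℝ} (hγ : γ ≤ 1 / 3) :
    grad φ x ⬝ᵥ (z - x) + γ * matNorm (hess φ x) (z - x) ≤ 2 * ν := by
  have hν2 : √ν ^ 2 = ν := Real.sq_sqrt (by linarith)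
  set v := z - x with hv
  by_cases hv0 : v = 0
  · rw [hv0]
    simp only [dotProduct_zero, matNorm_zero]
    linarith
  have hr0 := matNorm_pos (hB.hess_posDef x hx) hv0
  set D : Set ℝ := Set.Ico 0 1 with hDdef
  have hD : Convex ℝ D := convex_Ico 0 1
  have hin : ∀ τ ∈ D, x + τ • v ∈ interior K := fun τ hτ =>
    add_smul_sub_mem_interior hK hx hz hτ.1 hτ.2
  have h0 : (0 : ℝ) ∈ D := ⟨le_rfl, zero_lt_one⟩
  have hh : (1 / 2 : ℝ) ∈ D := ⟨by norm_num, by norm_num⟩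
  set r := matNorm (hess φ x) v with hr
  -- The lower bound on the local norm makes slope plus `(r⁻¹ + τ)⁻¹` increasing. Comparing `τ = 0`
  -- with `τ = 1/2`, where the slope is at most `2ν`, gains `r - 2r/(2 + r) ≥ r/3` when `r > 1`. For
  -- `r ≤ 1` the term `γ r ≤ 1/3` is below `ν`.
  have hn : ∀ τ ∈ D, (r⁻¹ + τ)⁻¹ ≤ matNorm (hess φ (x + τ • v)) v := by
    intro τ hτ
    have h := abs_le.1 (hB.abs_inv_matNorm_sub_le hv0 hD hin h0 hτ)
    rw [zero_smul, add_zero, sub_zero, abs_of_nonneg hτ.1] at h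
    refine inv_le_of_inv_le₀ (matNorm_pos (hB.hess_posDef _ (hin τ hτ)) hv0) ?_
    linarith [h.2]
  have hder : ∀ τ ∈ D, HasDerivAt (fun τ : ℝ => grad φ (x + τ • v) ⬝ᵥ v + (r⁻¹ + τ)⁻¹)
      (matNorm (hess φ (x + τ • v)) v ^ 2 + -1 / (r⁻¹ + τ) ^ 2) τ := fun τ hτ => by
    have hτ1 : 0 < r⁻¹ + τ := by linarith [hτ.1, inv_pos.2 hr0]
    exact (hB.hasDerivAt_grad (hin τ hτ)).add (((hasDerivAt_id τ).const_add _).inv hτ1.ne')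
  have hmono : MonotoneOn (fun τ : ℝ => grad φ (x + τ • v) ⬝ᵥ v + (r⁻¹ + τ)⁻¹) D := by
    refine monotoneOn_of_hasDerivWithinAt_nonneg hD
      (fun τ hτ => (hder τ hτ).continuousAt.continuousWithinAt)
      (fun τ hτ => (hder τ (interior_subset hτ)).hasDerivWithinAt) (fun τ hτ => ?_)
    have hτ' := interior_subset hτ
    have hτ1 : 0 < r⁻¹ + τ := by linarith [hτ'.1, inv_pos.2 hr0]
    have := pow_le_pow_left₀ (inv_pos.2 hτ1).le (hn τ hτ') 2
    rw [inv_pow] at this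
    rw [neg_div, one_div]
    linarith
  have m := hmono h0 hh hh.1
  simp only [zero_smul, add_zero, inv_inv] at m
  have g := hB.grad_dotProduct_sub_le hK (hin _ hh) hz
  have hrest : z - (x + (1 / 2 : ℝ) • v) = (1 / 2 : ℝ) • v := by
    have : z = x + v := by rw [hv]; abel
    rw [this, add_sub_add_left_eq_sub]
    nth_rw 1 [← one_smul ℝ v]
    rw [← sub_smul]
    norm_num
  rw [hrest, dotProduct_smul, smul_eq_mul, hν2] at g
  have g0 := hB.grad_dotProduct_sub_le hK hx hz
  rw [hν2, ← hv] at g0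
  rcases le_or_gt r 1 with h1 | h1
  · nlinarith
  · have hinv : (r⁻¹ + 1 / 2)⁻¹ ≤ 2 / 3 * r := by
      have h2 : r⁻¹ + 1 / 2 = (2 + r) / (2 * r) := by field_simp
      rw [h2, inv_div, div_le_iff₀ (by linarith)]
      nlinarith
    nlinarith

end IsSelfConcordantBarrier

/-! ### One step in one block -/

namespace IsSelfConcordantBarrier

open scoped Matrix

variable {k : ℕ} {ν : ℝ} {K : Set (Fin k → ℝ)} {φ : (Fin k → ℝ) → ℝ} {x : Fin k → ℝ}

lemma add_mem_interior_of_le (hB : IsSelfConcordantBarrier ν K φ) (hx : x ∈ interior K)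
    {v : Fin k → ℝ} (hr : matNorm (hess φ x) v ≤ 1 / 100) : x + v ∈ interior K :=
  hB.add_mem_interior hx (by linarith)

/-- The relative error `8r` of the Hessian is halved by the square root; `5r` in place of `4r` also
serves for the reverse comparison, where `(1 - 8r)(1 + 5r)² ≥ 1` is needed. -/
lemma matNorm_add_le_mul (hB : IsSelfConcordantBarrier ν K φ) (hx : x ∈ interior K)
    {v : Fin k → ℝ} (hr : matNorm (hess φ x) v ≤ 1 / 100) (u : Fin k → ℝ) :
    matNorm (hess φ (x + v)) u ≤ (1 + 5 * matNorm (hess φ x) v) * matNorm (hess φ x) u := by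
  have h0 := matNorm_nonneg (hess φ x) v
  refine matNorm_le_of_quad_le (by linarith) ?_
  have h := (abs_le.1 (hB.abs_hess_sub_le hx hr u)).2
  have hq := quad_nonneg (hB.hess_posDef x hx).posSemidef u
  nlinarith [mul_nonneg h0 hq, mul_nonneg (mul_nonneg h0 h0) hq]

lemma matNorm_le_mul_add (hB : IsSelfConcordantBarrier ν K φ) (hx : x ∈ interior K)
    {v : Fin k → ℝ} (hr : matNorm (hess φ x) v ≤ 1 / 100) (u : Fin k → ℝ) :
    matNorm (hess φ x) u ≤ (1 + 5 * matNorm (hess φ x) v) * matNorm (hess φ (x + v)) u := by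
  have h0 := matNorm_nonneg (hess φ x) v
  refine matNorm_le_of_quad_le (by linarith) ?_
  have h := (abs_le.1 (hB.abs_hess_sub_le hx hr u)).1
  have hq := quad_nonneg (hB.hess_posDef x hx).posSemidef u
  set r := matNorm (hess φ x) v
  have h1 : (1 - 8 * r) * (u ⬝ᵥ hess φ x *ᵥ u) ≤ u ⬝ᵥ hess φ (x + v) *ᵥ u := by linarith
  refine le_trans ?_ (mul_le_mul_of_nonneg_left h1 (sq_nonneg (1 + 5 * r)))
  rw [← mul_assoc]
  refine le_mul_of_one_le_left hq ?_
  nlinarith [mul_nonneg h0 h0, mul_nonneg h0 (sub_nonneg.2 hr),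
    mul_nonneg (mul_nonneg h0 h0) (sub_nonneg.2 hr)]

lemma dual_add_le_mul (hB : IsSelfConcordantBarrier ν K φ) (hx : x ∈ interior K)
    {v : Fin k → ℝ} (hr : matNorm (hess φ x) v ≤ 1 / 100) (g : Fin k → ℝ) :
    matNorm (hess φ (x + v))⁻¹ g ≤ (1 + 5 * matNorm (hess φ x) v) * matNorm (hess φ x)⁻¹ g :=
  matNorm_inv_le_mul (hB.hess_posDef x hx) (hB.hess_posDef _ (hB.add_mem_interior_of_le hx hr))
    (by linarith [matNorm_nonneg (hess φ x) v]) (hB.matNorm_le_mul_add hx hr) g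

lemma dual_le_mul_add (hB : IsSelfConcordantBarrier ν K φ) (hx : x ∈ interior K)
    {v : Fin k → ℝ} (hr : matNorm (hess φ x) v ≤ 1 / 100) (g : Fin k → ℝ) :
    matNorm (hess φ x)⁻¹ g ≤ (1 + 5 * matNorm (hess φ x) v) * matNorm (hess φ (x + v))⁻¹ g :=
  matNorm_inv_le_mul (hB.hess_posDef _ (hB.add_mem_interior_of_le hx hr)) (hB.hess_posDef x hx)
    (by linarith [matNorm_nonneg (hess φ x) v]) (hB.matNorm_add_le_mul hx hr) g

/-- The gradient is close to its linearization at a close base point. -/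
lemma dual_grad_sub_le (hB : IsSelfConcordantBarrier ν K φ) (hx : x ∈ interior K)
    {p v : Fin k → ℝ} {ρ : ℝ} (hρ : matNorm (hess φ x) p + matNorm (hess φ x) v ≤ ρ)
    (hρ1 : ρ ≤ 1 / 100) :
    matNorm (hess φ x)⁻¹ (grad φ (x + p + v) - grad φ (x + p) - hess φ x *ᵥ v) ≤
      8 * ρ * matNorm (hess φ x) v := by
  have hp := hB.hess_posDef x hx
  have hv0 := matNorm_nonneg (hess φ x) v
  have hp0 := matNorm_nonneg (hess φ x) p
  have hρ0 : 0 ≤ ρ := by linarith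
  refine matNorm_inv_le hp (by positivity) fun u => ?_
  have hn : ∀ τ ∈ Set.Icc (0 : ℝ) 1, matNorm (hess φ x) (p + τ • v) ≤ ρ := by
    intro τ hτ
    refine (matNorm_add_le hp _ _).trans ?_
    rw [matNorm_smul, abs_of_nonneg hτ.1]
    nlinarith [hτ.2]
  have hin : ∀ τ ∈ Set.Icc (0 : ℝ) 1, x + p + τ • v ∈ interior K := fun τ hτ => by
    rw [add_assoc]
    exact hB.add_mem_interior_of_le hx ((hn τ hτ).trans hρ1)
  have hder : ∀ τ ∈ Set.Icc (0 : ℝ) 1, HasDerivAt (fun τ : ℝ => grad φ (x + p + τ • v) ⬝ᵥ u)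
      (v ⬝ᵥ hess φ (x + p + τ • v) *ᵥ u) τ := fun τ hτ =>
    hasDerivAt_grad_line ((hB.contDiffAt (hin τ hτ)).of_le (by norm_num)) u
  -- For fixed `u` the mean value theorem yields one intermediate Hessian, whose difference from
  -- `hess φ x` is small as a bilinear form.
  obtain ⟨τ, hτ, he⟩ := exists_hasDerivAt_eq_slope (fun τ : ℝ => grad φ (x + p + τ • v) ⬝ᵥ u) _
    zero_lt_one (fun τ hτ => (hder τ hτ).continuousAt.continuousWithinAt)
    (fun τ hτ => hder τ (Set.Ioo_subset_Icc_self hτ))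
  have hτ' := Set.Ioo_subset_Icc_self hτ
  simp only [zero_smul, one_smul, add_zero, sub_zero, div_one] at he
  rw [sub_dotProduct, sub_dotProduct, ← he, dotProduct_comm (hess φ x *ᵥ v),
    dotProduct_mulVec_symm hp.isHermitian u v, ← dotProduct_sub, ← Matrix.sub_mulVec, mul_assoc]
  refine (le_abs_self _).trans (abs_bilin_le ?_ hp (fun w => ?_) v u)
  · exact (hB.hess_posDef _ (hin τ hτ')).isHermitian.sub hp.isHermitian
  · rw [Matrix.sub_mulVec, dotProduct_sub, add_assoc]
    refine (hB.abs_hess_sub_le hx ((hn τ hτ').trans hρ1) w).trans ?_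
    exact mul_le_mul_of_nonneg_right (by linarith [hn τ hτ']) (quad_nonneg hp.posSemidef w)

variable {x' q q' : Fin k → ℝ} {α : ℝ}

/-- Here `q` and `q'` stand for `s_i / t` and its approximation. They contribute `α`, and the
gradients contribute `(1 + 8α) α`. -/
lemma dual_mu_sub_le (hB : IsSelfConcordantBarrier ν K φ) (hx' : x' ∈ interior K)
    (hα : α ≤ 1 / 10000) (hx : matNorm (hess φ x') (x' - x) < α)
    (hq : matNorm (hess φ x')⁻¹ (q' - q) ≤ α) :
    matNorm (hess φ x')⁻¹ ((q + grad φ x) - (q' + grad φ x')) ≤ 2.1 * α := by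
  have hp := hB.hess_posDef x' hx'
  have hn : matNorm (hess φ x') (x - x') < α := by rwa [← matNorm_neg, neg_sub]
  have h0 := matNorm_nonneg (hess φ x') (x - x')
  have hg := hB.dual_grad_sub_le (p := 0) (v := x - x') (ρ := α) hx'
    (by rw [matNorm_zero]; linarith) (by linarith)
  rw [add_zero, add_sub_cancel] at hg
  have e : (q + grad φ x) - (q' + grad φ x') = -(q' - q) +
      ((grad φ x - grad φ x' - hess φ x' *ᵥ (x - x')) + hess φ x' *ᵥ (x - x')) := by abel
  rw [e]
  refine (matNorm_add_le hp.inv _ _).trans ?_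
  rw [matNorm_neg]
  have h2 := matNorm_add_le hp.inv (grad φ x - grad φ x' - hess φ x' *ᵥ (x - x'))
    (hess φ x' *ᵥ (x - x'))
  rw [matNorm_mulVec hp] at h2
  nlinarith

/-- Changing the vector costs `2.1 α`. Changing the norm costs a factor `1 + 5α`, harmless because
`γ` is small. -/
lemma abs_gam_sub_le (hB : IsSelfConcordantBarrier ν K φ) (hx' : x' ∈ interior K)
    (hα : α ≤ 1 / 10000) (hx : matNorm (hess φ x') (x' - x) < α)
    (hq : matNorm (hess φ x')⁻¹ (q' - q) ≤ α)
    (hγ : matNorm (hess φ x)⁻¹ (q + grad φ x) ≤ 1 / 100) :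
    |matNorm (hess φ x')⁻¹ (q' + grad φ x') - matNorm (hess φ x)⁻¹ (q + grad φ x)| ≤ 3 * α := by
  have hp := hB.hess_posDef x' hx'
  have hn : matNorm (hess φ x') (x - x') < α := by rwa [← matNorm_neg, neg_sub]
  have h0 := matNorm_nonneg (hess φ x') (x - x')
  have hd := hB.dual_mu_sub_le hx' hα hx hq
  have h1 := hB.dual_add_le_mul hx' (v := x - x') (by linarith) (q + grad φ x)
  have h2 := hB.dual_le_mul_add hx' (v := x - x') (by linarith) (q + grad φ x)
  rw [add_sub_cancel] at h1 h2
  have t1 := matNorm_add_le hp.inv (q' + grad φ x') ((q + grad φ x) - (q' + grad φ x'))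
  have t2 := matNorm_sub_le hp.inv (q + grad φ x) ((q + grad φ x) - (q' + grad φ x'))
  rw [add_sub_cancel] at t1
  rw [sub_sub_cancel] at t2
  have g0 := matNorm_nonneg (hess φ x)⁻¹ (q + grad φ x)
  have g1 := matNorm_nonneg (hess φ x')⁻¹ (q + grad φ x)
  set γ := matNorm (hess φ x)⁻¹ (q + grad φ x)
  set γ' := matNorm (hess φ x')⁻¹ (q' + grad φ x')
  set γ₁ := matNorm (hess φ x')⁻¹ (q + grad φ x)
  set r := matNorm (hess φ x') (x - x')
  have hγ₁ : γ₁ ≤ 1 / 50 := by nlinarith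
  have a1 : γ ≤ γ₁ + 0.1 * α := by nlinarith [mul_nonneg h0 g1]
  have a2 : γ₁ ≤ γ + 0.05 * α := by nlinarith [mul_nonneg h0 g0]
  rw [abs_le]
  constructor <;> linarith

/-- The effect of a centering step on the centrality of a block. -/
lemma gam_step_le (hB : IsSelfConcordantBarrier ν K φ) (hx' : x' ∈ interior K)
    (hxK : x ∈ interior K) (hα : α ≤ 1 / 10000) (hx : matNorm (hess φ x') (x' - x) < α)
    (hq : matNorm (hess φ x')⁻¹ (q' - q) ≤ α)
    (hγ : matNorm (hess φ x)⁻¹ (q + grad φ x) ≤ 1 / 4096)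
    {δ w g : Fin k → ℝ} {θ : ℝ} (hθ0 : 0 ≤ θ) (hθ1 : θ ≤ 1)
    (hwg : w + g = -θ • (q' + grad φ x'))
    (hw : matNorm (hess φ x')⁻¹ (hess φ x' *ᵥ δ - w) ≤ 2 * α * matNorm (hess φ x') δ)
    (hδ : matNorm (hess φ x') δ ≤ 2 * α) :
    x + δ ∈ interior K ∧
    matNorm (hess φ (x + δ))⁻¹ (q + g + grad φ (x + δ)) ≤
      matNorm (hess φ x)⁻¹ (q + grad φ x) - θ * matNorm (hess φ x')⁻¹ (q' + grad φ x')
        + 6 * α * θ + 0.01 * matNorm (hess φ x') δ := by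
  have hp := hB.hess_posDef x' hx'
  have hn : matNorm (hess φ x') (x - x') < α := by rwa [← matNorm_neg, neg_sub]
  have h0 := matNorm_nonneg (hess φ x') (x - x')
  have a0 := matNorm_nonneg (hess φ x') δ
  have hα0 : 0 < α := lt_of_le_of_lt h0 hn
  have hδx := hB.matNorm_add_le_mul hx' (v := x - x') (by linarith) δ
  rw [add_sub_cancel] at hδx
  have b0 := matNorm_nonneg (hess φ x) δ
  have hδx' : matNorm (hess φ x) δ ≤ 1.1 * matNorm (hess φ x') δ := by nlinarith
  have hin : x + δ ∈ interior K := hB.add_mem_interior_of_le hxK (by linarith)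
  refine ⟨hin, ?_⟩
  have hpn := hB.hess_posDef _ hin
  have hd := hB.dual_mu_sub_le hx' hα hx hq
  have hgam := (abs_le.1 (hB.abs_gam_sub_le hx' hα hx hq (by linarith))).2
  have hpd : matNorm (hess φ x') ((x - x') + δ) ≤ 3 * α := by
    refine (matNorm_add_le hp _ _).trans ?_
    linarith
  have hdual : ∀ g, matNorm (hess φ (x + δ))⁻¹ g ≤ 1.1 * matNorm (hess φ x')⁻¹ g := by
    intro g
    have h := hB.dual_add_le_mul hx' (v := (x - x') + δ) (by linarith) g
    rw [← add_assoc, add_sub_cancel] at h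
    have := matNorm_nonneg (hess φ x')⁻¹ g
    nlinarith
  have hμ := hB.dual_add_le_mul hxK (v := δ) (by linarith) (q + grad φ x)
  have hE := hB.dual_grad_sub_le (p := x - x') (v := δ) (ρ := 3 * α) hx' (by linarith)
    (by linarith)
  rw [add_sub_cancel] at hE
  set μ := q + grad φ x with hμdef
  set μ' := q' + grad φ x' with hμ'def
  -- The direction is split into a primal part `w` and a dual part `g`. The new centrality vector is
  -- `(1 - θ) μ` plus three errors: using `μ'` for `μ`, using `V` for the inverse Hessian, and
  -- linearizing the gradient.
  have e : q + g + grad φ (x + δ) = ((1 - θ) • μ + θ • (μ - μ')) +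
      ((hess φ x' *ᵥ δ - w) + (grad φ (x + δ) - grad φ x - hess φ x' *ᵥ δ)) := by
    have hg : g = -θ • μ' - w := eq_sub_of_add_eq' hwg
    rw [hg, smul_sub, sub_smul, one_smul, neg_smul, hμdef]
    abel
  rw [e]
  have g0 := matNorm_nonneg (hess φ x)⁻¹ μ
  have n1 : matNorm (hess φ (x + δ))⁻¹ ((1 - θ) • μ + θ • (μ - μ')) ≤
      (1 - θ) * matNorm (hess φ (x + δ))⁻¹ μ + θ * (1.1 * (2.1 * α)) := by
    refine (matNorm_add_le hpn.inv _ _).trans ?_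
    rw [matNorm_smul, matNorm_smul, abs_of_nonneg (sub_nonneg.2 hθ1), abs_of_nonneg hθ0]
    refine add_le_add le_rfl (mul_le_mul_of_nonneg_left ?_ hθ0)
    refine (hdual _).trans ?_
    linarith
  have n2 : matNorm (hess φ (x + δ))⁻¹
      ((hess φ x' *ᵥ δ - w) + (grad φ (x + δ) - grad φ x - hess φ x' *ᵥ δ)) ≤
      30 * α * matNorm (hess φ x') δ := by
    refine (hdual _).trans ?_
    have := matNorm_add_le hp.inv (hess φ x' *ᵥ δ - w)
      (grad φ (x + δ) - grad φ x - hess φ x' *ᵥ δ)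
    nlinarith [mul_nonneg hα0.le a0]
  refine (matNorm_add_le hpn.inv _ _).trans ?_
  set γ := matNorm (hess φ x)⁻¹ μ
  set a := matNorm (hess φ x') δ
  set b := matNorm (hess φ x) δ
  have n3 : (1 - θ) * matNorm (hess φ (x + δ))⁻¹ μ ≤ (1 - θ) * γ + 6 * a * γ := by
    have h1 : (1 - θ) * matNorm (hess φ (x + δ))⁻¹ μ ≤ (1 - θ) * ((1 + 5 * b) * γ) :=
      mul_le_mul_of_nonneg_left hμ (sub_nonneg.2 hθ1)
    have h2 : b * γ ≤ 1.1 * a * γ := mul_le_mul_of_nonneg_right hδx' g0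
    have h3 : 0 ≤ θ * (b * γ) := mul_nonneg hθ0 (mul_nonneg b0 g0)
    nlinarith [mul_nonneg a0 g0]
  have n4 : 6 * a * γ ≤ 0.002 * a := by nlinarith
  have n5 : 30 * α * a ≤ 0.003 * a := by nlinarith
  have n6 : θ * matNorm (hess φ x')⁻¹ μ' ≤ θ * (γ + 3 * α) :=
    mul_le_mul_of_nonneg_left (by linarith) hθ0
  nlinarith [mul_nonneg hθ0 hα0.le]

/-- The effect of decreasing the path parameter on the centrality of a block. -/
lemma gam_rescale_le (hB : IsSelfConcordantBarrier ν K φ) (hxK : x ∈ interior K) (hν : 1 ≤ ν)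
    {η : ℝ} (hη0 : 0 ≤ η) (hη1 : η ≤ 1 / 4)
    (hγ : matNorm (hess φ x)⁻¹ (q + grad φ x) ≤ 1) :
    matNorm (hess φ x)⁻¹ ((1 - η)⁻¹ • q + grad φ x) ≤
      matNorm (hess φ x)⁻¹ (q + grad φ x) + 4 * η * √ν := by
  have hp := hB.hess_posDef x hxK
  have hη : 0 < 1 - η := by linarith
  -- Written this way, only the gradient, of dual norm at most `√ν`, is perturbed.
  have e : (1 - η)⁻¹ • q + grad φ x = (1 - η)⁻¹ • ((q + grad φ x) - η • grad φ x) := by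
    have h1 : grad φ x = (1 - η)⁻¹ • ((1 - η) • grad φ x) := by
      rw [smul_smul, inv_mul_cancel₀ hη.ne', one_smul]
    nth_rw 1 [h1]
    rw [← smul_add, sub_smul, one_smul]
    congr 1
    abel
  have hs : 1 ≤ √ν := by rwa [Real.one_le_sqrt]
  rw [e, matNorm_smul, abs_of_pos (inv_pos.2 hη), inv_mul_le_iff₀ hη]
  refine (matNorm_sub_le hp.inv _ _).trans ?_
  rw [matNorm_smul, abs_of_nonneg hη0]
  have hg := mul_le_mul_of_nonneg_left (hB.grad_le x hxK) hη0
  set γ := matNorm (hess φ x)⁻¹ (q + grad φ x)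
  nlinarith [mul_nonneg hη0 (sub_nonneg.2 hγ), mul_nonneg hη0 (sub_nonneg.2 hs),
    mul_nonneg (mul_nonneg hη0 (sub_nonneg.2 hη1)) (by linarith : 0 ≤ √ν)]

end IsSelfConcordantBarrier

/-! ### The potential -/

set_option maxHeartbeats 1000000 in
open Classical in
/-- The soft-max potential stays bounded under a step that decreases the terms along the
normalized gradient. -/
lemma sum_exp_le_of_step {ι : Type} [Fintype ι] {lam α : ℝ} (hlam : 0 < lam) (hα : 0 < α)
    (hla : lam * α ≤ 1 / 2 ^ 20) (hlow : lam * (96 * √α) ≤ 3 / 32) {γ γ' γ₁ β w : ι → ℝ}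
    (hγ₁ : ∀ i, |γ₁ i - γ i| ≤ 3 * α)
    (hβ : ∀ i, β i = if 96 * √α ≤ γ₁ i then
      α * (Real.exp (lam * γ₁ i) / √(∑ j, Real.exp (2 * lam * γ₁ j))) else 0)
    (hw0 : ∀ i, 0 ≤ w i) (hw : √(∑ i, w i ^ 2) ≤ 0.03 * α)
    (hγ' : ∀ i, γ' i ≤ γ i - 0.99 * β i + w i)
    (hΦ : ∑ i, Real.exp (lam * γ i) ≤ 4 * Fintype.card ι) :
    ∑ i, Real.exp (lam * γ' i) ≤ 4 * Fintype.card ι := by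
  rcases isEmpty_or_nonempty ι with hι | hι
  · simp
  set S := √(∑ j, Real.exp (2 * lam * γ₁ j)) with hSdef
  set e : ι → ℝ := fun i => Real.exp (lam * γ i) with he
  set e₁ : ι → ℝ := fun i => Real.exp (lam * γ₁ i) with he₁
  have he0 : ∀ i, 0 < e i := fun i => Real.exp_pos _
  have he10 : ∀ i, 0 < e₁ i := fun i => Real.exp_pos _
  have hS : S = √(∑ j, e₁ j ^ 2) := by
    rw [hSdef]
    congr 1
    refine Finset.sum_congr rfl fun i _ => ?_
    rw [he₁, ← Real.exp_nat_mul]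
    push_cast
    ring_nf
  have hsum0 : 0 < ∑ j, e₁ j ^ 2 :=
    Finset.sum_pos (fun i _ => pow_pos (he10 i) 2) Finset.univ_nonempty
  have hS0 : 0 < S := by rw [hS]; exact Real.sqrt_pos.2 hsum0
  have hS2 : S ^ 2 = ∑ j, e₁ j ^ 2 := by rw [hS, Real.sq_sqrt hsum0.le]
  set E := √(∑ j, e j ^ 2) with hE
  set N : ℝ := (Fintype.card ι : ℝ) with hN
  have hN0 : 1 ≤ N := by
    rw [hN]
    exact_mod_cast Fintype.card_pos
  have hsN0 : 1 ≤ √N := by rwa [Real.one_le_sqrt]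
  have hsN2 : √N ^ 2 = N := Real.sq_sqrt (by linarith)
  have hone : √(∑ _j : ι, (1 : ℝ) ^ 2) = √N := by simp [hN]
  have hla0 : 0 < lam * α := mul_pos hlam hα
  -- The exponents at the approximate point differ by at most `3λα ≤ 3/2^20`, so the weights agree
  -- within a tenth of a percent.
  have hee : ∀ i, 0.999 * e₁ i ≤ e i ∧ 0.999 * e i ≤ e₁ i := by
    have hexp : ∀ z : ℝ, |z| ≤ 3 * (lam * α) → 0.999 ≤ Real.exp z := by
      intro z hz
      have := Real.add_one_le_exp z
      have := neg_abs_le z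
      norm_num at hla
      linarith
    intro i
    have hd : |lam * γ₁ i - lam * γ i| ≤ 3 * (lam * α) := by
      rw [← mul_sub, abs_mul, abs_of_pos hlam]
      nlinarith [hγ₁ i]
    constructor
    · have : e i = Real.exp (lam * γ i - lam * γ₁ i) * e₁ i := by
        rw [he₁, ← Real.exp_add, sub_add_cancel]
      rw [this]
      exact mul_le_mul_of_nonneg_right (hexp _ (by rwa [abs_sub_comm])) (he10 i).le
    · have : e₁ i = Real.exp (lam * γ₁ i - lam * γ i) * e i := by
        rw [he, ← Real.exp_add, sub_add_cancel]
      rw [this]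
      exact mul_le_mul_of_nonneg_right (hexp _ hd) (he0 i).le
  have he1S : ∀ i, e₁ i / S ≤ 1 := fun i => by
    rw [div_le_one hS0, hS]
    apply Real.le_sqrt_of_sq_le
    exact Finset.single_le_sum (f := fun j => e₁ j ^ 2) (fun j _ => sq_nonneg _) (Finset.mem_univ i)
  have hβ0 : ∀ i, 0 ≤ β i ∧ β i ≤ α := fun i => by
    rw [hβ i]
    split_ifs
    · exact ⟨mul_nonneg hα.le (div_nonneg (he10 i).le hS0.le),
        mul_le_of_le_one_right hα.le (he1S i)⟩
    · exact ⟨le_rfl, hα.le⟩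
  have hw1 : ∀ i, w i ≤ 0.03 * α := fun i => by
    refine le_trans ?_ hw
    apply Real.le_sqrt_of_sq_le
    exact Finset.single_le_sum (f := fun j => w j ^ 2) (fun j _ => sq_nonneg _) (Finset.mem_univ i)
  -- Second-order expansion: the exponent changes by at most `1/1000`, so the quadratic term is
  -- absorbed by relaxing `1` to `1.01` and `0.99` to `0.98`.
  have hterm : ∀ i, Real.exp (lam * γ' i) ≤
      e i + lam * (1.01 * (e i * w i) - 0.98 * (e i * β i)) := by
    intro i
    have h1 : Real.exp (lam * γ' i) ≤ e i * Real.exp (lam * (w i - 0.99 * β i)) := by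
      rw [he, ← Real.exp_add]
      apply Real.exp_le_exp.2
      rw [← mul_add]
      exact mul_le_mul_of_nonneg_left (by linarith [hγ' i]) hlam.le
    have hu0 : 0 ≤ w i + 0.99 * β i := by linarith [hw0 i, (hβ0 i).1]
    have hy : |lam * (w i - 0.99 * β i)| ≤ lam * (w i + 0.99 * β i) := by
      rw [abs_mul, abs_of_pos hlam]
      refine mul_le_mul_of_nonneg_left ?_ hlam.le
      rw [abs_le]
      constructor <;> linarith [hw0 i, (hβ0 i).1]
    have hy1 : lam * (w i + 0.99 * β i) ≤ 1 / 1000 := by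
      have : lam * (w i + 0.99 * β i) ≤ lam * (2 * α) :=
        mul_le_mul_of_nonneg_left (by linarith [hw1 i, (hβ0 i).2]) hlam.le
      norm_num at hla
      linarith
    have h2 := (abs_le.1 (Real.abs_exp_sub_one_sub_id_le
      (x := lam * (w i - 0.99 * β i)) (by linarith))).2
    have h3 : (lam * (w i - 0.99 * β i)) ^ 2 ≤ 1 / 1000 * (lam * (w i + 0.99 * β i)) := by
      rw [← sq_abs]
      nlinarith [abs_nonneg (lam * (w i - 0.99 * β i))]
    have h4 : Real.exp (lam * (w i - 0.99 * β i)) ≤ 1 + lam * (1.01 * w i - 0.98 * β i) := by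
      nlinarith [mul_nonneg hlam.le (hw0 i), mul_nonneg hlam.le (hβ0 i).1]
    refine h1.trans ((mul_le_mul_of_nonneg_left h4 (he0 i).le).trans (le_of_eq ?_))
    ring
  have hew : ∑ i, e i * w i ≤ E * (0.03 * α) :=
    (Real.sum_mul_le_sqrt_mul_sqrt _ _ _).trans
      (mul_le_mul_of_nonneg_left hw (Real.sqrt_nonneg _))
  -- Frozen blocks have `λγ ≤ 3/32 + 3/2^20 < 1/2`, so their weights are below `2`.
  have hlowe : ∀ i, ¬ 96 * √α ≤ γ₁ i → e i ≤ 2 := by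
    intro i hi
    have h1 : lam * γ i ≤ 1 / 2 := by
      have h2 : lam * γ i ≤ lam * (96 * √α + 3 * α) :=
        mul_le_mul_of_nonneg_left (by linarith [(abs_le.1 (hγ₁ i)).1]) hlam.le
      norm_num at hla
      linarith
    have h3 : Real.exp (1 / 2) ≤ 2 := by
      have := (abs_le.1 (Real.abs_exp_sub_one_sub_id_le (x := 1 / 2) (by norm_num [abs_le]))).2
      linarith
    exact (Real.exp_le_exp.2 h1).trans h3
  -- Subtracting `2 e₁/S` makes the lower bound valid for frozen blocks as well; summed over the
  -- blocks it costs at most `2√N`.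
  have hebi : ∀ i, α * ((e i * e₁ i) / S - 2 * (e₁ i / S)) ≤ e i * β i := by
    intro i
    have hq : 0 ≤ e₁ i / S := div_nonneg (he10 i).le hS0.le
    rw [hβ i, mul_div_assoc, ← sub_mul]
    split_ifs with h
    · nlinarith [mul_nonneg hα.le hq]
    · have := hlowe i h
      rw [mul_zero]
      exact mul_nonpos_of_nonneg_of_nonpos hα.le
        (mul_nonpos_of_nonpos_of_nonneg (by linarith) hq)
  have hprod : 0.999 * S ≤ ∑ i, (e i * e₁ i) / S := by
    rw [← Finset.sum_div, le_div_iff₀ hS0, mul_assoc, ← sq, hS2, Finset.mul_sum]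
    refine Finset.sum_le_sum fun i _ => ?_
    nlinarith [(hee i).1, he10 i]
  have hSE : 0.999 * E ≤ S := by
    rw [hS, hE]
    apply Real.le_sqrt_of_sq_le
    rw [mul_pow, Real.sq_sqrt (Finset.sum_nonneg fun i _ => sq_nonneg _), Finset.mul_sum]
    refine Finset.sum_le_sum fun i _ => ?_
    rw [← mul_pow]
    exact pow_le_pow_left₀ (mul_nonneg (by norm_num) (he0 i).le) (hee i).2 2
  have hsum1 : ∑ i, e₁ i / S ≤ √N := by
    rw [← Finset.sum_div, div_le_iff₀ hS0, hS, ← hone]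
    simpa using Real.sum_mul_le_sqrt_mul_sqrt Finset.univ (fun _ => (1 : ℝ)) e₁
  have hE0 : 0 ≤ E := Real.sqrt_nonneg _
  have heb : α * (0.99 * E - 2 * √N) ≤ ∑ i, e i * β i := by
    refine le_trans ?_ (Finset.sum_le_sum fun i _ => hebi i)
    rw [← Finset.mul_sum, Finset.sum_sub_distrib, ← Finset.mul_sum]
    refine mul_le_mul_of_nonneg_left ?_ hα.le
    linarith
  have hEΦ : ∑ i, e i ≤ √N * E := by
    rw [← hone]
    simpa using Real.sum_mul_le_sqrt_mul_sqrt Finset.univ (fun _ => (1 : ℝ)) e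
  have hmain : ∑ i, Real.exp (lam * γ' i) ≤ ∑ i, e i + lam * (α * (2 * √N - 0.9 * E)) := by
    refine (Finset.sum_le_sum fun i _ => hterm i).trans ?_
    rw [Finset.sum_add_distrib, ← Finset.mul_sum, Finset.sum_sub_distrib, ← Finset.mul_sum,
      ← Finset.mul_sum]
    refine add_le_add le_rfl (mul_le_mul_of_nonneg_left ?_ hlam.le)
    nlinarith [mul_nonneg hα.le hE0, mul_nonneg hα.le (zero_le_one.trans hsN0)]
  -- If the potential is at least `3N`, Cauchy-Schwarz gives `E ≥ 3√N` and the drift is nonpositive.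
  -- Otherwise the drift is at most `N`.
  rcases le_or_gt (3 * N) (∑ i, e i) with h | h
  · have h3 : 3 * √N ≤ E := by
      refine le_of_mul_le_mul_left ?_ (zero_lt_one.trans_le hsN0)
      nlinarith
    have : lam * (α * (2 * √N - 0.9 * E)) ≤ 0 := by
      rw [← mul_assoc]
      exact mul_nonpos_of_nonneg_of_nonpos hla0.le (by linarith)
    change ∑ i, e i ≤ 4 * N at hΦ
    linarith
  · have : lam * (α * (2 * √N - 0.9 * E)) ≤ N := by
      rw [← mul_assoc]
      have h1 : lam * α * (2 * √N - 0.9 * E) ≤ 1 / 2 * (2 * √N) := by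
        refine mul_le_mul_of_nonneg (by norm_num at hla ⊢; linarith) (by linarith) hla0.le
          (by linarith)
      nlinarith
    linarith

/-! ### The linear algebra of a step -/

section Step

open scoped Matrix

open scoped MatrixOrder in
lemma msqrt_mul_self {J : Type} [Fintype J] [DecidableEq J] {V : Matrix J J ℝ}
    (hV : V.PosSemidef) : msqrt V * msqrt V = V :=
  CFC.sqrt_mul_sqrt_self V (Matrix.nonneg_iff_posSemidef.2 hV)

lemma isUnit_det_msqrt {J : Type} [Fintype J] [DecidableEq J] {V : Matrix J J ℝ}
    (hV : V.PosDef) : IsUnit (msqrt V).det := by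
  have h := (Matrix.isUnit_iff_isUnit_det _).1 hV.isUnit
  rw [← msqrt_mul_self hV.posSemidef, Matrix.det_mul] at h
  exact isUnit_of_mul_isUnit_left h

/-- The steps in `x` and in `s` are an orthogonal decomposition of the centering direction. -/
lemma exists_step_decomposition {J : Type} [Fintype J] [DecidableEq J] {d : ℕ}
    {A : Matrix (Fin d) J ℝ} (hA : LinearIndependent ℝ A.row) {V : Matrix J J ℝ} (hV : V.PosDef)
    (t : ℝ) (h : J → ℝ) :
    ∃ (w : J → ℝ) (y : Fin d → ℝ), w + Aᵀ *ᵥ y = h ∧ deltaX A V h = V *ᵥ w ∧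
      deltaS A V t h = t • Aᵀ *ᵥ y ∧ A *ᵥ deltaX A V h = 0 := by
  have hG : (A * V * Aᵀ).PosDef := by
    have := hV.mul_mul_conjTranspose_same (B := A) (Matrix.vecMul_injective_iff.2 hA)
    simpa using this
  set G := A * V * Aᵀ with hGdef
  have hm := msqrt_mul_self hV.posSemidef
  -- This `y` solves the normal equations `A V Aᵀ y = A V h`, which puts `V (h - Aᵀ y)` in the
  -- kernel of `A`. The square roots of `V` cancel.
  set y := G⁻¹ *ᵥ (A *ᵥ (V *ᵥ h)) with hy
  have hX : deltaX A V h = V *ᵥ (h - Aᵀ *ᵥ y) := by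
    have e : msqrt V * (1 - proj A V) * msqrt V = V - V * (Aᵀ * (G⁻¹ * (A * V))) := by
      rw [proj, mul_sub, sub_mul, mul_one, hm]
      congr 1
      calc _ = (msqrt V * msqrt V) * Aᵀ * G⁻¹ * A * (msqrt V * msqrt V) := by
            simp only [Matrix.mul_assoc, hGdef]
        _ = _ := by rw [hm]; simp only [Matrix.mul_assoc]
    rw [deltaX, e, hy, Matrix.sub_mulVec, Matrix.mulVec_sub]
    simp only [Matrix.mulVec_mulVec]
  refine ⟨h - Aᵀ *ᵥ y, y, sub_add_cancel _ _, hX, ?_, ?_⟩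
  · have e : (msqrt V)⁻¹ * proj A V * msqrt V = Aᵀ * (G⁻¹ * (A * V)) := by
      rw [proj]
      calc _ = ((msqrt V)⁻¹ * msqrt V) * Aᵀ * G⁻¹ * A * (msqrt V * msqrt V) := by
            simp only [Matrix.mul_assoc, hGdef]
        _ = _ := by
            rw [hm, Matrix.nonsing_inv_mul _ (isUnit_det_msqrt hV)]
            simp only [Matrix.mul_assoc, Matrix.one_mul]
    rw [deltaS, e, hy]
    simp only [Matrix.mulVec_mulVec]
  · have e : A *ᵥ (V *ᵥ (Aᵀ *ᵥ y)) = A *ᵥ (V *ᵥ h) := by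
      have : A *ᵥ (V *ᵥ (Aᵀ *ᵥ y)) = G *ᵥ y := by
        simp only [Matrix.mulVec_mulVec, Matrix.mul_assoc, hGdef]
      rw [this, hy, mulVec_inv_mulVec hG]
    rw [hX, Matrix.mulVec_sub, Matrix.mulVec_sub, e, sub_self]

/-! ### Block vectors and block diagonal matrices. -/

section Blocks

variable {ι : Type} {n : ι → ℕ}

lemma dotProduct_eq_sum_blk [Fintype ι] (x y : (Σ i, Fin (n i)) → ℝ) :
    x ⬝ᵥ y = ∑ i, blk x i ⬝ᵥ blk y i := by
  simp only [dotProduct, blk]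
  exact Fintype.sum_sigma _

variable [Fintype ι] [DecidableEq ι]

lemma blk_blockDiagonal'_mulVec (V : ∀ i, Matrix (Fin (n i)) (Fin (n i)) ℝ)
    (w : (Σ i, Fin (n i)) → ℝ) (i : ι) :
    blk (Matrix.blockDiagonal' V *ᵥ w) i = V i *ᵥ blk w i := by
  funext j
  simp only [blk, Matrix.mulVec, dotProduct]
  rw [Fintype.sum_sigma, Finset.sum_eq_single i]
  · refine Finset.sum_congr rfl fun l _ => ?_
    rw [Matrix.blockDiagonal'_apply_eq]
  · intro i' _ hi
    refine Finset.sum_eq_zero fun l _ => ?_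
    rw [Matrix.blockDiagonal'_apply_ne _ _ _ hi.symm, zero_mul]
  · simp

lemma posDef_blockDiagonal' {V : ∀ i, Matrix (Fin (n i)) (Fin (n i)) ℝ} (hV : ∀ i, (V i).PosDef) :
    (Matrix.blockDiagonal' V).PosDef := by
  refine Matrix.PosDef.of_dotProduct_mulVec_pos ?_ fun x hx => ?_
  · rw [Matrix.IsHermitian, Matrix.blockDiagonal'_conjTranspose]
    congr 1
    funext i
    exact (hV i).isHermitian
  · have hblk : ∃ i, blk x i ≠ 0 := by
      by_contra! hcon
      exact hx (funext fun p => congrFun (hcon p.1) p.2)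
    obtain ⟨i, hi⟩ := hblk
    rw [star_trivial, dotProduct_eq_sum_blk]
    simp only [blk_blockDiagonal'_mulVec]
    refine Finset.sum_pos' (fun i _ => quad_nonneg (hV i).posSemidef _) ⟨i, Finset.mem_univ i, ?_⟩
    simpa using (hV i).dotProduct_mulVec_pos hi

end Blocks

/-! ### Spectral approximations of the inverse Hessian. -/

section Approximation

variable {J : Type} [Fintype J] [DecidableEq J] {H V : Matrix J J ℝ} {α : ℝ}

lemma posDef_of_sub_smul_inv (hH : H.PosDef) (hα1 : α < 1) (hl : (V - (1 - α) • H⁻¹).PosSemidef) :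
    V.PosDef := by
  have := (hH.inv.smul (show (0 : ℝ) < 1 - α by linarith)).add_posSemidef hl
  rwa [add_sub_cancel] at this

/-- A matrix close to the inverse Hessian acts like the inverse Hessian. -/
lemma dual_mulVec_sub_le (hH : H.PosDef) (hα0 : 0 ≤ α) (hα : α ≤ 1 / 4)
    (hl : (V - (1 - α) • H⁻¹).PosSemidef) (hu : ((1 + α) • H⁻¹ - V).PosSemidef) (w : J → ℝ) :
    matNorm H⁻¹ (H *ᵥ (V *ᵥ w) - w) ≤ 2 * α * matNorm H (V *ᵥ w) := by
  have hVh : V.IsHermitian := (posDef_of_sub_smul_inv hH (by linarith) hl).isHermitian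
  have hB : (V - H⁻¹).IsHermitian := hVh.sub hH.inv.isHermitian
  have hBb : ∀ u, |u ⬝ᵥ (V - H⁻¹) *ᵥ u| ≤ α * (u ⬝ᵥ H⁻¹ *ᵥ u) := by
    intro u
    have h1 := quad_nonneg hl u
    have h2 := quad_nonneg hu u
    simp only [Matrix.sub_mulVec, Matrix.smul_mulVec, dotProduct_sub, dotProduct_smul,
      smul_eq_mul] at h1 h2 ⊢
    rw [abs_le]
    constructor <;> linarith
  have e : H *ᵥ (V *ᵥ w) - w = H *ᵥ ((V - H⁻¹) *ᵥ w) := by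
    rw [Matrix.sub_mulVec, Matrix.mulVec_sub, mulVec_inv_mulVec hH]
  set u := H *ᵥ (V *ᵥ w) - w with hudef
  -- As `H⁻¹ u = (V - H⁻¹) w`, pairing `u` with `w` in this form gives `‖u‖*² ≤ α ‖u‖* ‖w‖*`. The
  -- triangle inequality below then trades `‖w‖*` for the norm of `V w`.
  have hu2 : matNorm H⁻¹ u ^ 2 ≤ α * (matNorm H⁻¹ u * matNorm H⁻¹ w) := by
    have h1 := (abs_le.1 (abs_bilin_le hB hH.inv hBb u w)).2
    have h2 : H⁻¹ *ᵥ u = (V - H⁻¹) *ᵥ w := by rw [e, inv_mulVec_mulVec hH]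
    rwa [← h2, ← matNorm_sq hH.inv.posSemidef] at h1
  have hu0 := matNorm_nonneg H⁻¹ u
  have hw0 := matNorm_nonneg H⁻¹ w
  have hu1 : matNorm H⁻¹ u ≤ α * matNorm H⁻¹ w := by
    rcases hu0.eq_or_lt with h | h
    · rw [← h]; positivity
    · refine le_of_mul_le_mul_left ?_ h
      nlinarith
  have htri := matNorm_sub_le hH.inv (H *ᵥ (V *ᵥ w)) u
  rw [hudef, sub_sub_cancel, ← hudef, matNorm_mulVec hH] at htri
  have hd0 := matNorm_nonneg H (V *ᵥ w)
  nlinarith [mul_nonneg hα0 hw0, mul_nonneg hα0 hd0]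

/-- Since `H V w` is close to `w`, the pairing of `V w` with `w` nearly equals the squared local
norm of `V w`. -/
lemma sq_matNorm_le_dotProduct (hH : H.PosDef) (hα0 : 0 ≤ α) (hα : α ≤ 1 / 4)
    (hl : (V - (1 - α) • H⁻¹).PosSemidef) (hu : ((1 + α) • H⁻¹ - V).PosSemidef) (w : J → ℝ) :
    (1 - 2 * α) * matNorm H (V *ᵥ w) ^ 2 ≤ (V *ᵥ w) ⬝ᵥ w := by
  have h1 := dual_mulVec_sub_le hH hα0 hα hl hu w
  have h2 := dotProduct_le hH (H *ᵥ (V *ᵥ w) - w) (V *ᵥ w)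
  rw [sub_dotProduct, dotProduct_comm, ← matNorm_sq hH.posSemidef, dotProduct_comm w] at h2
  nlinarith [mul_le_mul_of_nonneg_right h1 (matNorm_nonneg H (V *ᵥ w))]

end Approximation

end Step

/-! ### One iteration -/

section Iteration

open scoped Matrix

/-- The potential of a state bounds the centrality of every block. -/
lemma gam_le_of_potential_le {ι : Type} [Fintype ι] {lam N : ℝ} (hlam : 0 < lam)
    (hN : N ≤ Real.exp (lam / 4096)) {γ : ι → ℝ} (h : ∑ i, Real.exp (lam * γ i) ≤ N) (i : ι) :
    γ i ≤ 1 / 4096 := by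
  have h1 : Real.exp (lam * γ i) ≤ Real.exp (lam / 4096) :=
    ((Finset.single_le_sum (f := fun j => Real.exp (lam * γ j)) (fun j _ => (Real.exp_pos _).le)
      (Finset.mem_univ i)).trans h).trans hN
  have h2 := Real.exp_le_exp.1 h1
  rw [div_eq_mul_inv] at h2
  have := le_of_mul_le_mul_left h2 hlam
  norm_num at this ⊢
  exact this

/-- An error of the step is small in the norm used for the potential. -/
lemma sqrt_sum_sq_error_le {ι : Type} [Fintype ι] {a νi : ι → ℝ} {α κ ν : ℝ}
    (hα : 0 ≤ α) (hκ : κ = α / 2 ^ 10)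
    (ha : √(∑ i, a i ^ 2) ≤ 1.01 * α) (hν : 0 < ν) (hν1 : ∀ i, 0 ≤ νi i)
    (hνs : ∑ i, νi i ≤ 1.5 * ν) :
    √(∑ i, (0.01 * a i + 4 * (κ / √ν) * √(νi i)) ^ 2) ≤ 0.03 * α := by
  rw [Real.sqrt_le_left (by positivity)]
  have hs := Real.sqrt_pos.2 hν
  have h1 : ∑ i, a i ^ 2 ≤ (1.01 * α) ^ 2 := (Real.sqrt_le_left (by positivity)).1 ha
  have h2 : (κ / √ν) ^ 2 * ∑ i, νi i ≤ 1.5 * κ ^ 2 := by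
    rw [div_pow, Real.sq_sqrt hν.le, div_mul_eq_mul_div, div_le_iff₀ hν]
    nlinarith [mul_le_mul_of_nonneg_left hνs (sq_nonneg κ)]
  -- By `(p + q)² ≤ 2p² + 2q²`, which gives `2 * 0.01²` and `2 * 4²`.
  calc ∑ i, (0.01 * a i + 4 * (κ / √ν) * √(νi i)) ^ 2
      ≤ ∑ i, (0.0002 * a i ^ 2 + 32 * ((κ / √ν) ^ 2 * νi i)) := by
        refine Finset.sum_le_sum fun i _ => ?_
        nth_rw 2 [← Real.sq_sqrt (hν1 i)]
        nlinarith [sq_nonneg (0.01 * a i - 4 * (κ / √ν) * √(νi i))]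
    _ = 0.0002 * ∑ i, a i ^ 2 + 32 * ((κ / √ν) ^ 2 * ∑ i, νi i) := by
        rw [Finset.sum_add_distrib, ← Finset.mul_sum, ← Finset.mul_sum, ← Finset.mul_sum]
    _ ≤ (0.03 * α) ^ 2 := by
        have h3 : κ ^ 2 ≤ α ^ 2 / 2 ^ 20 := by rw [hκ]; ring_nf; rfl
        nlinarith [sq_nonneg α]

variable {ι : Type} [Fintype ι] [DecidableEq ι] {n : ι → ℕ} {d : ℕ}

/-- The norms of the blocks of a step are at most those of the centering direction. -/
lemma sqrt_sum_sq_step_le {P : BlockProgram ι n d} {x' h w : (Σ i, Fin (n i)) → ℝ}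
    {V : ∀ i, Matrix (Fin (n i)) (Fin (n i)) ℝ} {α : ℝ} (hH : ∀ i, (P.H x' i).PosDef)
    (hα0 : 0 ≤ α) (hα : α ≤ 1 / 10000)
    (hl : ∀ i, (V i - (1 - α) • (P.H x' i)⁻¹).PosSemidef)
    (hu : ∀ i, ((1 + α) • (P.H x' i)⁻¹ - V i).PosSemidef) {y : Fin d → ℝ}
    (hwy : w + P.Aᵀ *ᵥ y = h) (hA : P.A *ᵥ (Matrix.blockDiagonal' V *ᵥ w) = 0) :
    √(∑ i, matNorm (P.H x' i) (V i *ᵥ blk w i) ^ 2) ≤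
      1.01 * √(∑ i, matNorm (P.H x' i)⁻¹ (blk h i) ^ 2) := by
  set a : ι → ℝ := fun i => matNorm (P.H x' i) (V i *ᵥ blk w i) with ha
  set β : ι → ℝ := fun i => matNorm (P.H x' i)⁻¹ (blk h i) with hβ
  have h1 : (1 - 2 * α) * ∑ i, a i ^ 2 ≤ (Matrix.blockDiagonal' V *ᵥ w) ⬝ᵥ w := by
    rw [dotProduct_eq_sum_blk, Finset.mul_sum]
    refine Finset.sum_le_sum fun i _ => ?_
    rw [blk_blockDiagonal'_mulVec]
    exact sq_matNorm_le_dotProduct (hH i) hα0 (by linarith) (hl i) (hu i) _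
  -- The step lies in the kernel of `A`, so it is orthogonal to `Aᵀ y = h - w`.
  have h2 : (Matrix.blockDiagonal' V *ᵥ w) ⬝ᵥ w = (Matrix.blockDiagonal' V *ᵥ w) ⬝ᵥ h := by
    rw [← hwy, dotProduct_add, Matrix.dotProduct_mulVec _ P.Aᵀ, Matrix.vecMul_transpose, hA,
      zero_dotProduct, add_zero]
  have h3 : (Matrix.blockDiagonal' V *ᵥ w) ⬝ᵥ h ≤ √(∑ i, a i ^ 2) * √(∑ i, β i ^ 2) := by
    rw [dotProduct_eq_sum_blk]
    refine (Finset.sum_le_sum fun i _ => ?_).trans (Real.sum_mul_le_sqrt_mul_sqrt Finset.univ a β)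
    rw [blk_blockDiagonal'_mulVec, dotProduct_comm, mul_comm]
    exact dotProduct_le (hH i) _ _
  have hS : √(∑ i, a i ^ 2) ^ 2 = ∑ i, a i ^ 2 :=
    Real.sq_sqrt (Finset.sum_nonneg fun i _ => sq_nonneg _)
  rw [← hS] at h1
  have a0 := Real.sqrt_nonneg (∑ i, a i ^ 2)
  have b0 := Real.sqrt_nonneg (∑ i, β i ^ 2)
  set S := √(∑ i, a i ^ 2)
  set T := √(∑ i, β i ^ 2)
  rcases a0.eq_or_lt with h | h
  · rw [← h]; positivity
  · have h4 : (1 - 2 * α) * S ≤ T := by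
      refine le_of_mul_le_mul_left ?_ h
      nlinarith
    nlinarith

/-- An iteration keeps the iterates in the domain and the potential bounded. -/
theorem next_mem_and_potential_le {P : BlockProgram ι n d} {νi : ι → ℝ} {lam α κ ν : ℝ}
    (hB : ∀ i, IsSelfConcordantBarrier (νi i) (P.K i) (P.φ i)) (hν1 : ∀ i, 1 ≤ νi i)
    (hA : LinearIndependent ℝ P.A.row) (hlam : 2 ^ 15 ≤ lam) (hα : α = 1 / (2 ^ 20 * lam ^ 2))
    (hκ : κ = α / 2 ^ 10) (hν : 1 ≤ ν) (hνs : ∑ i, νi i ≤ 1.5 * ν)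
    (hcard : (4 * Fintype.card ι : ℝ) ≤ Real.exp (lam / 4096)) {σ : State ι n} (ht : 0 < σ.t)
    (hx : ∀ i, blk σ.x i ∈ interior (P.K i))
    (hΦ : P.potential lam σ.t σ.x σ.s ≤ 4 * Fintype.card ι)
    {x' s' : (Σ i, Fin (n i)) → ℝ} {V : ∀ i, Matrix (Fin (n i)) (Fin (n i)) ℝ}
    (hap : P.Approx α σ x' s' V) :
    (∀ i, blk (P.next lam α κ ν σ x' s' V).x i ∈ interior (P.K i)) ∧
    P.potential lam (P.next lam α κ ν σ x' s' V).t (P.next lam α κ ν σ x' s' V).x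
      (P.next lam α κ ν σ x' s' V).s ≤ 4 * Fintype.card ι ∧
    P.A *ᵥ (P.next lam α κ ν σ x' s' V).x = P.A *ᵥ σ.x ∧
    ∃ y, (P.next lam α κ ν σ x' s' V).s = σ.s + P.Aᵀ *ᵥ y := by
  have hlam0 : 0 < lam := by norm_num at hlam; linarith
  have hα0 : 0 < α := by rw [hα]; positivity
  have hα1 : α ≤ 1 / 10000 := by
    rw [hα]
    apply one_div_le_one_div_of_le (by norm_num)
    norm_num at hlam ⊢
    nlinarith
  have hsα : √α = 1 / (2 ^ 10 * lam) := by
    rw [hα, show (1 : ℝ) / (2 ^ 20 * lam ^ 2) = (1 / (2 ^ 10 * lam)) ^ 2 by ring,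
      Real.sqrt_sq (by positivity)]
  have hsα0 : 0 < √α := Real.sqrt_pos.2 hα0
  have hsα2 : √α * √α = α := Real.mul_self_sqrt hα0.le
  have hsα1 : √α ≤ 1 / 100 := by
    rw [hsα]
    apply one_div_le_one_div_of_le (by norm_num)
    norm_num at hlam ⊢
    nlinarith
  have hla : lam * α ≤ 1 / 2 ^ 20 := by
    have : lam * α = 1 / (2 ^ 20 * lam) := by rw [hα]; field_simp
    rw [this]
    apply one_div_le_one_div_of_le (by norm_num)
    norm_num at hlam ⊢
    linarith
  have hlow : lam * (96 * √α) ≤ 3 / 32 := by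
    rw [hsα]
    apply le_of_eq
    field_simp
    norm_num
  have hH : ∀ i, (P.H x' i).PosDef := fun i => (hB i).hess_posDef _ (hap.mem i)
  have hV : ∀ i, (V i).PosDef := fun i =>
    posDef_of_sub_smul_inv (hH i) (by linarith) (hap.lower i)
  set h := P.dir lam α σ.t x' s' with hh
  obtain ⟨w, y, hwy, hX, hS, hAX⟩ := exists_step_decomposition hA (posDef_blockDiagonal' hV) σ.t h
  rw [hX] at hAX
  set η := κ / √ν with hη
  have hκ0 : 0 < κ := by rw [hκ]; positivity
  have hη0 : 0 ≤ η := by positivity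
  have hη1 : η ≤ 1 / 4 := by
    have h1 : η ≤ κ := div_le_self hκ0.le (Real.one_le_sqrt.2 hν)
    have h2 : κ ≤ α := by rw [hκ]; exact div_le_self hα0.le (by norm_num)
    linarith
  set γ : ι → ℝ := P.gam σ.t σ.x σ.s with hγdef
  set γ₁ : ι → ℝ := P.gam σ.t x' s' with hγ₁def
  have hγ : ∀ i, γ i ≤ 1 / 4096 := gam_le_of_potential_le hlam0 hcard hΦ
  have hq : ∀ i, matNorm (P.H x' i)⁻¹ (σ.t⁻¹ • blk s' i - σ.t⁻¹ • blk σ.s i) ≤ α := by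
    intro i
    rw [← smul_sub, matNorm_smul, abs_of_pos (inv_pos.2 ht), inv_mul_le_iff₀ ht]
    exact (hap.near_s i).le
  have hγ₁ : ∀ i, |γ₁ i - γ i| ≤ 3 * α := fun i =>
    (hB i).abs_gam_sub_le (hap.mem i) hα1 (hap.near_x i) (hq i) ((hγ i).trans (by norm_num))
  set S := √(∑ j, Real.exp (2 * lam * γ₁ j)) with hSdef
  have hS0 : 0 ≤ S := Real.sqrt_nonneg _
  -- `θ i` is the fraction of `μ_i` that the step removes, and `β i` is the dual norm of `h_i`.
  set θ : ι → ℝ := fun i => α * P.coef lam α σ.t x' s' i with hθ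
  set β : ι → ℝ := fun i => θ i * γ₁ i with hβ
  have hγ₁0 : ∀ i, 0 ≤ γ₁ i := fun i => matNorm_nonneg _ _
  have hcoef : ∀ i, P.coef lam α σ.t x' s' i = if 96 * √α ≤ γ₁ i then
      (Real.exp (lam * γ₁ i) / γ₁ i) / S else 0 := fun i => by
    rw [BlockProgram.coef]
  have hβeq : ∀ i, β i = if 96 * √α ≤ γ₁ i then α * (Real.exp (lam * γ₁ i) / S) else 0 := by
    intro i
    simp only [hβ, hθ, hcoef i]
    split_ifs with hc
    · have : γ₁ i ≠ 0 := by
        have : 0 < γ₁ i := by linarith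
        exact this.ne'
      field_simp
    · ring
  have hθ0 : ∀ i, 0 ≤ θ i := by
    intro i
    simp only [hθ, hcoef i]
    split_ifs with hc
    · exact mul_nonneg hα0.le (div_nonneg (div_nonneg (Real.exp_pos _).le (hγ₁0 i)) hS0)
    · simp
  have hexpS : ∀ i, Real.exp (lam * γ₁ i) ^ 2 = Real.exp (2 * lam * γ₁ i) := fun i => by
    rw [← Real.exp_nat_mul]
    push_cast
    ring_nf
  have hsumpos : 0 ≤ ∑ j, Real.exp (2 * lam * γ₁ j) :=
    Finset.sum_nonneg fun j _ => (Real.exp_pos _).le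
  have hβ0 : ∀ i, 0 ≤ β i := fun i => mul_nonneg (hθ0 i) (hγ₁0 i)
  have hβle : ∀ i, β i ≤ α * (Real.exp (lam * γ₁ i) / S) := by
    intro i
    rw [hβeq i]
    split_ifs
    · exact le_rfl
    · exact mul_nonneg hα0.le (div_nonneg (Real.exp_pos _).le hS0)
  have hβsum : ∑ i, β i ^ 2 ≤ α ^ 2 := by
    calc ∑ i, β i ^ 2 ≤ ∑ i, α ^ 2 * (Real.exp (2 * lam * γ₁ i) / S ^ 2) := by
          refine Finset.sum_le_sum fun i _ => ?_
          rw [← hexpS, ← div_pow, ← mul_pow]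
          exact pow_le_pow_left₀ (hβ0 i) (hβle i) 2
      _ = α ^ 2 * ((∑ i, Real.exp (2 * lam * γ₁ i)) / S ^ 2) := by
          rw [← Finset.mul_sum, Finset.sum_div]
      _ ≤ α ^ 2 := by
          rw [hSdef, Real.sq_sqrt hsumpos]
          exact mul_le_of_le_one_right (sq_nonneg α) (div_self_le_one _)
  have hβα : ∀ i, β i ≤ α := fun i => by
    have h1 : β i ^ 2 ≤ α ^ 2 :=
      (Finset.single_le_sum (f := fun j => β j ^ 2) (fun j _ => sq_nonneg _)
        (Finset.mem_univ i)).trans hβsum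
    exact (pow_le_pow_iff_left₀ (hβ0 i) hα0.le two_ne_zero).1 h1
  -- This is the purpose of freezing blocks with small `γ`: above the cutoff, `θ ≤ β/(96√α)`. It
  -- yields `θ ≤ 1` and makes the error `6αθ` a small fraction of the gain `β`.
  have hθβ : ∀ i, 96 * √α * θ i ≤ β i := by
    intro i
    by_cases hc : 96 * √α ≤ γ₁ i
    · calc 96 * √α * θ i ≤ γ₁ i * θ i := mul_le_mul_of_nonneg_right hc (hθ0 i)
        _ = β i := mul_comm _ _
    · have : θ i = 0 := by simp only [hθ, hcoef i, if_neg hc, mul_zero]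
      rw [this, mul_zero]
      exact hβ0 i
  have hθ1 : ∀ i, θ i ≤ 1 := by
    intro i
    have h1 : √α * (96 * θ i) ≤ √α * √α := by rw [hsα2]; linarith [hθβ i, hβα i]
    have h2 := le_of_mul_le_mul_left h1 hsα0
    linarith
  have hαθ : ∀ i, 6 * α * θ i ≤ 0.01 * β i := by
    intro i
    have h1 : √α * (√α * (6 * θ i)) = 6 * α * θ i := by rw [← mul_assoc, hsα2]; ring
    rw [← h1]
    have h2 : √α * (6 * θ i) ≤ β i := by
      nlinarith [hθβ i, mul_nonneg hsα0.le (hθ0 i)]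
    have h3 : 0 ≤ √α * (6 * θ i) := mul_nonneg hsα0.le (by linarith [hθ0 i])
    nlinarith
  have hhblk : ∀ i, blk h i = -θ i • P.mu σ.t x' s' i := fun i => by
    funext j
    simp only [hh, blk, BlockProgram.dir, hθ, Pi.smul_apply, smul_eq_mul]
    ring
  have hhβ : ∀ i, matNorm (P.H x' i)⁻¹ (blk h i) = β i := fun i => by
    rw [hhblk, matNorm_smul, abs_neg, abs_of_nonneg (hθ0 i)]
    rfl
  set a : ι → ℝ := fun i => matNorm (P.H x' i) (V i *ᵥ blk w i) with ha
  have hasum : √(∑ i, a i ^ 2) ≤ 1.01 * α := by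
    refine (sqrt_sum_sq_step_le hH hα0.le hα1 hap.lower hap.upper hwy hAX).trans ?_
    simp only [hhβ]
    refine mul_le_mul_of_nonneg_left ?_ (by norm_num)
    rw [Real.sqrt_le_left hα0.le]
    exact hβsum
  have ha0 : ∀ i, 0 ≤ a i := fun i => matNorm_nonneg _ _
  have haα : ∀ i, a i ≤ 2 * α := fun i => by
    have h1 : a i ≤ √(∑ i, a i ^ 2) := Real.le_sqrt_of_sq_le
      (Finset.single_le_sum (f := fun j => a j ^ 2) (fun j _ => sq_nonneg _) (Finset.mem_univ i))
    linarith
  have hwg : ∀ i, blk w i + blk (P.Aᵀ *ᵥ y) i = -θ i • P.mu σ.t x' s' i := fun i => by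
    rw [← hhblk, ← hwy]
    rfl
  have hstep := fun i => (hB i).gam_step_le (hap.mem i) (hx i) hα1 (hap.near_x i) (hq i) (hγ i)
    (hθ0 i) (hθ1 i) (hwg i) (dual_mulVec_sub_le (hH i) hα0.le (by linarith) (hap.lower i)
      (hap.upper i) (blk w i)) (haα i)
  have hxn : ∀ i, blk (P.next lam α κ ν σ x' s' V).x i = blk σ.x i + V i *ᵥ blk w i := fun i => by
    rw [← blk_blockDiagonal'_mulVec, ← hX]
    rfl
  have hsn' : (P.next lam α κ ν σ x' s' V).s = σ.s + σ.t • P.Aᵀ *ᵥ y := by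
    rw [← hS]
    rfl
  have htn : (P.next lam α κ ν σ x' s' V).t = (1 - η) * σ.t := rfl
  have hγn : ∀ i, P.gam (P.next lam α κ ν σ x' s' V).t (P.next lam α κ ν σ x' s' V).x
      (P.next lam α κ ν σ x' s' V).s i ≤ γ i - 0.99 * β i + (0.01 * a i + 4 * η * √(νi i)) := by
    intro i
    obtain ⟨hin, hle⟩ := hstep i
    have hle1 : matNorm (hess (P.φ i) (blk σ.x i + V i *ᵥ blk w i))⁻¹
        (σ.t⁻¹ • blk σ.s i + blk (P.Aᵀ *ᵥ y) i +
          grad (P.φ i) (blk σ.x i + V i *ᵥ blk w i)) ≤ γ i - 0.99 * β i + 0.01 * a i := by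
      change _ ≤ γ i - β i + 6 * α * θ i + 0.01 * a i at hle
      linarith [hαθ i]
    have hr := (hB i).gam_rescale_le hin (hν1 i) hη0 hη1
      (q := σ.t⁻¹ • blk σ.s i + blk (P.Aᵀ *ᵥ y) i) (by
        linarith [hγ i, hβ0 i, haα i])
    rw [BlockProgram.gam, BlockProgram.mu, BlockProgram.H, hxn i, hsn', htn]
    have e : ((1 - η) * σ.t)⁻¹ • blk (σ.s + σ.t • P.Aᵀ *ᵥ y) i =
        (1 - η)⁻¹ • (σ.t⁻¹ • blk σ.s i + blk (P.Aᵀ *ᵥ y) i) := by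
      have : blk (σ.s + σ.t • P.Aᵀ *ᵥ y) i = blk σ.s i + σ.t • blk (P.Aᵀ *ᵥ y) i := rfl
      rw [this, mul_inv, mul_smul, smul_add σ.t⁻¹, smul_smul σ.t⁻¹, inv_mul_cancel₀ ht.ne',
        one_smul]
    rw [e]
    linarith
  refine ⟨fun i => ?_, ?_, ?_, σ.t • y, ?_⟩
  · rw [hxn i]
    exact (hstep i).1
  · exact sum_exp_le_of_step hlam0 hα0 hla hlow hγ₁ hβeq
      (fun i => add_nonneg (by linarith [ha0 i]) (by positivity))
      (sqrt_sum_sq_error_le hα0.le hκ hasum (by linarith) (fun i => by linarith [hν1 i]) hνs)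
      hγn hΦ
  · change P.A *ᵥ (σ.x + _) = _
    rw [Matrix.mulVec_add, ← hh, hX, hAX, add_zero]
  · rw [hsn', Matrix.mulVec_smul]

end Iteration

/-! ### The logarithmic barrier of the half-line -/

section LogBarrier

open scoped Matrix

lemma interior_halfLine : interior {z : Fin 1 → ℝ | 0 ≤ z 0} = {z | 0 < z 0} := by
  have h := (isOpenMap_eval (X := fun _ : Fin 1 => ℝ) 0).preimage_interior_eq_interior_preimage
    (continuous_apply 0) (Set.Ici 0)
  rw [interior_Ici] at h
  exact h.symm

lemma contDiffAt_neg_log {z : Fin 1 → ℝ} (hz : 0 < z 0) {l : WithTop ℕ∞} :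
    ContDiffAt ℝ l (fun z : Fin 1 → ℝ => -Real.log (z 0)) z :=
  ((contDiff_apply ℝ ℝ (0 : Fin 1)).contDiffAt.log hz.ne').neg

/-- Here and for the next two derivatives, the value is read off from the derivative along a line,
by uniqueness of derivatives in one variable. -/
lemma grad_neg_log {z : Fin 1 → ℝ} (hz : 0 < z 0) (u : Fin 1 → ℝ) :
    grad (fun z : Fin 1 → ℝ => -Real.log (z 0)) z ⬝ᵥ u = -(u 0 / z 0) := by
  have hx : z + (0 : ℝ) • u = z := by simp
  have h1 := hasDerivAt_comp_line (v := u) (τ := 0) (x := z)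
    (φ := fun z : Fin 1 → ℝ => -Real.log (z 0)) (by rw [hx]; exact contDiffAt_neg_log hz)
  have h0 : HasDerivAt (fun τ : ℝ => z 0 + τ * u 0) (u 0) 0 := by
    simpa using ((hasDerivAt_id (0 : ℝ)).mul_const (u 0)).const_add (z 0)
  have h2 := (h0.log (by simpa using hz.ne')).neg
  rw [hx] at h1
  simpa using h1.unique h2

lemma quad_hess_neg_log {z : Fin 1 → ℝ} (hz : 0 < z 0) (u v : Fin 1 → ℝ) :
    u ⬝ᵥ hess (fun z : Fin 1 → ℝ => -Real.log (z 0)) z *ᵥ v = u 0 * v 0 / z 0 ^ 2 := by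
  have hx : z + (0 : ℝ) • u = z := by simp
  have h1 := hasDerivAt_grad_line (v := u) (τ := 0) (x := z)
    (φ := fun z : Fin 1 → ℝ => -Real.log (z 0)) (by rw [hx]; exact contDiffAt_neg_log hz) v
  have h0 : HasDerivAt (fun τ : ℝ => z 0 + τ * u 0) (u 0) 0 := by
    simpa using ((hasDerivAt_id (0 : ℝ)).mul_const (u 0)).const_add (z 0)
  have h2 : HasDerivAt (fun τ : ℝ => -(v 0 / (z 0 + τ * u 0))) (u 0 * v 0 / z 0 ^ 2) 0 := by
    have := ((hasDerivAt_const (0 : ℝ) (v 0)).div h0 (by simpa using hz.ne')).neg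
    refine HasDerivAt.congr_deriv this ?_
    rw [zero_mul, zero_mul, add_zero, zero_sub, neg_div, neg_neg, mul_comm]
  rw [hx] at h1
  refine h1.unique (h2.congr_of_eventuallyEq ?_)
  have hc : Tendsto (fun τ : ℝ => z 0 + τ * u 0) (𝓝 0) (𝓝 (z 0)) := by
    simpa using h0.continuousAt.tendsto
  filter_upwards [hc.eventually (lt_mem_nhds hz)] with τ hτ
  rw [grad_neg_log (by simpa using hτ)]
  simp

lemma third_neg_log {z : Fin 1 → ℝ} (hz : 0 < z 0) (u : Fin 1 → ℝ) :
    iteratedFDeriv ℝ 3 (fun z : Fin 1 → ℝ => -Real.log (z 0)) z ![u, u, u] =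
      -(2 * (u 0 / z 0) ^ 3) := by
  have hx : z + (0 : ℝ) • u = z := by simp
  have h1 := hasDerivAt_hess_line (v := u) (τ := 0) (x := z)
    (φ := fun z : Fin 1 → ℝ => -Real.log (z 0)) (by rw [hx]; exact contDiffAt_neg_log hz) u u
  have h0 : HasDerivAt (fun τ : ℝ => z 0 + τ * u 0) (u 0) 0 := by
    simpa using ((hasDerivAt_id (0 : ℝ)).mul_const (u 0)).const_add (z 0)
  have h2 : HasDerivAt (fun τ : ℝ => u 0 * u 0 / (z 0 + τ * u 0) ^ 2)
      (-(2 * (u 0 / z 0) ^ 3)) 0 := by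
    have := (hasDerivAt_const (0 : ℝ) (u 0 * u 0)).div (h0.pow 2) (by simpa using hz.ne')
    refine HasDerivAt.congr_deriv this ?_
    simp only [zero_mul, zero_sub, add_zero, Pi.pow_apply]
    field_simp
    norm_num
    ring
  rw [hx] at h1
  refine h1.unique (h2.congr_of_eventuallyEq ?_)
  have hc : Tendsto (fun τ : ℝ => z 0 + τ * u 0) (𝓝 0) (𝓝 (z 0)) := by
    simpa using h0.continuousAt.tendsto
  filter_upwards [hc.eventually (lt_mem_nhds hz)] with τ hτ
  rw [quad_hess_neg_log (by simpa using hτ)]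
  simp

/-- The local norm of `u` is `|u 0| / z 0`; the bound on the third derivative then holds with
equality. -/
theorem isSelfConcordantBarrier_neg_log :
    IsSelfConcordantBarrier 1 {z : Fin 1 → ℝ | 0 ≤ z 0} (fun z => -Real.log (z 0)) := by
  have hpd : ∀ z : Fin 1 → ℝ, 0 < z 0 →
      (hess (fun z : Fin 1 → ℝ => -Real.log (z 0)) z).PosDef := by
    intro z hz
    refine Matrix.PosDef.of_dotProduct_mulVec_pos ?_ fun u hu => ?_
    · ext i j
      rw [Subsingleton.elim i j]
      simp
    · rw [star_trivial, quad_hess_neg_log hz]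
      have : u 0 ≠ 0 := fun h => hu (funext fun i => by rw [Subsingleton.elim i 0, h]; rfl)
      have := mul_self_pos.2 this
      positivity
  have hnorm : ∀ z : Fin 1 → ℝ, 0 < z 0 → ∀ u,
      matNorm (hess (fun z : Fin 1 → ℝ => -Real.log (z 0)) z) u = |u 0| / z 0 := by
    intro z hz u
    rw [matNorm, quad_hess_neg_log hz, show u 0 * u 0 / z 0 ^ 2 = (u 0 / z 0) ^ 2 by ring,
      Real.sqrt_sq_eq_abs, abs_div, abs_of_pos hz]
  constructor
  · rw [interior_halfLine]
    exact fun z hz => (contDiffAt_neg_log hz).contDiffWithinAt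
  · intro z hz
    have hz0 : z 0 = 0 := by
      have hcl : IsClosed {z : Fin 1 → ℝ | 0 ≤ z 0} :=
        isClosed_le continuous_const (continuous_apply 0)
      rw [hcl.frontier_eq, interior_halfLine] at hz
      exact le_antisymm (not_lt.1 hz.2) hz.1
    rw [interior_halfLine, tendsto_neg_atTop_iff]
    refine Real.tendsto_log_nhdsGT_zero.comp (tendsto_nhdsWithin_iff.2 ⟨?_, ?_⟩)
    · have := (continuous_apply (A := fun _ : Fin 1 => ℝ) 0).tendsto z
      rw [hz0] at this
      exact this.mono_left nhdsWithin_le_nhds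
    · filter_upwards [self_mem_nhdsWithin] with y hy using hy
  · intro z hz
    rw [interior_halfLine] at hz
    exact hpd z hz
  · intro z hz u
    rw [interior_halfLine] at hz
    have hz' : 0 < z 0 := hz
    rw [third_neg_log hz, hnorm z hz, abs_neg, abs_mul, abs_pow, abs_div, abs_of_pos hz',
      abs_of_pos (zero_lt_two' ℝ)]
  · intro z hz
    rw [interior_halfLine] at hz
    have hz' : 0 < z 0 := hz
    rw [Real.sqrt_one]
    refine matNorm_inv_le (hpd z hz) zero_le_one fun u => ?_
    rw [grad_neg_log hz, hnorm z hz, one_mul, ← neg_div]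
    exact div_le_div_of_nonneg_right (neg_le_abs _) hz'.le

end LogBarrier

/-! ### Euclidean norms of vectors and blocks. -/

section EuclideanNorm

variable {J : Type} [Fintype J]

lemma l2Norm_nonneg (v : J → ℝ) : 0 ≤ l2Norm v := Real.sqrt_nonneg _

lemma l2Norm_sq (v : J → ℝ) : l2Norm v ^ 2 = ∑ j, v j ^ 2 :=
  Real.sq_sqrt (Finset.sum_nonneg fun _ _ => sq_nonneg _)

lemma dotProduct_le_l2Norm (u v : J → ℝ) : u ⬝ᵥ v ≤ l2Norm u * l2Norm v :=
  Real.sum_mul_le_sqrt_mul_sqrt _ _ _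

lemma abs_le_l2Norm (v : J → ℝ) (j : J) : |v j| ≤ l2Norm v := by
  apply Real.abs_le_sqrt
  exact Finset.single_le_sum (f := fun j => v j ^ 2) (fun j _ => sq_nonneg _) (Finset.mem_univ j)

lemma l2Norm_blk_le {ι : Type} [Fintype ι] {n : ι → ℕ} (x : (Σ i, Fin (n i)) → ℝ) (i : ι) :
    l2Norm (blk x i) ≤ l2Norm x := by
  apply Real.sqrt_le_sqrt
  rw [Fintype.sum_sigma]
  exact Finset.single_le_sum (f := fun i => ∑ j, x ⟨i, j⟩ ^ 2)
    (fun i _ => Finset.sum_nonneg fun j _ => sq_nonneg _) (Finset.mem_univ i)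

end EuclideanNorm

/-! ### Local norms, the analytic center and the duality gap -/

section Center

open scoped Matrix

variable {ι : Type} [DecidableEq ι] {n : ι → ℕ} {d : ℕ}

/-- The vector `x` with the `i`-th block replaced by `y`. -/
def setBlk (x : (Σ i, Fin (n i)) → ℝ) (i : ι) (y : Fin (n i) → ℝ) : (Σ i, Fin (n i)) → ℝ :=
  fun p => Function.update (fun i => blk x i) i y p.1 p.2

lemma blk_setBlk (x : (Σ i, Fin (n i)) → ℝ) (i : ι) (y : Fin (n i) → ℝ) (j : ι) :
    blk (setBlk x i y) j = Function.update (fun i => blk x i) i y j := rfl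

lemma blk_setBlk_same (x : (Σ i, Fin (n i)) → ℝ) (i : ι) (y : Fin (n i) → ℝ) :
    blk (setBlk x i y) i = y := by
  rw [blk_setBlk, Function.update_self]

lemma blk_setBlk_mem {S : ∀ i, Set (Fin (n i) → ℝ)} {x : (Σ i, Fin (n i)) → ℝ}
    (hx : ∀ i, blk x i ∈ S i) {i : ι} {y : Fin (n i) → ℝ} (hy : y ∈ S i) (j : ι) :
    blk (setBlk x i y) j ∈ S j := by
  rw [blk_setBlk]
  rcases eq_or_ne j i with rfl | h
  · rwa [Function.update_self]
  · rw [Function.update_of_ne h]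
    exact hx j

variable [Fintype ι]

/-- The sum separates: varying one block alone shows that `blk x₀ i` minimizes `φ_i` locally. -/
lemma grad_eq_zero_of_isAnalyticCenter {P : BlockProgram ι n d} {x₀ : (Σ i, Fin (n i)) → ℝ}
    (h : P.IsAnalyticCenter x₀) (i : ι) : grad (P.φ i) (blk x₀ i) = 0 := by
  have hmin : IsLocalMin (P.φ i) (blk x₀ i) := by
    filter_upwards [isOpen_interior.mem_nhds (h.1 i)] with y hy
    have h1 := h.2 (setBlk x₀ i y) (blk_setBlk_mem (S := fun i => interior (P.K i)) h.1 hy)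
    rw [← Finset.add_sum_erase _ _ (Finset.mem_univ i),
      ← Finset.add_sum_erase _ (fun j => P.φ j (blk (setBlk x₀ i y) j)) (Finset.mem_univ i),
      blk_setBlk_same] at h1
    have h2 : ∑ j ∈ Finset.univ.erase i, P.φ j (blk (setBlk x₀ i y) j) =
        ∑ j ∈ Finset.univ.erase i, P.φ j (blk x₀ j) := by
      refine Finset.sum_congr rfl fun j hj => ?_
      rw [blk_setBlk, Function.update_of_ne (Finset.ne_of_mem_erase hj)]
    rw [h2] at h1
    linarith
  funext j
  rw [grad, hmin.fderiv_eq_zero]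
  rfl

/-- In a ball of radius `R`, the local norms dominate the Euclidean norm up to the factor `R`. -/
lemma l2Norm_le_mul_matNorm {P : BlockProgram ι n d} {νi : ι → ℝ}
    (hB : ∀ i, IsSelfConcordantBarrier (νi i) (P.K i) (P.φ i)) {x₀ : (Σ i, Fin (n i)) → ℝ}
    (hx : ∀ i, blk x₀ i ∈ interior (P.K i)) {R : ℝ}
    (hR : ∀ x : (Σ i, Fin (n i)) → ℝ, (∀ i, blk x i ∈ P.K i) → l2Norm x ≤ R) (i : ι)
    (u : Fin (n i) → ℝ) : l2Norm u ≤ R * matNorm (P.H x₀ i) u := by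
  have hxK : ∀ i, blk x₀ i ∈ P.K i := fun i => interior_subset (hx i)
  have hR0 : 0 ≤ R := (l2Norm_nonneg _).trans (hR x₀ hxK)
  by_cases hu : u = 0
  · simp [hu, l2Norm, matNorm_zero]
  have hr : 0 < matNorm (P.H x₀ i) u := matNorm_pos ((hB i).hess_posDef _ (hx i)) hu
  -- Dikin's ellipsoid contains both `x₀ + ρ u` and `x₀ - ρ u` (in block `i`). Adding their squared
  -- norms cancels the cross term. Dikin's bound is strict, so `ρ` is later chosen strictly between
  -- two ratios.
  have key : ∀ ρ : ℝ, 0 ≤ ρ → ρ * matNorm (P.H x₀ i) u < 1 → ρ * l2Norm u ≤ R := by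
    intro ρ h0 h1
    have hin : ∀ ε : ℝ, |ε| = ρ → ∑ j, (blk x₀ i j + ε * u j) ^ 2 ≤ R ^ 2 := by
      intro ε hε
      have h2 : blk x₀ i + ε • u ∈ P.K i := by
        refine interior_subset ((hB i).add_mem_interior (hx i) ?_)
        rw [matNorm_smul, hε]
        exact h1
      have h3 := (l2Norm_blk_le _ i).trans
        (hR (setBlk x₀ i (blk x₀ i + ε • u)) (blk_setBlk_mem hxK h2))
      rw [blk_setBlk_same] at h3
      have h4 := pow_le_pow_left₀ (l2Norm_nonneg _) h3 2
      rwa [l2Norm_sq] at h4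
    have h2 := hin ρ (abs_of_nonneg h0)
    have h3 := hin (-ρ) (by rw [abs_neg, abs_of_nonneg h0])
    have h4 : ρ ^ 2 * ∑ j, u j ^ 2 + ρ ^ 2 * ∑ j, u j ^ 2 ≤
        ∑ j, (blk x₀ i j + ρ * u j) ^ 2 + ∑ j, (blk x₀ i j + -ρ * u j) ^ 2 := by
      rw [Finset.mul_sum, ← Finset.sum_add_distrib, ← Finset.sum_add_distrib]
      refine Finset.sum_le_sum fun j _ => ?_
      nlinarith [sq_nonneg (blk x₀ i j)]
    rw [← l2Norm_sq] at h4
    refine (pow_le_pow_iff_left₀ (mul_nonneg h0 (l2Norm_nonneg _)) hR0 two_ne_zero).1 ?_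
    rw [mul_pow]
    linarith
  by_contra! hcon
  have hl : 0 < l2Norm u := (mul_nonneg hR0 hr.le).trans_lt hcon
  have h1 : R / l2Norm u < 1 / matNorm (P.H x₀ i) u := by
    rw [div_lt_div_iff₀ hl hr]
    linarith
  obtain ⟨ρ, h2, h3⟩ := exists_between h1
  rw [div_lt_iff₀ hl] at h2
  rw [lt_div_iff₀ hr] at h3
  have h4 : 0 ≤ ρ := by
    by_contra! h
    have := mul_neg_of_neg_of_pos h hl
    linarith
  exact absurd (key ρ h4 h3) (not_le.2 h2)

end Center

section DualityGap

open scoped Matrix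

variable {ι : Type} [Fintype ι] {n : ι → ℕ} {d : ℕ}

/-- The duality gap at an approximately centered pair. -/
lemma dotProduct_sub_le_gap {P : BlockProgram ι n d} {νi : ι → ℝ}
    (hB : ∀ i, IsSelfConcordantBarrier (νi i) (P.K i) (P.φ i)) (hK : ∀ i, Convex ℝ (P.K i))
    (hν : ∀ i, 1 ≤ νi i) {t : ℝ} (ht : 0 < t) {x s z : (Σ i, Fin (n i)) → ℝ}
    (hx : ∀ i, blk x i ∈ interior (P.K i)) (hz : ∀ i, blk z i ∈ P.K i)
    (hA : P.A *ᵥ x = P.A *ᵥ z) {y : Fin d → ℝ} (hs : s = P.c + P.Aᵀ *ᵥ y)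
    (hγ : ∀ i, P.gam t x s i ≤ 1 / 3) :
    P.c ⬝ᵥ x - P.c ⬝ᵥ z ≤ 2 * t * ∑ i, νi i := by
  -- `s - c` lies in the row space of `A` and `x - z` in its kernel, so `s` may replace `c`.
  have h1 : P.c ⬝ᵥ x - P.c ⬝ᵥ z = s ⬝ᵥ (x - z) := by
    have h2 : (P.Aᵀ *ᵥ y) ⬝ᵥ (x - z) = 0 := by
      rw [dotProduct_comm, Matrix.dotProduct_mulVec, Matrix.vecMul_transpose, Matrix.mulVec_sub,
        hA, sub_self, zero_dotProduct]
    rw [hs, add_dotProduct, h2, add_zero, dotProduct_sub]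
  rw [h1, dotProduct_eq_sum_blk, Finset.mul_sum]
  refine Finset.sum_le_sum fun i _ => ?_
  have hp := (hB i).hess_posDef _ (hx i)
  have hsi : blk s i = t • (P.mu t x s i - grad (P.φ i) (blk x i)) := by
    rw [BlockProgram.mu, add_sub_cancel_right, smul_smul, mul_inv_cancel₀ ht.ne', one_smul]
  have hxz : blk (x - z) i = -(blk z i - blk x i) := by
    rw [neg_sub]
    rfl
  have hm := dotProduct_le hp (P.mu t x s i) (-(blk z i - blk x i))
  rw [matNorm_neg] at hm
  have hg := (hB i).grad_dotProduct_add_le (hK i) (hν i) (hx i) (hz i) (hγ i)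
  rw [hsi, hxz, smul_dotProduct, smul_eq_mul, sub_dotProduct, dotProduct_neg (grad _ _)]
  change _ ≤ P.gam t x s i * _ at hm
  have : P.mu t x s i ⬝ᵥ (-(blk z i - blk x i)) - -(grad (P.φ i) (blk x i) ⬝ᵥ
      (blk z i - blk x i)) ≤ 2 * νi i := by linarith
  calc _ ≤ t * (2 * νi i) := mul_le_mul_of_nonneg_left this ht.le
    _ = _ := by ring

end DualityGap

/-! ### Runs of the loop -/

section Runs

/-- The current iterates and the inverse Hessians are admissible approximations. -/
lemma BlockProgram.approx_self {ι : Type} {n : ι → ℕ} {d : ℕ} {P : BlockProgram ι n d}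
    {α : ℝ} {νi : ι → ℝ}
    (hB : ∀ i, IsSelfConcordantBarrier (νi i) (P.K i) (P.φ i)) (hα : 0 < α) {σ : State ι n}
    (ht : 0 < σ.t) (hx : ∀ i, blk σ.x i ∈ interior (P.K i)) :
    P.Approx α σ σ.x σ.s (fun i => (P.H σ.x i)⁻¹) := by
  have hH : ∀ i, ((P.H σ.x i)⁻¹).PosSemidef := fun i =>
    ((hB i).hess_posDef _ (hx i)).inv.posSemidef
  refine ⟨hx, fun i => ?_, fun i => ?_, fun i => ?_, fun i => ?_⟩
  · rw [sub_self, matNorm_zero]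
    exact hα
  · rw [sub_self, matNorm_zero]
    positivity
  · have : (P.H σ.x i)⁻¹ - (1 - α) • (P.H σ.x i)⁻¹ = α • (P.H σ.x i)⁻¹ := by
      rw [sub_smul, one_smul, sub_sub_cancel]
    rw [this]
    exact (hH i).smul hα.le
  · have : (1 + α) • (P.H σ.x i)⁻¹ - (P.H σ.x i)⁻¹ = α • (P.H σ.x i)⁻¹ := by
      rw [add_smul, one_smul, add_sub_cancel_left]
    rw [this]
    exact (hH i).smul hα.le

variable {ι : Type} [Fintype ι] [DecidableEq ι] {n : ι → ℕ} {d : ℕ} {P : BlockProgram ι n d}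
  {lam α κ ν τ : ℝ} {σ₀ : State ι n}

lemma BlockProgram.Reaches.t_eq {k : ℕ} {σ : State ι n} (h : P.Reaches lam α κ ν τ σ₀ k σ) :
    σ.t = (1 - κ / √ν) ^ k * σ₀.t := by
  induction h with
  | start => simp
  | iterate x' s' V _ _ _ ih =>
    rw [BlockProgram.next, ih, pow_succ]
    ring

/-- The exponent is `k - 1` because the guard was tested before the last decrease of `t`. -/
lemma BlockProgram.Reaches.lt_of_pos {k : ℕ} {σ : State ι n}
    (h : P.Reaches lam α κ ν τ σ₀ k σ) (hk : 0 < k) :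
    τ < (1 - κ / √ν) ^ (k - 1) * σ₀.t := by
  cases h with
  | start => exact absurd hk (lt_irrefl 0)
  | iterate x' s' V h1 h2 _ =>
    rw [Nat.add_sub_cancel, ← h1.t_eq]
    exact h2

/-- A loop that never gets stuck ends, or runs for any number of iterations. -/
lemma BlockProgram.exists_reaches
    (h : ∀ k σ, P.Reaches lam α κ ν τ σ₀ k σ → τ < σ.t → ∃ x' s' V, P.Approx α σ x' s' V) (k : ℕ) :
    (∃ σ, P.Reaches lam α κ ν τ σ₀ k σ) ∨ ∃ j σ, P.Reaches lam α κ ν τ σ₀ j σ ∧ σ.t ≤ τ := by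
  induction k with
  | zero => exact Or.inl ⟨σ₀, .start⟩
  | succ k ih =>
    rcases ih with ⟨σ, hσ⟩ | hj
    · rcases le_or_gt σ.t τ with ht | ht
      · exact Or.inr ⟨k, σ, hσ, ht⟩
      · obtain ⟨x', s', V, hap⟩ := h k σ hσ ht
        exact Or.inl ⟨_, .iterate x' s' V hσ ht hap⟩
    · exact Or.inr hj

end Runs

/-! ### The modified program -/

section Modified

open scoped Matrix

lemma extVec_dotProduct {ι : Type} [Fintype ι] {n : ι → ℕ} (x : (Σ i, Fin (n i)) → ℝ) (a : ℝ)
    (w : (Σ o, Fin (extDim n o)) → ℝ) :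
    extVec x a ⬝ᵥ w = x ⬝ᵥ restrict w + a * w ⟨none, 0⟩ := by
  simp only [dotProduct, restrict]
  rw [Fintype.sum_sigma, Fintype.sum_option, Fintype.sum_sigma, add_comm]
  congr 1
  exact Fin.sum_univ_one _

variable {ι : Type} [Fintype ι] {n : ι → ℕ} {d : ℕ} (P : BlockProgram ι n d)
  (x₀ : (Σ i, Fin (n i)) → ℝ) (L R δ : ℝ)

lemma modified_mulVec (w : (Σ o, Fin (extDim n o)) → ℝ) :
    (P.modified x₀ L R δ).A *ᵥ w =
      P.A *ᵥ restrict w + w ⟨none, 0⟩ • (P.b - P.A *ᵥ x₀) := by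
  funext r
  have := extVec_dotProduct (P.A r) (P.b r - (P.A *ᵥ x₀) r) w
  rw [mul_comm] at this
  exact this

lemma modified_c_dotProduct (w : (Σ o, Fin (extDim n o)) → ℝ) :
    (P.modified x₀ L R δ).c ⬝ᵥ w = δ / (L * R) * (P.c ⬝ᵥ restrict w) + w ⟨none, 0⟩ := by
  have := extVec_dotProduct ((δ / (L * R)) • P.c) 1 w
  rw [one_mul, smul_dotProduct, smul_eq_mul] at this
  exact this

/-- Dropping the last column is linear and carries the rows of `Ā` to those of `A`. -/
lemma linearIndependent_modified_row (h : LinearIndependent ℝ P.A.row) :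
    LinearIndependent ℝ (P.modified x₀ L R δ).A.row :=
  LinearIndependent.of_comp (LinearMap.funLeft ℝ ℝ
    (fun p : Σ i, Fin (n i) => (⟨some p.1, p.2⟩ : Σ o, Fin (extDim n o)))) h

variable {P x₀ L R δ}

lemma isSelfConcordantBarrier_modified {νi : ι → ℝ}
    (hB : ∀ i, IsSelfConcordantBarrier (νi i) (P.K i) (P.φ i)) (o : Option ι) :
    IsSelfConcordantBarrier (o.elim 1 νi) ((P.modified x₀ L R δ).K o)
      ((P.modified x₀ L R δ).φ o) := by
  cases o with
  | none => exact isSelfConcordantBarrier_neg_log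
  | some i => exact hB i

lemma convex_modified (hK : ∀ i, Convex ℝ (P.K i)) (o : Option ι) :
    Convex ℝ ((P.modified x₀ L R δ).K o) := by
  cases o with
  | none => exact convex_halfSpace_ge (LinearMap.proj (R := ℝ) (φ := fun _ : Fin 1 => ℝ) 0).isLinear 0
  | some i => exact hK i

lemma init_mem_interior (hx : ∀ i, blk x₀ i ∈ interior (P.K i)) (o : Option ι) :
    blk (extVec x₀ 1) o ∈ interior ((P.modified x₀ L R δ).K o) := by
  cases o with
  | none =>
    change _ ∈ interior {z : Fin 1 → ℝ | 0 ≤ z 0}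
    rw [interior_halfLine]
    exact zero_lt_one' ℝ
  | some i => exact hx i

/-- In the extra block `1 - 1 = 0`. In the others only the scaled cost remains, and the Euclidean
norm is at most `R` times the local norm. -/
lemma gam_init_le [DecidableEq ι] {νi : ι → ℝ}
    (hB : ∀ i, IsSelfConcordantBarrier (νi i) (P.K i) (P.φ i)) (hc : P.IsAnalyticCenter x₀)
    (hR : ∀ x : (Σ i, Fin (n i)) → ℝ, (∀ i, blk x i ∈ P.K i) → l2Norm x ≤ R) (hR0 : 0 ≤ R)
    (hL : l2Norm P.c ≤ L) (hδ : 0 ≤ δ) (o : Option ι) :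
    (P.modified x₀ L R δ).gam 1 (extVec x₀ 1) (P.modified x₀ L R δ).c o ≤ δ := by
  have hL0 : 0 ≤ L := (l2Norm_nonneg _).trans hL
  -- Only an inequality: if `L * R = 0`, the quotient is `0` by convention.
  have hdiv : δ / (L * R) * (L * R) ≤ δ := by
    rcases eq_or_ne (L * R) 0 with h | h
    · rw [h, mul_zero]
      exact hδ
    · rw [div_mul_cancel₀ _ h]
  cases o with
  | none =>
    have hmu : (P.modified x₀ L R δ).mu 1 (extVec x₀ 1) (P.modified x₀ L R δ).c none = 0 := by
      funext j
      have h1 := grad_neg_log (z := fun _ => 1) zero_lt_one (Pi.single j 1)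
      rw [dotProduct_single_one] at h1
      change (1 : ℝ)⁻¹ * 1 + grad (fun z : Fin 1 → ℝ => -Real.log (z 0)) (fun _ => 1) j = 0
      rw [h1, Subsingleton.elim j 0]
      simp
    rw [BlockProgram.gam, hmu, matNorm_zero]
    exact hδ
  | some i =>
    have hmu : (P.modified x₀ L R δ).mu 1 (extVec x₀ 1) (P.modified x₀ L R δ).c (some i) =
        (δ / (L * R)) • blk P.c i := by
      have h1 : (P.modified x₀ L R δ).mu 1 (extVec x₀ 1) (P.modified x₀ L R δ).c (some i) =
        (1 : ℝ)⁻¹ • ((δ / (L * R)) • blk P.c i) + grad (P.φ i) (blk x₀ i) := rfl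
      rw [h1, grad_eq_zero_of_isAnalyticCenter hc, inv_one, one_smul, add_zero]
    rw [BlockProgram.gam, hmu]
    change matNorm (P.H x₀ i)⁻¹ _ ≤ δ
    refine matNorm_inv_le ((hB i).hess_posDef _ (hc.1 i)) hδ fun u => ?_
    rw [smul_dotProduct, smul_eq_mul]
    have h1 : blk P.c i ⬝ᵥ u ≤ L * (R * matNorm (P.H x₀ i) u) :=
      (dotProduct_le_l2Norm _ _).trans (mul_le_mul ((l2Norm_blk_le _ i).trans hL)
        (l2Norm_le_mul_matNorm hB hc.1 hR i u) (l2Norm_nonneg _) hL0)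
    calc δ / (L * R) * (blk P.c i ⬝ᵥ u)
        ≤ δ / (L * R) * (L * (R * matNorm (P.H x₀ i) u)) :=
          mul_le_mul_of_nonneg_left h1 (by positivity)
      _ = δ / (L * R) * (L * R) * matNorm (P.H x₀ i) u := by ring
      _ ≤ δ * matNorm (P.H x₀ i) u :=
          mul_le_mul_of_nonneg_right (hdiv)
            (matNorm_nonneg _ _)

end Modified

/-! ### The parameters -/

section Parameters

variable {m : ℕ}

lemma half_le_log (hm : 2 ≤ m) : 1 / 2 ≤ Real.log m := by
  have h1 := Real.log_two_gt_d9
  have h2 : Real.log 2 ≤ Real.log m := Real.log_le_log two_pos (by exact_mod_cast hm)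
  linarith

lemma le_lamOf (hm : 2 ≤ m) : 2 ^ 15 ≤ lamOf m := by
  have := half_le_log hm
  rw [lamOf]
  norm_num
  linarith

lemma one_le_lamOf (hm : 2 ≤ m) : 1 ≤ lamOf m := le_trans (by norm_num) (le_lamOf hm)

lemma lamOf_le (hm : 2 ≤ m) : lamOf m ≤ 2 ^ 16 * m := by
  have : Real.log m ≤ m - 1 := Real.log_le_sub_one_of_pos (by positivity)
  rw [lamOf]
  norm_num
  linarith

/-- The factor `2^16` in `λ` makes the right side `m ^ 16`. -/
lemma card_le_exp (hm : 2 ≤ m) :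
    (4 * Fintype.card (Option (Fin m)) : ℝ) ≤ Real.exp (lamOf m / 4096) := by
  have hm' : (2 : ℝ) ≤ m := by exact_mod_cast hm
  have h1 : lamOf m / 4096 = (16 : ℕ) * Real.log m := by
    rw [lamOf]
    push_cast
    ring
  rw [h1, Real.exp_nat_mul, Real.exp_log (by linarith), Fintype.card_option, Fintype.card_fin]
  push_cast
  calc (4 * (m + 1) : ℝ) ≤ 2 ^ 15 * m := by linarith
    _ ≤ (m : ℝ) ^ 15 * m :=
        mul_le_mul_of_nonneg_right (pow_le_pow_left₀ two_pos.le hm' 15) (by linarith)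
    _ = (m : ℝ) ^ 16 := by ring

lemma alphaOf_pos (hm : 2 ≤ m) : 0 < alphaOf m := by
  have := one_le_lamOf hm
  rw [alphaOf]
  positivity

lemma alphaOf_le_one (hm : 2 ≤ m) : alphaOf m ≤ 1 := by
  have := one_le_lamOf hm
  rw [alphaOf, div_le_one (by positivity)]
  nlinarith

lemma kappaOf_eq (m : ℕ) : kappaOf m = 1 / (2 ^ 62 * Real.log m ^ 2) := by
  rw [kappaOf, alphaOf, lamOf, div_div]
  congr 1
  ring

lemma kappaOf_pos (hm : 2 ≤ m) : 0 < kappaOf m := div_pos (alphaOf_pos hm) (by norm_num)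

lemma kappaOf_lt_one (hm : 2 ≤ m) : kappaOf m < 1 := by
  rw [kappaOf, div_lt_one (by norm_num)]
  have := alphaOf_le_one hm
  norm_num
  linarith

lemma deltaOf_pos {δ : ℝ} (hm : 2 ≤ m) (hδ : 0 < δ) : 0 < deltaOf m δ :=
  lt_min (one_div_pos.2 (zero_lt_one.trans_le (one_le_lamOf hm))) hδ

lemma deltaOf_le (m : ℕ) (δ : ℝ) : deltaOf m δ ≤ δ := min_le_right _ _

lemma deltaOf_le_inv (m : ℕ) (δ : ℝ) : deltaOf m δ ≤ 1 / lamOf m := min_le_left _ _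

lemma deltaOf_le_one {δ : ℝ} (hm : 2 ≤ m) : deltaOf m δ ≤ 1 :=
  (deltaOf_le_inv m δ).trans ((div_le_one (zero_lt_one.trans_le (one_le_lamOf hm))).2
    (one_le_lamOf hm))

/-- Both `ν` and `1/δ'` are at most a constant times `Y = ν / min δ 1`, by `λ ≤ 2^16 m`. As `Y ≥ 2`,
the constant `2^34` is absorbed into `Y ^ 34`. -/
lemma inv_threshold_le {ν δ : ℝ} (hm : 2 ≤ m) (hν : m ≤ ν) (hδ : 0 < δ) :
    (threshold m ν δ)⁻¹ ≤ (ν / min δ 1) ^ 37 := by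
  have hm' : (2 : ℝ) ≤ m := by exact_mod_cast hm
  have hlam := one_le_lamOf hm
  set D := min δ 1 with hD
  have hD0 : 0 < D := lt_min hδ one_pos
  have hD1 : D ≤ 1 := min_le_right _ _
  set Y := ν / D with hY
  have hYν : ν ≤ Y := by
    rw [hY, le_div_iff₀ hD0]
    nlinarith
  have hd : D / lamOf m ≤ deltaOf m δ :=
    le_min (div_le_div_of_nonneg_right hD1 (by linarith))
      ((div_le_self hD0.le hlam).trans (min_le_left _ _))
  have hd0 : 0 < D / lamOf m := by positivity
  have h1 : (deltaOf m δ)⁻¹ ≤ 2 ^ 16 * Y := by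
    calc (deltaOf m δ)⁻¹ ≤ (D / lamOf m)⁻¹ := inv_anti₀ hd0 hd
      _ = lamOf m / D := inv_div _ _
      _ ≤ 2 ^ 16 * ν / D := div_le_div_of_nonneg_right ((lamOf_le hm).trans (by linarith)) hD0.le
      _ = 2 ^ 16 * Y := by rw [hY, mul_div_assoc]
  have hi : 0 ≤ (deltaOf m δ)⁻¹ := inv_nonneg.2 (hd0.le.trans hd)
  have hY2 : 2 ≤ Y := by linarith
  calc (threshold m ν δ)⁻¹ = 4 * ν * (deltaOf m δ)⁻¹ ^ 2 := by
        rw [threshold, inv_div, div_eq_mul_inv, inv_pow]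
    _ ≤ 4 * Y * (2 ^ 16 * Y) ^ 2 := by gcongr
    _ = 2 ^ 34 * Y ^ 3 := by ring
    _ ≤ Y ^ 34 * Y ^ 3 :=
        mul_le_mul_of_nonneg_right (pow_le_pow_left₀ two_pos.le hY2 34) (by positivity)
    _ = Y ^ 37 := by ring

/-- The number of iterations until the path parameter is below the threshold. -/
lemma iterations_le {ν δ : ℝ} (hm : 2 ≤ m) (hν : m ≤ ν) (hδ : 0 < δ) {k : ℕ}
    (h : 0 < k → threshold m ν δ < (1 - kappaOf m / √ν) ^ (k - 1)) :
    (k : ℝ) ≤ (37 * 2 ^ 62 + 8) * (√ν * Real.log m ^ 2 * Real.log (ν / min δ 1)) := by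
  have hm' : (2 : ℝ) ≤ m := by exact_mod_cast hm
  have hD0 : 0 < min δ 1 := lt_min hδ one_pos
  have hs : 1 ≤ √ν := Real.one_le_sqrt.2 (by linarith)
  have hl := half_le_log hm
  have hX : 1 / 2 ≤ Real.log (ν / min δ 1) := by
    refine hl.trans (Real.log_le_log (by linarith) (hν.trans ?_))
    rw [le_div_iff₀ hD0]
    nlinarith [min_le_right δ 1]
  set X := Real.log (ν / min δ 1) with hXdef
  have hl2 : 1 / 4 ≤ Real.log m ^ 2 := by nlinarith
  -- This lower bound lets `8` times the product absorb the `1` in `k = (k - 1) + 1`.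
  have hbase : 1 / 8 ≤ √ν * Real.log m ^ 2 * X := by
    have h1 : 1 / 4 ≤ √ν * Real.log m ^ 2 := by nlinarith
    nlinarith
  rcases Nat.eq_zero_or_pos k with rfl | hk
  · push_cast
    positivity
  have hτ0 : 0 < threshold m ν δ := by
    have := deltaOf_pos hm hδ
    rw [threshold]
    have : 0 < ν := by linarith
    positivity
  have h1 := Real.log_lt_log hτ0 (h hk)
  have hη : kappaOf m / √ν < 1 := by
    rw [div_lt_one (by linarith)]
    linarith [kappaOf_lt_one hm]
  rw [Real.log_pow] at h1
  have h2 : Real.log (1 - kappaOf m / √ν) ≤ -(kappaOf m / √ν) := by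
    have := Real.log_le_sub_one_of_pos (show 0 < 1 - kappaOf m / √ν by linarith)
    linarith
  have h3 : -Real.log (threshold m ν δ) ≤ 37 * X := by
    rw [← Real.log_inv, hXdef, show (37 : ℝ) = (37 : ℕ) by norm_num, ← Real.log_pow]
    exact Real.log_le_log (inv_pos.2 hτ0) (inv_threshold_le hm hν hδ)
  have hk1 : ((k - 1 : ℕ) : ℝ) = k - 1 := by
    rw [Nat.cast_sub hk, Nat.cast_one]
  rw [hk1] at h1
  have hk0 : (0 : ℝ) ≤ k - 1 := by
    rw [← hk1]
    positivity
  have h4 : (k - 1 : ℝ) * (kappaOf m / √ν) ≤ 37 * X := by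
    nlinarith [mul_le_mul_of_nonneg_left h2 hk0]
  have h5 : kappaOf m / √ν * (2 ^ 62 * (√ν * Real.log m ^ 2)) = 1 := by
    rw [kappaOf_eq]
    have : Real.log m ≠ 0 := by linarith
    field_simp
  have h6 : (k - 1 : ℝ) ≤ 37 * X * (2 ^ 62 * (√ν * Real.log m ^ 2)) := by
    calc (k - 1 : ℝ) = (k - 1 : ℝ) * (kappaOf m / √ν) * (2 ^ 62 * (√ν * Real.log m ^ 2)) := by
          rw [mul_assoc, h5, mul_one]
      _ ≤ _ := mul_le_mul_of_nonneg_right h4 (by positivity)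
  linarith

end Parameters

/-! ### The algorithm -/

section Algorithm

open scoped Matrix

variable {m : ℕ} {n : Fin m → ℕ} {d : ℕ} {P : BlockProgram (Fin m) n d} {ν : Fin m → ℝ}
  {x₀ : (Σ i, Fin (n i)) → ℝ} {L R δ : ℝ}

lemma le_sum_nu (hν : ∀ i, 1 ≤ ν i) : (m : ℝ) ≤ ∑ i, ν i := by
  calc (m : ℝ) = ∑ _i : Fin m, (1 : ℝ) := by simp
    _ ≤ _ := Finset.sum_le_sum fun i _ => hν i

/-- The invariant of the loop. -/
theorem reaches_invariant (hm : 2 ≤ m)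
    (hB : ∀ i, IsSelfConcordantBarrier (ν i) (P.K i) (P.φ i)) (hν : ∀ i, 1 ≤ ν i)
    (hA : LinearIndependent ℝ P.A.row) (hc : P.IsAnalyticCenter x₀)
    (hR : ∀ x : (Σ i, Fin (n i)) → ℝ, (∀ i, blk x i ∈ P.K i) → l2Norm x ≤ R) (hR0 : 0 ≤ R)
    (hL : l2Norm P.c ≤ L) (hδ : 0 < δ) {k : ℕ} {σ : State (Option (Fin m)) (extDim n)}
    (h : P.IPMReaches (∑ i, ν i) x₀ L R δ k σ) :
    0 < σ.t ∧ (∀ o, blk σ.x o ∈ interior ((P.work x₀ L R δ).K o)) ∧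
    (P.work x₀ L R δ).potential (lamOf m) σ.t σ.x σ.s ≤ 4 * Fintype.card (Option (Fin m)) ∧
    (P.work x₀ L R δ).A *ᵥ σ.x = P.b ∧
    ∃ y, σ.s = (P.work x₀ L R δ).c + (P.work x₀ L R δ).Aᵀ *ᵥ y := by
  have hm' : (2 : ℝ) ≤ m := by exact_mod_cast hm
  have hνm := le_sum_nu hν
  unfold BlockProgram.IPMReaches at h
  induction h with
  | start =>
    refine ⟨zero_lt_one' ℝ, init_mem_interior hc.1, ?_, ?_, 0, ?_⟩
    · have hlam := one_le_lamOf hm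
      have hg : ∀ o, Real.exp (lamOf m * (P.work x₀ L R δ).gam 1 (extVec x₀ 1)
          (P.work x₀ L R δ).c o) ≤ 4 := by
        intro o
        have h1 := gam_init_le hB hc hR hR0 hL (deltaOf_pos hm hδ).le o
        have h2 : lamOf m * (P.work x₀ L R δ).gam 1 (extVec x₀ 1) (P.work x₀ L R δ).c o ≤ 1 := by
          calc _ ≤ lamOf m * (1 / lamOf m) :=
                mul_le_mul_of_nonneg_left (h1.trans (deltaOf_le_inv m δ)) (by linarith)
            _ = 1 := mul_one_div_cancel (by linarith)
        refine (Real.exp_le_exp.2 h2).trans ?_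
        linarith [Real.exp_one_lt_d9]
      calc _ ≤ ∑ _o : Option (Fin m), (4 : ℝ) := Finset.sum_le_sum fun o _ => hg o
        _ = _ := by simp [mul_comm]
    · have := modified_mulVec P x₀ L R (deltaOf m δ) (extVec x₀ 1)
      refine this.trans ?_
      change P.A *ᵥ x₀ + (1 : ℝ) • (P.b - P.A *ᵥ x₀) = P.b
      rw [one_smul, add_sub_cancel]
    · rw [Matrix.mulVec_zero, add_zero]
      rfl
  | iterate x' s' V _ _ hap ih =>
    obtain ⟨ht, hx, hΦ, hAx, y, hs⟩ := ih
    have hη : kappaOf m / √(∑ i, ν i) < 1 := by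
      have hs : 1 ≤ √(∑ i, ν i) := Real.one_le_sqrt.2 (by linarith)
      rw [div_lt_one (by linarith)]
      linarith [kappaOf_lt_one hm]
    -- The extra block raises the total parameter to `1 + ν ≤ 1.5 ν`, as `ν ≥ m ≥ 2`.
    obtain ⟨h1, h2, h3, y', h4⟩ := next_mem_and_potential_le (κ := kappaOf m) (ν := ∑ i, ν i)
      (isSelfConcordantBarrier_modified hB)
      (fun o => by
        cases o with
        | none => exact le_rfl
        | some i => exact hν i)
      (linearIndependent_modified_row P x₀ L R (deltaOf m δ) hA) (le_lamOf hm) rfl rfl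
      (by linarith) (by
        rw [Fintype.sum_option]
        simp only [Option.elim]
        linarith) (card_le_exp hm) ht hx hΦ hap
    refine ⟨mul_pos (by linarith) ht, h1, h2, h3.trans hAx, y + y', ?_⟩
    rw [Matrix.mulVec_add, ← add_assoc, ← hs]
    exact h4

/-- The error bounds at the end of the loop. -/
theorem approx_solution_of_le_threshold (hm : 2 ≤ m)
    (hB : ∀ i, IsSelfConcordantBarrier (ν i) (P.K i) (P.φ i)) (hK : ∀ i, Convex ℝ (P.K i))
    (hν : ∀ i, 1 ≤ ν i) (hne : P.feasible.Nonempty) (hx₀ : ∀ i, blk x₀ i ∈ P.K i)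
    (hR : ∀ x : (Σ i, Fin (n i)) → ℝ, (∀ i, blk x i ∈ P.K i) → l2Norm x ≤ R) (hR0 : 0 ≤ R)
    (hL : l2Norm P.c ≤ L) (hδ : 0 < δ) {σ : State (Option (Fin m)) (extDim n)} (ht : 0 < σ.t)
    (hx : ∀ o, blk σ.x o ∈ interior ((P.work x₀ L R δ).K o))
    (hΦ : (P.work x₀ L R δ).potential (lamOf m) σ.t σ.x σ.s ≤ 4 * Fintype.card (Option (Fin m)))
    (hA : (P.work x₀ L R δ).A *ᵥ σ.x = P.b) {y : Fin d → ℝ}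
    (hs : σ.s = (P.work x₀ L R δ).c + (P.work x₀ L R δ).Aᵀ *ᵥ y)
    (hτ : σ.t ≤ threshold m (∑ i, ν i) δ) :
    (∀ z ∈ P.feasible, P.c ⬝ᵥ restrict σ.x ≤ P.c ⬝ᵥ z + L * R * δ) ∧
    l1Norm (P.A *ᵥ restrict σ.x - P.b) ≤ 3 * δ * (R * ∑ r, ∑ p, |P.A r p| + l1Norm P.b) ∧
    ∀ i, blk (restrict σ.x) i ∈ P.K i := by
  have hm' : (2 : ℝ) ≤ m := by exact_mod_cast hm
  have hνm := le_sum_nu hν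
  have hL0 : 0 ≤ L := (l2Norm_nonneg _).trans hL
  have hd0 := deltaOf_pos hm hδ
  have hd1 : deltaOf m δ ≤ 1 := deltaOf_le_one hm
  have hdδ := deltaOf_le m δ
  have hxK : ∀ i, blk (restrict σ.x) i ∈ P.K i := fun i => interior_subset (hx (some i))
  have ha0 : 0 < σ.x ⟨none, 0⟩ := by
    have h1 := hx none
    change _ ∈ interior {z : Fin 1 → ℝ | 0 ≤ z 0} at h1
    rw [interior_halfLine] at h1
    exact h1
  -- The comparison point is `z` with extra coordinate `0`, which is feasible for the modified
  -- program. The gap is `2t(1 + ν) ≤ 3tν`.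
  have hgap : ∀ z ∈ P.feasible, deltaOf m δ / (L * R) * (P.c ⬝ᵥ restrict σ.x - P.c ⬝ᵥ z) +
      σ.x ⟨none, 0⟩ ≤ 3 / 4 * deltaOf m δ ^ 2 := by
    intro z hz
    have hγ := gam_le_of_potential_le (zero_lt_one.trans_le (one_le_lamOf hm)) (card_le_exp hm) hΦ
    have h1 := dotProduct_sub_le_gap (z := extVec z 0) (isSelfConcordantBarrier_modified hB)
      (convex_modified hK)
      (fun o => by
        cases o with
        | none => exact le_rfl
        | some i => exact hν i) ht hx
      (fun o => by
        cases o with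
        | none => exact le_refl (0 : ℝ)
        | some i => exact hz.2 i)
      (by
        refine hA.trans ?_
        refine Eq.trans ?_ (modified_mulVec P x₀ L R (deltaOf m δ) (extVec z 0)).symm
        change P.b = P.A *ᵥ z + (0 : ℝ) • _
        rw [zero_smul, add_zero]
        exact hz.1.symm) hs (fun o => (hγ o).trans (by norm_num))
    have e1 := modified_c_dotProduct P x₀ L R (deltaOf m δ) σ.x
    have e2 : (P.modified x₀ L R (deltaOf m δ)).c ⬝ᵥ extVec z 0 = deltaOf m δ / (L * R) * (P.c ⬝ᵥ z) + 0 :=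
      modified_c_dotProduct P x₀ L R (deltaOf m δ) (extVec z 0)
    rw [e1, e2, Fintype.sum_option] at h1
    simp only [Option.elim] at h1
    have h2 : 2 * σ.t * (1 + ∑ i, ν i) ≤ 3 / 4 * deltaOf m δ ^ 2 := by
      have h3 : σ.t * (4 * ∑ i, ν i) ≤ deltaOf m δ ^ 2 := by
        rwa [threshold, le_div_iff₀ (by linarith)] at hτ
      nlinarith
    linarith
  have hcs : ∀ z ∈ P.feasible, |P.c ⬝ᵥ restrict σ.x - P.c ⬝ᵥ z| ≤ 2 * (L * R) := by
    intro z hz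
    have hb : ∀ w : (Σ i, Fin (n i)) → ℝ, (∀ i, blk w i ∈ P.K i) → |P.c ⬝ᵥ w| ≤ L * R := by
      intro w hw
      have hle : l2Norm P.c * l2Norm w ≤ L * R := mul_le_mul hL (hR w hw) (l2Norm_nonneg _) hL0
      rw [abs_le]
      constructor
      · have h1 := dotProduct_le_l2Norm P.c (-w)
        have h2 : l2Norm (-w) = l2Norm w := by simp [l2Norm]
        rw [dotProduct_neg, h2] at h1
        linarith
      · exact (dotProduct_le_l2Norm P.c w).trans hle
    refine (abs_sub _ _).trans ?_
    linarith [hb _ hxK, hb z hz.2]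
  have hLR := mul_nonneg hL0 hR0
  refine ⟨fun z hz => ?_, ?_, hxK⟩
  -- If `L R = 0` the rescaled cost is zero and the gap says nothing about `c`, but then `hcs` shows
  -- that the objective values agree.
  · rcases hLR.eq_or_lt with h | h
    · have h1 := (abs_le.1 (hcs z hz)).2
      rw [← h] at h1 ⊢
      linarith
    · have h1 := hgap z hz
      have h2 : deltaOf m δ / (L * R) * (P.c ⬝ᵥ restrict σ.x - P.c ⬝ᵥ z) ≤
          deltaOf m δ * deltaOf m δ := by nlinarith [sq_nonneg (deltaOf m δ)]
      rw [div_mul_eq_mul_div, div_le_iff₀ h, mul_assoc] at h2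
      have h3 := le_of_mul_le_mul_left h2 hd0
      nlinarith
  · obtain ⟨z, hz⟩ := hne
    -- The cost part of the gap is at least `-2δ'`, so the extra coordinate is at most `2δ' +
    -- (3/4)δ'² ≤ 3δ'`.
    have ha : σ.x ⟨none, 0⟩ ≤ 3 * deltaOf m δ := by
      have h1 := hgap z hz
      have h2 : deltaOf m δ / (L * R) * |P.c ⬝ᵥ restrict σ.x - P.c ⬝ᵥ z| ≤ 2 * deltaOf m δ := by
        rcases hLR.eq_or_lt with h | h
        · rw [← h, div_zero, zero_mul]
          linarith
        · rw [div_mul_eq_mul_div, div_le_iff₀ h]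
          nlinarith [hcs z hz]
      have h3 : 0 ≤ deltaOf m δ / (L * R) := div_nonneg hd0.le hLR
      have h4 := mul_le_mul_of_nonneg_left
        (neg_abs_le (P.c ⬝ᵥ restrict σ.x - P.c ⬝ᵥ z)) h3
      nlinarith
    have he : P.A *ᵥ restrict σ.x - P.b = -(σ.x ⟨none, 0⟩ • (P.b - P.A *ᵥ x₀)) := by
      have h1 := (modified_mulVec P x₀ L R (deltaOf m δ) σ.x).symm.trans hA
      rw [sub_eq_iff_eq_add, neg_add_eq_sub]
      exact eq_sub_of_add_eq h1
    have hxp : ∀ p, |x₀ p| ≤ R := fun p => (abs_le_l2Norm x₀ p).trans (hR x₀ hx₀)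
    have hb : ∀ r, |(P.b - P.A *ᵥ x₀) r| ≤ |P.b r| + R * ∑ p, |P.A r p| := by
      intro r
      refine (abs_sub _ _).trans (add_le_add le_rfl ?_)
      refine (Finset.abs_sum_le_sum_abs _ _).trans ?_
      rw [Finset.mul_sum]
      refine Finset.sum_le_sum fun p _ => ?_
      rw [abs_mul, mul_comm]
      exact mul_le_mul_of_nonneg_right (hxp p) (abs_nonneg _)
    calc l1Norm (P.A *ᵥ restrict σ.x - P.b)
        = σ.x ⟨none, 0⟩ * ∑ r, |(P.b - P.A *ᵥ x₀) r| := by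
          rw [he, l1Norm, Finset.mul_sum]
          refine Finset.sum_congr rfl fun r _ => ?_
          rw [Pi.neg_apply, abs_neg, Pi.smul_apply, smul_eq_mul, abs_mul, abs_of_pos ha0]
      _ ≤ 3 * δ * ∑ r, |(P.b - P.A *ᵥ x₀) r| :=
          mul_le_mul_of_nonneg_right (by linarith) (Finset.sum_nonneg fun r _ => abs_nonneg _)
      _ ≤ 3 * δ * ∑ r, (|P.b r| + R * ∑ p, |P.A r p|) :=
          mul_le_mul_of_nonneg_left (Finset.sum_le_sum fun r _ => hb r) (by linarith)
      _ = _ := by rw [Finset.sum_add_distrib, ← Finset.mul_sum, add_comm, l1Norm]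

end Algorithm

end RobustIPM

end

/-! ### The main theorem. -/

theorem theorem4p1 :
    ∃ C : ℝ, ∀ (m : ℕ) (n : Fin m → ℕ) (d : ℕ) (P : RobustIPM.BlockProgram (Fin m) n d)
      (ν : Fin m → ℝ) (x₀ : (Σ i, Fin (n i)) → ℝ) (L R δ : ℝ),
      2 ≤ m → (∀ i, 1 ≤ n i) →
      (∀ i, IsCompact (P.K i)) → (∀ i, Convex ℝ (P.K i)) →
      (∀ i, RobustIPM.IsSelfConcordantBarrier (ν i) (P.K i) (P.φ i)) →
      LinearIndependent ℝ P.A.row → P.feasible.Nonempty →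
      P.IsAnalyticCenter x₀ →
      (∀ x : (Σ i, Fin (n i)) → ℝ, (∀ i, RobustIPM.blk x i ∈ P.K i) → RobustIPM.l2Norm x ≤ R) →
      RobustIPM.l2Norm P.c ≤ L → 0 < δ →
      -- every run keeps the potential bounded, stays in the domain, and never gets stuck
      (∀ k σ, P.IPMReaches (∑ i, ν i) x₀ L R δ k σ →
        (∀ o, RobustIPM.blk σ.x o ∈ interior ((P.work x₀ L R δ).K o)) ∧
        (P.work x₀ L R δ).potential (RobustIPM.lamOf m) σ.t σ.x σ.s
          ≤ 80 * (m / RobustIPM.alphaOf m) ∧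
        (RobustIPM.threshold m (∑ i, ν i) δ < σ.t →
          ∃ x' s' V, (P.work x₀ L R δ).Approx (RobustIPM.alphaOf m) σ x' s' V)) ∧
      -- no run makes more iterations than claimed
      (∀ k σ, P.IPMReaches (∑ i, ν i) x₀ L R δ k σ →
        (k : ℝ) ≤ C * (√(∑ i, ν i) * Real.log m ^ 2 * Real.log ((∑ i, ν i) / min δ 1))) ∧
      -- some run ends, and whatever a run returns is an approximate solution
      (∃ k x, P.IPMReturns (∑ i, ν i) x₀ L R δ k x) ∧
      (∀ k x, P.IPMReturns (∑ i, ν i) x₀ L R δ k x →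
        (∀ z ∈ P.feasible, P.c ⬝ᵥ x ≤ P.c ⬝ᵥ z + L * R * δ) ∧
        RobustIPM.l1Norm (P.A.mulVec x - P.b)
          ≤ 3 * δ * (R * ∑ r, ∑ p, |P.A r p| + RobustIPM.l1Norm P.b) ∧
        ∀ i, RobustIPM.blk x i ∈ P.K i) := by
  refine ⟨37 * 2 ^ 62 + 8, ?_⟩
  intro m n d P ν x₀ L R δ hm hn hKc hK hB hA hne hc hR hL hδ
  have hν : ∀ i, 1 ≤ ν i := fun i => (hB i).one_le_nu (hK i) (hKc i) (hn i) (hc.1 i)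
  have hx₀ : ∀ i, RobustIPM.blk x₀ i ∈ P.K i := fun i => interior_subset (hc.1 i)
  have hR0 : 0 ≤ R := (RobustIPM.l2Norm_nonneg _).trans (hR x₀ hx₀)
  have hνm := RobustIPM.le_sum_nu hν
  have hm' : (2 : ℝ) ≤ m := by exact_mod_cast hm
  have hinv : ∀ k σ, P.IPMReaches (∑ i, ν i) x₀ L R δ k σ → _ := fun k σ h =>
    RobustIPM.reaches_invariant hm hB hν hA hc hR hR0 hL hδ h
  have hα := RobustIPM.alphaOf_pos hm
  have happ : ∀ k σ, P.IPMReaches (∑ i, ν i) x₀ L R δ k σ →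
      RobustIPM.threshold m (∑ i, ν i) δ < σ.t →
      ∃ x' s' V, (P.work x₀ L R δ).Approx (RobustIPM.alphaOf m) σ x' s' V := by
    intro k σ h _
    obtain ⟨ht, hx, -⟩ := hinv k σ h
    exact ⟨_, _, _, RobustIPM.BlockProgram.approx_self
      (RobustIPM.isSelfConcordantBarrier_modified hB) hα ht hx⟩
  refine ⟨fun k σ h => ?_, fun k σ h => ?_, ?_, ?_⟩
  · obtain ⟨ht, hx, hΦ, -⟩ := hinv k σ h
    refine ⟨hx, hΦ.trans ?_, happ k σ h⟩
    have h1 : (m : ℝ) ≤ m / RobustIPM.alphaOf m := by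
      rw [le_div_iff₀ hα]
      nlinarith [RobustIPM.alphaOf_le_one hm]
    rw [Fintype.card_option, Fintype.card_fin]
    push_cast
    linarith
  · refine RobustIPM.iterations_le hm hνm hδ fun hk => ?_
    have h1 := RobustIPM.BlockProgram.Reaches.lt_of_pos h hk
    change _ < _ * (1 : ℝ) at h1
    rwa [mul_one] at h1
  · have hs : 1 ≤ √(∑ i, ν i) := Real.one_le_sqrt.2 (by linarith)
    have hκ := RobustIPM.kappaOf_pos hm
    have hη0 : 0 < RobustIPM.kappaOf m / √(∑ i, ν i) := by positivity
    have hη1 : RobustIPM.kappaOf m / √(∑ i, ν i) < 1 := by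
      rw [div_lt_one (by linarith)]
      linarith [RobustIPM.kappaOf_lt_one hm]
    have hτ : 0 < RobustIPM.threshold m (∑ i, ν i) δ :=
      div_pos (pow_pos (RobustIPM.deltaOf_pos hm hδ) 2) (by linarith)
    -- A run that reaches `k` iterations has `t` below the threshold; one that cannot be continued
    -- that far has ended earlier.
    obtain ⟨k, hk⟩ := exists_pow_lt_of_lt_one hτ
      (show 1 - RobustIPM.kappaOf m / √(∑ i, ν i) < 1 by linarith)
    rcases RobustIPM.BlockProgram.exists_reaches happ k with ⟨σ, hσ⟩ | ⟨j, σ, hσ, ht⟩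
    · refine ⟨k, _, σ, hσ, ?_, rfl⟩
      rw [RobustIPM.BlockProgram.Reaches.t_eq hσ]
      change _ * (1 : ℝ) ≤ _
      rw [mul_one]
      exact hk.le
    · exact ⟨j, _, σ, hσ, ht, rfl⟩
  · rintro k x ⟨σ, hσ, ht, rfl⟩
    obtain ⟨ht0, hx, hΦ, hAx, y, hs⟩ := hinv k σ hσ
    exact RobustIPM.approx_solution_of_le_threshold hm hB hK hν hne hx₀ hR hR0 hL hδ ht0 hx hΦ hAx
      hs ht
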